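/- Consider the non-relativistic Vlasov–Poisson system $$\partial_t f+v\cdot\partial_x f-\partial_xU\cdot\partial_v f=0,\qquad \Delta U=4\pi\rho,\quad \lim_{|x|\to\infty}U(t,x)=0,\qquad \rho(t,x)=\int_{\mathbb R^3} f(t,x,v)\,dv,$$ and the relativistic Vlasov–Poisson system, in which the term $v\cdot\partial_x f$ is replaced by $\frac{v}{\sqrt{1+|v|^2}}\cdot\partial_x f$. Measurable means Borel measurable. A function $g$ on $\mathbb R^3\times\mathbb R^3$ is *spherically symmetric* if $g(Ax,Av)=g(x,v)$ for all $x,v\in\mathbb R^3$ and $A\in\mathrm{SO}(3)$. Let $0<T\le\infty$. A measurable function $f\colon[0,T[\,\times\mathbb R^6\to\mathbb R$ is a *strong Lagrangian solution* of one of these systems if: (i) the integrals $$\rho(t,x)=\int f(t,x,v)\,dv,\qquad F(t,x)=\int\frac{x-y}{|x-y|^3}\,\rho(t,y)\,dy$$ exist for all $(t,x)\in[0,T[\,\times\mathbb R^3$, $F$ is continuous, and for every $0<T'<T$ there is $L>0$ with $|F(t,x)-F(t,x')|\le L|x-x'|$ for all $t\in[0,T']$ and $x,x'\in\mathbb R^3$;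 (ii) for every $(t,z)\in[0,T[\,\times\mathbb R^6$ the function $s\mapsto f(s,Z(s,t,z))$ is constant on $[0,T[$, where $s\mapsto Z(s,t,z)=(X,V)(s,t,x,v)$ is the unique solution on $[0,T[$ of $$\dot X=V\ \text{ (non-relativistic)}\quad\text{or}\quad \dot X=\frac{V}{\sqrt{1+|V|^2}}\ \text{ (relativistic)},\qquad \dot V=-F(s,X),$$ with $Z(t,t,z)=z=(x,v)$. Such a solution is called spherically symmetric if $f(t)=f(t,\cdot)$ is spherically symmetric for every $t\in[0,T[$. For $g\colon\mathbb R^6\to[0,\infty[$ measurable, bounded and compactly supported, put $$E_{\mathrm{kin}}(g)=\tfrac12\iint|v|^2g(x,v)\,dv\,dx\ \text{ (non-relativistic)},\qquad E_{\mathrm{kin}}(g)=\iint\sqrt{1+|v|^2}\,g(x,v)\,dv\,dx\ \text{ (relativistic)},$$ $$E_{\mathrm{pot}}(g)=-\tfrac12\iiiint\frac{g(x,v)\,g(y,w)}{|x-y|}\,dv\,dw\,dx\,dy,\qquad \mathcal C_\Phi(g)=\iint\Phi\big(g(x,v)\big)\,dv\,dx,$$ where $\Phi\colon\mathbb R\to\mathbb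 R$ is any continuous function with $\Phi(0)=0$. **Theorem.** Let $\mathring f\colon\mathbb R^6\to[0,\infty[$ be measurable, bounded, compactly supported and spherically symmetric, and fix one of the two systems. Then there are $T\in\,]0,\infty]$ and a spherically symmetric strong Lagrangian solution $f\colon[0,T[\,\times\mathbb R^6\to[0,\infty[$ with $f(0)=\mathring f$ which is maximal and unique: if $g$ is any spherically symmetric strong Lagrangian solution on some $[0,T'[$ with $g(0)=\mathring f$, then $T'\le T$ and $g(t)=f(t)$ for all $t\in[0,T'[$. Moreover: 1. In the non-relativistic case, $T=\infty$. 2. In the relativistic case, $T=\infty$ if $\sup\{|v| : (x,v)\in\operatorname{supp}f(t),\ 0\le t<T\}<\infty$. 3. For all $t\in[0,T[$ the function $f(t)$ is measurable, bounded and compactly supported, and $$E_{\mathrm{kin}}(f(t))+E_{\mathrm{pot}}(f(t))=E_{\mathrm{kin}}(\mathring f)+E_{\mathrm{pot}}(\mathring f),\qquad \mathcal C_\Phi(f(t))=\mathcal C_\Phi(\mathring f)$$ for all continuous $\Phi\colon\mathbb R\to\mathbb R$ with $\Phi(0)=0$. -/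

import Mathlib

open MeasureTheory Set

noncomputable section

namespace VlasovPoisson

/-- Three-dimensional Euclidean space. -/
abbrev Space : Type := EuclideanSpace ℝ (Fin 3)

/-- Phase space `ℝ³ × ℝ³`; a point is `z = (x, v)`. The measure `volume` on it is
Lebesgue measure on `ℝ⁶`. -/
abbrev Phase : Type := Space × Space

/-- The two systems under consideration. -/
inductive Model : Type where
  | nonrelativistic : Model
  | relativistic : Model

/-- The velocity `dx/ds` of a particle: `v`, respectively `v / √(1 + |v|²)`. -/
def Model.velocity : Model → Space → Space
  | .nonrelativistic, v => v
  | .relativistic, v => (Real.sqrt (1 + ‖v‖ ^ 2))⁻¹ • v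

/-- The kinetic energy of a single particle: `|v|² / 2`, respectively `√(1 + |v|²)`. -/
def Model.particleEnergy : Model → Space → ℝ
  | .nonrelativistic, v => ‖v‖ ^ 2 / 2
  | .relativistic, v => Real.sqrt (1 + ‖v‖ ^ 2)

/-- The half-open time interval `[0, T[`, where `T = ⊤` is allowed. -/
def timeInterval (T : EReal) : Set ℝ := {t : ℝ | 0 ≤ t ∧ (t : EReal) < T}

/-- The action `x ↦ A x` of `SO(3)` on `ℝ³`. -/
def rotate (A : Matrix.specialOrthogonalGroup (Fin 3) ℝ) (x : Space) : Space :=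
  Matrix.toEuclideanLin (A : Matrix (Fin 3) (Fin 3) ℝ) x

/-- `g (A x, A v) = g (x, v)` for all `x, v ∈ ℝ³` and `A ∈ SO(3)`. -/
def SphericallySymmetric (g : Phase → ℝ) : Prop :=
  ∀ (A : Matrix.specialOrthogonalGroup (Fin 3) ℝ) (x v : Space),
    g (rotate A x, rotate A v) = g (x, v)

/-- A state: a non-negative, measurable, bounded and compactly supported function on
phase space. -/
structure IsState (g : Phase → ℝ) : Prop where
  nonneg : ∀ z, 0 ≤ g z
  measurable : Measurable g
  bounded : ∃ C : ℝ, ∀ z, g z ≤ C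
  hasCompactSupport : HasCompactSupport g

/-- The spatial density `ρ(x) = ∫ g(x, v) dv`. -/
def density (g : Phase → ℝ) (x : Space) : ℝ := ∫ v : Space, g (x, v)

/-- The integrand `y ↦ ρ(y) (x - y) / |x - y|³` of the gravitational field at `x`. -/
def fieldIntegrand (g : Phase → ℝ) (x y : Space) : Space :=
  (density g y / ‖x - y‖ ^ 3) • (x - y)

/-- The gravitational field `F(x) = ∫ (x - y) / |x - y|³ ρ(y) dy`. -/
def field (g : Phase → ℝ) (x : Space) : Space := ∫ y : Space, fieldIntegrand g x y

/-- `Z = (X, V)` solves, on `[0, T[`, the characteristic system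
`dX/ds = V` (respectively `V / √(1 + |V|²)`), `dV/ds = - F(s, X)`.
The derivative at the end point `s = 0` is one-sided. -/
def IsCharacteristic (m : Model) (T : EReal) (F : ℝ → Space → Space) (Z : ℝ → Phase) : Prop :=
  ∀ s ∈ timeInterval T,
    HasDerivWithinAt Z (m.velocity (Z s).2, -F s (Z s).1) (timeInterval T) s

/-- Strong Lagrangian solutions on `[0, T[`. Only the values of `f` at times in `[0, T[`
matter. -/
structure IsStrongLagrangianSolution (m : Model) (T : EReal) (f : ℝ → Phase → ℝ) : Prop where
  pos : 0 < T
  measurable : Measurable (fun p : timeInterval T × Phase => f p.1 p.2)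
  /-- The density exists at every time and at every point of space. -/
  density_exists : ∀ t ∈ timeInterval T, ∀ x : Space, Integrable (fun v : Space => f t (x, v))
  /-- The field exists at every time and at every point of space. -/
  field_exists : ∀ t ∈ timeInterval T, ∀ x : Space, Integrable (fieldIntegrand (f t) x)
  field_continuous :
    ContinuousOn (fun p : ℝ × Space => field (f p.1) p.2) (timeInterval T ×ˢ univ)
  field_lipschitz : ∀ T' : ℝ, 0 < T' → (T' : EReal) < T → ∃ L : ℝ, 0 < L ∧
    ∀ t ∈ Icc 0 T', ∀ x x' : Space, ‖field (f t) x - field (f t) x'‖ ≤ L * ‖x - x'‖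
  /-- Through every `(t, z)` there is exactly one characteristic on `[0, T[`, and `f` is
  constant along it. -/
  constant_along : ∀ t ∈ timeInterval T, ∀ z : Phase, ∃ Z : ℝ → Phase,
    IsCharacteristic m T (fun s => field (f s)) Z ∧ Z t = z ∧
    (∀ Z' : ℝ → Phase, IsCharacteristic m T (fun s => field (f s)) Z' → Z' t = z →
      EqOn Z' Z (timeInterval T)) ∧
    ∀ s ∈ timeInterval T, f s (Z s) = f t z

/-- A spherically symmetric strong Lagrangian solution on `[0, T[` with initial data `f₀`. -/
structure IsSymmetricSolution (m : Model) (f₀ : Phase → ℝ) (T : EReal) (f : ℝ → Phase → ℝ) :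
    Prop where
  solution : IsStrongLagrangianSolution m T f
  symmetric : ∀ t ∈ timeInterval T, SphericallySymmetric (f t)
  initial : f 0 = f₀

/-- `E_kin(g) = ½ ∬ |v|² g dv dx`, respectively `∬ √(1 + |v|²) g dv dx`. -/
def kineticEnergy (m : Model) (g : Phase → ℝ) : ℝ :=
  ∫ z : Phase, m.particleEnergy z.2 * g z

/-- `E_pot(g) = - ½ ⨌ g(x, v) g(y, w) / |x - y| dv dw dx dy`. -/
def potentialEnergy (g : Phase → ℝ) : ℝ :=
  -(1 / 2) * ∫ p : Phase × Phase, g p.1 * g p.2 / ‖p.1.1 - p.2.1‖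

/-- The Casimir functional `C(g) = ∬ Φ(g(x, v)) dv dx`. -/
def casimir (Φ : ℝ → ℝ) (g : Phase → ℝ) : ℝ := ∫ z : Phase, Φ (g z)

end VlasovPoisson

end

/-!
# Spherically symmetric solutions of the Vlasov–Poisson systems

A strong Lagrangian solution is the transport `f₀ ∘ backward` of its initial state along the flow
of its own gravitational field, so everything reduces to a fixed point problem for the field.

*The field.* By Newton's shell theorem (`shell_theorem`, proved in the coordinates
`(⟪x / |x|, y⟫, |y|)`) the field of a spherically symmetric state is `radialField`: the mass in the
ball of radius `|x|`, times `x / |x|³`. In this form no singular integral is left. With a bound on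
the spatial density, that is on the velocities in the support, the radial field is Lipschitz in
space, and moving all particles by at most `δ` changes it by at most a multiple of `δ`
(`norm_radialField_map_sub_le`). Hence forces depend Lipschitz continuously on characteristics, and
conversely by Grönwall's inequality. The bound on the spatial density and all conservation laws use
that the flow preserves volume; since the force is only Lipschitz in space, this is shown by
approximation with the symplectic Euler scheme, whose steps are shears
(`HasFlow.measurePreserving_forward`).

*Existence and uniqueness.* With the force cut off at a height `B`, velocities stay bounded on
bounded time intervals, and Picard iteration in an exponentially weighted norm gives a unique
solution for all times (`exists_isCutoffSolution`, `IsCutoffSolution.eq`). While the cut-off is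
inactive this solves the original system, and every solution arises in this way on compact time
intervals, whence uniqueness. The union of all solutions is the maximal one
(`isSymmetricSolution_maximalSolution`). If velocities stay bounded up to a finite time, then so
does the field, and a higher cut-off continues the solution beyond that time
(`IsSymmetricSolution.exists_continuation`).

*Global existence in the non-relativistic case.* If velocities are bounded by `P`, the field is
bounded by a multiple of `P²`, and always by `M / |x|²`. A coordinate of the velocity, which is the
time derivative of the corresponding coordinate of the position, then moves under a force dominated
by a function of that coordinate of the position alone, with integral of order `P`. So the square of
the velocity grows by at most a multiple of `P` (`sq_velocity_le_of_inverse_square`), and for the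
smallest bound `P` this reads `P² ≤ a + b P` (`exists_velocity_bound_nonrelativistic`).

*Conservation laws.* Casimir functionals are conserved because the flow preserves volume. For the
energy, the kernel is softened to `y / (ε² + |y|²) ^ (3 / 2)`. In Lagrangian coordinates the softened
energy is differentiable in time, and its derivative is controlled by the difference of the two
kernels, which tends to zero with `ε` in `L¹` of the unit ball and uniformly outside of it
(`HasFlow.energy_comp_backward`).
-/

noncomputable section

namespace VlasovPoisson

open scoped NNReal Topology ENNReal

/-! ### Lipschitz estimates for radial rescalings -/

/-- Rescaling `x ↦ (c / n x) x` by a factor with `n` nonexpansive, `c ≤ n` and `‖x‖ ≤ n x` is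
`2`-Lipschitz. Both the relativistic velocity and the radial cut-off have this form. -/
theorem norm_rescale_sub_le {E : Type*} [NormedAddCommGroup E] [NormedSpace ℝ E] {c : ℝ}
    (hc : 0 < c) {n : E → ℝ} (hn : ∀ x, c ≤ n x) (hn' : ∀ x, ‖x‖ ≤ n x)
    (hlip : ∀ x y, |n x - n y| ≤ ‖x - y‖) (x y : E) :
    ‖(c / n x) • x - (c / n y) • y‖ ≤ 2 * ‖x - y‖ := by
  have hx : 0 < n x := hc.trans_le (hn x)
  have hy : 0 < n y := hc.trans_le (hn y)
  have h1 : (c / n x) • x - (c / n y) • y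
      = (c / n x) • (x - y) + ((c / n x) * ((n y - n x) / n y)) • y := by
    rw [smul_sub, sub_add, ← sub_smul]
    congr 2
    field_simp
    ring
  have h2 : c / n x ≤ 1 := (div_le_one hx).2 (hn x)
  have h3 : ‖y‖ / n y ≤ 1 := (div_le_one hy).2 (hn' y)
  have h4 : 0 ≤ c / n x := by positivity
  rw [h1]
  refine (norm_add_le _ _).trans ?_
  rw [norm_smul, norm_smul, Real.norm_of_nonneg h4, norm_mul, Real.norm_of_nonneg h4,
    norm_div, Real.norm_of_nonneg hy.le, Real.norm_eq_abs]
  have h5 : |n y - n x| ≤ ‖x - y‖ := by rw [abs_sub_comm]; exact hlip x y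
  have h6 : c / n x * (|n y - n x| / n y) * ‖y‖ = c / n x * (|n y - n x| * (‖y‖ / n y)) := by ring
  rw [h6]
  have h7 : |n y - n x| * (‖y‖ / n y) ≤ ‖x - y‖ :=
    (mul_le_of_le_one_right (abs_nonneg _) h3).trans h5
  have h8 : c / n x * (|n y - n x| * (‖y‖ / n y)) ≤ 1 * ‖x - y‖ :=
    mul_le_mul h2 h7 (by positivity) zero_le_one
  have h9 : c / n x * ‖x - y‖ ≤ 1 * ‖x - y‖ := mul_le_mul_of_nonneg_right h2 (norm_nonneg _)
  linarith

/-- The radial cut-off at height `R`: the identity on the ball of radius `R`, and the rescaling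
to length `R` outside of it. -/
def cap (R : ℝ) (x : Space) : Space := (R / max R ‖x‖) • x

theorem cap_of_le {R : ℝ} (hR : 0 < R) {x : Space} (hx : ‖x‖ ≤ R) : cap R x = x := by
  rw [cap, max_eq_left hx, div_self hR.ne', one_smul]

theorem norm_cap_le {R : ℝ} (hR : 0 < R) (x : Space) : ‖cap R x‖ ≤ R := by
  have h : 0 < max R ‖x‖ := hR.trans_le (le_max_left _ _)
  rw [cap, norm_smul, norm_div, Real.norm_of_nonneg hR.le, Real.norm_of_nonneg h.le,
    div_mul_eq_mul_div, div_le_iff₀ h]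
  exact mul_le_mul_of_nonneg_left (le_max_right _ _) hR.le

theorem norm_cap_sub_le {R : ℝ} (hR : 0 < R) (x y : Space) :
    ‖cap R x - cap R y‖ ≤ 2 * ‖x - y‖ := by
  refine norm_rescale_sub_le (n := fun x => max R ‖x‖) hR (fun _ => le_max_left _ _)
    (fun _ => le_max_right _ _) (fun x y => ?_) x y
  exact (abs_max_sub_max_le_max R ‖x‖ R ‖y‖).trans (by simpa using abs_norm_sub_norm_le x y)

theorem continuous_cap {R : ℝ} (hR : 0 < R) : Continuous (cap R) :=
  (LipschitzWith.of_dist_le_mul (K := 2) fun x y => by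
    simpa [dist_eq_norm] using norm_cap_sub_le hR x y).continuous

theorem abs_sqrt_one_add_sq_sub_le (a b : ℝ) :
    |Real.sqrt (1 + a ^ 2) - Real.sqrt (1 + b ^ 2)| ≤ |a - b| := by
  have ha := Real.sq_sqrt (show 0 ≤ 1 + a ^ 2 by positivity)
  have hb := Real.sq_sqrt (show 0 ≤ 1 + b ^ 2 by positivity)
  have h1 : 1 + a * b ≤ Real.sqrt (1 + a ^ 2) * Real.sqrt (1 + b ^ 2) := by
    rw [← Real.sqrt_mul (by positivity)]
    apply Real.le_sqrt_of_sq_le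
    nlinarith [sq_nonneg (a - b)]
  apply sq_le_sq.1
  nlinarith

theorem norm_velocity_sub_le (m : Model) (v w : Space) :
    ‖m.velocity v - m.velocity w‖ ≤ 2 * ‖v - w‖ := by
  cases m with
  | nonrelativistic => simp only [Model.velocity]; linarith [norm_nonneg (v - w)]
  | relativistic =>
    have h := norm_rescale_sub_le (n := fun x : Space => Real.sqrt (1 + ‖x‖ ^ 2)) one_pos
      (fun x => Real.one_le_sqrt.2 (by nlinarith [norm_nonneg x]))
      (fun x => Real.le_sqrt_of_sq_le (by linarith))
      (fun x y => (abs_sqrt_one_add_sq_sub_le _ _).trans (abs_norm_sub_norm_le x y)) v w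
    simpa [Model.velocity] using h

theorem norm_velocity_le (m : Model) (v : Space) : ‖m.velocity v‖ ≤ ‖v‖ := by
  cases m with
  | nonrelativistic => exact le_rfl
  | relativistic =>
    have h : 1 ≤ Real.sqrt (1 + ‖v‖ ^ 2) := Real.one_le_sqrt.2 (by nlinarith [norm_nonneg v])
    rw [Model.velocity, norm_smul, norm_inv, Real.norm_of_nonneg (by positivity)]
    exact mul_le_of_le_one_left (norm_nonneg _) (inv_le_one_of_one_le₀ h)

theorem continuous_velocity (m : Model) : Continuous m.velocity :=
  (LipschitzWith.of_dist_le_mul (K := 2) fun x y => by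
    simpa [dist_eq_norm] using norm_velocity_sub_le m x y).continuous

theorem velocity_neg (m : Model) (v : Space) : m.velocity (-v) = -m.velocity v := by
  cases m <;> simp [Model.velocity]

/-! ### The characteristic flow of a Lipschitz force field -/

/-- The vector field on phase space whose integral curves are the characteristics. -/
def charField (m : Model) (F : ℝ → Space → Space) (s : ℝ) (z : Phase) : Phase :=
  (m.velocity z.2, -F s z.1)

/-- A force field on `[0, T]` that is jointly continuous, and Lipschitz in space uniformly in
time. -/
structure IsForce (T L : ℝ) (F : ℝ → Space → Space) : Prop where
  continuousOn : ContinuousOn (fun p : ℝ × Space => F p.1 p.2) (Icc 0 T ×ˢ univ)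
  lipschitz : ∀ s ∈ Icc 0 T, ∀ x y, ‖F s x - F s y‖ ≤ L * ‖x - y‖

/-- A Lipschitz constant of `charField` for a force with Lipschitz constant `L`. -/
def charLip (L : ℝ) : ℝ≥0 := max 2 L.toNNReal

theorem two_le_charLip (L : ℝ) : (2 : ℝ) ≤ charLip L := by
  have : (2 : ℝ≥0) ≤ charLip L := le_max_left _ _
  exact_mod_cast this

theorem le_charLip (L : ℝ) : L ≤ charLip L :=
  (Real.le_coe_toNNReal L).trans (by exact_mod_cast le_max_right _ _)

theorem norm_charField_sub_le {m : Model} {T L : ℝ} {F : ℝ → Space → Space}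
    (hF : IsForce T L F) {s : ℝ} (hs : s ∈ Icc 0 T) (z w : Phase) :
    ‖charField m F s z - charField m F s w‖ ≤ charLip L * ‖z - w‖ := by
  rw [Prod.norm_def, Prod.norm_def (z - w)]
  refine max_le ?_ ?_
  · refine (norm_velocity_sub_le m _ _).trans ?_
    exact mul_le_mul (two_le_charLip L) (le_max_right _ _) (norm_nonneg _) (charLip L).2
  · have h : (charField m F s z - charField m F s w).2 = -(F s z.1 - F s w.1) := by
      simp [charField]; abel
    rw [h, norm_neg]
    refine (hF.lipschitz s hs _ _).trans ?_
    exact mul_le_mul (le_charLip L) (le_max_left _ _) (norm_nonneg _) (charLip L).2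

theorem lipschitzWith_charField {m : Model} {T L : ℝ} {F : ℝ → Space → Space}
    (hF : IsForce T L F) {s : ℝ} (hs : s ∈ Icc 0 T) :
    LipschitzWith (charLip L) (charField m F s) :=
  LipschitzWith.of_dist_le_mul fun z w => by
    simpa [dist_eq_norm] using norm_charField_sub_le hF hs z w

theorem IsForce.mono {T T' L : ℝ} {F : ℝ → Space → Space} (hF : IsForce T L F) (h : T' ≤ T) :
    IsForce T' L F :=
  ⟨hF.continuousOn.mono (prod_mono (Icc_subset_Icc_right h) subset_rfl),
    fun s hs => hF.lipschitz s ⟨hs.1, hs.2.trans h⟩⟩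

theorem IsForce.congr {T L : ℝ} {F G : ℝ → Space → Space} (hF : IsForce T L F)
    (h : ∀ s ∈ Icc 0 T, ∀ x, G s x = F s x) : IsForce T L G :=
  ⟨hF.continuousOn.congr fun p hp => h _ hp.1 _, fun s hs x y => by
    rw [h s hs, h s hs]; exact hF.lipschitz s hs x y⟩

/-- The force seen when the motion on `[0, t]` is run backwards. -/
theorem IsForce.reverse {T L : ℝ} {F : ℝ → Space → Space} (hF : IsForce T L F) {t : ℝ}
    (ht : t ∈ Icc 0 T) : IsForce t L (fun s => F (t - s)) := by
  refine ⟨?_, fun s hs => hF.lipschitz _ ⟨by linarith [hs.2], by linarith [hs.1, ht.2]⟩⟩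
  refine hF.continuousOn.comp (f := fun p : ℝ × Space => (t - p.1, p.2)) (by fun_prop) ?_
  rintro p ⟨hp, -⟩
  exact ⟨⟨by linarith [hp.2], by linarith [hp.1, ht.2]⟩, mem_univ _⟩

theorem integralCurve_reverse {E : Type*} [NormedAddCommGroup E] [NormedSpace ℝ E]
    {v : ℝ → E → E} {Z : ℝ → E} {T t : ℝ} (h : IsIntegralCurveOn Z v (Icc 0 T))
    (ht : t ∈ Icc 0 T) :
    IsIntegralCurveOn (fun s => Z (t - s)) (fun s z => -v (t - s) z) (Icc 0 t) := by
  intro s hs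
  have hs' : t - s ∈ Icc 0 T := ⟨by linarith [hs.2], by linarith [hs.1, ht.2]⟩
  have h1 : HasDerivWithinAt (fun s : ℝ => t - s) (-1) (Icc 0 t) s := by
    simpa using (hasDerivWithinAt_id s (Icc 0 t)).const_sub t
  have := (h _ hs').scomp s h1
    (fun u hu => ⟨by linarith [hu.2], by linarith [hu.1, ht.2]⟩)
  rw [neg_one_smul] at this
  exact this

/-- Grönwall's inequality for two integral curves, forward in time. -/
theorem dist_integralCurve_le {E : Type*} [NormedAddCommGroup E] [NormedSpace ℝ E]
    {v : ℝ → E → E} {K : ℝ≥0} {T : ℝ} (hv : ∀ s ∈ Icc 0 T, LipschitzWith K (v s))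
    {Z W : ℝ → E} (hZ : IsIntegralCurveOn Z v (Icc 0 T)) (hW : IsIntegralCurveOn W v (Icc 0 T))
    {a b : ℝ} (ha : 0 ≤ a) (hab : a ≤ b) (hb : b ≤ T) :
    dist (Z b) (W b) ≤ dist (Z a) (W a) * Real.exp (K * (b - a)) := by
  have hsub : Icc a b ⊆ Icc 0 T := Icc_subset_Icc ha hb
  have key : ∀ {Z : ℝ → E}, IsIntegralCurveOn Z v (Icc 0 T) →
      ∀ t ∈ Ico a b, HasDerivWithinAt Z (v t (Z t)) (Ici t) t := by
    intro Z hZ t ht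
    have h0 : t ∈ Icc 0 T := hsub ⟨ht.1, ht.2.le⟩
    refine (hZ t h0).mono_of_mem_nhdsWithin ?_
    exact Filter.mem_of_superset (Icc_mem_nhdsGE (ht.2.trans_le hb))
      (Icc_subset_Icc_left h0.1)
  exact dist_le_of_trajectories_ODE_of_mem (s := fun _ => univ)
    (fun t ht => (hv t (hsub ⟨ht.1, ht.2.le⟩)).lipschitzOnWith)
    (hZ.continuousOn.mono hsub) (key hZ) (fun _ _ => trivial)
    (hW.continuousOn.mono hsub) (key hW) (fun _ _ => trivial) le_rfl b ⟨hab, le_rfl⟩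

/-- Grönwall's inequality for two integral curves, backward in time. -/
theorem dist_integralCurve_le' {E : Type*} [NormedAddCommGroup E] [NormedSpace ℝ E]
    {v : ℝ → E → E} {K : ℝ≥0} {T : ℝ} (hv : ∀ s ∈ Icc 0 T, LipschitzWith K (v s))
    {Z W : ℝ → E} (hZ : IsIntegralCurveOn Z v (Icc 0 T)) (hW : IsIntegralCurveOn W v (Icc 0 T))
    {a b : ℝ} (ha : 0 ≤ a) (hab : a ≤ b) (hb : b ≤ T) :
    dist (Z a) (W a) ≤ dist (Z b) (W b) * Real.exp (K * (b - a)) := by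
  have hbT : b ∈ Icc 0 T := ⟨ha.trans hab, hb⟩
  have h := dist_integralCurve_le (v := fun s z => -v (b - s) z) (K := K) (T := b)
    (fun s hs => by
      have := hv (b - s) ⟨by linarith [hs.2], by linarith [hs.1]⟩
      exact LipschitzWith.of_dist_le_mul fun x y => by
        simpa using this.dist_le_mul x y)
    (integralCurve_reverse hZ hbT) (integralCurve_reverse hW hbT) le_rfl
    (sub_nonneg.2 hab) (by linarith : b - a ≤ b)
  simpa using h

theorem integralCurve_eqOn {E : Type*} [NormedAddCommGroup E] [NormedSpace ℝ E]
    {v : ℝ → E → E} {K : ℝ≥0} {T : ℝ} (hv : ∀ s ∈ Icc 0 T, LipschitzWith K (v s))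
    {Z W : ℝ → E} (hZ : IsIntegralCurveOn Z v (Icc 0 T)) (hW : IsIntegralCurveOn W v (Icc 0 T))
    {t : ℝ} (ht : t ∈ Icc 0 T) (h : Z t = W t) : EqOn Z W (Icc 0 T) := by
  intro s hs
  rw [← dist_le_zero]
  rcases le_total s t with hst | hst
  · simpa [h] using dist_integralCurve_le' hv hZ hW hs.1 hst ht.2
  · simpa [h] using dist_integralCurve_le hv hZ hW ht.1 hst hs.2

/-- For a bounded force, characteristics exist on all of `[0, T]`: the speed along them is
bounded in advance, so that the velocity may be cut off and the vector field becomes bounded. -/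
theorem exists_integralCurve {m : Model} {T L B : ℝ} {F : ℝ → Space → Space}
    (hF : IsForce T L F) (hB : ∀ s ∈ Icc 0 T, ∀ x, ‖F s x‖ ≤ B) {t : ℝ} (ht : t ∈ Icc 0 T)
    (z : Phase) : ∃ Z, IsIntegralCurveOn Z (charField m F) (Icc 0 T) ∧ Z t = z := by
  have hB0 : 0 ≤ B := (norm_nonneg _).trans (hB t ht 0)
  have hT : 0 ≤ T := ht.1.trans ht.2
  set R : ℝ := ‖z.2‖ + B * T + 1 with hRdef
  have hR : 0 < R := by positivity
  let c : Phase → Phase := fun w => (w.1, cap R w.2)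
  have hc : LipschitzWith 2 c := LipschitzWith.of_dist_le_mul fun w w' => by
    rw [Prod.dist_eq, Prod.dist_eq]
    refine max_le ?_ ?_
    · exact (le_max_left _ _).trans
        (le_mul_of_one_le_left (le_max_of_le_left dist_nonneg) (by norm_num))
    · rw [dist_eq_norm]
      refine (norm_cap_sub_le hR _ _).trans ?_
      rw [← dist_eq_norm]
      exact mul_le_mul_of_nonneg_left (le_max_right _ _) (by norm_num)
  let v : ℝ → Phase → Phase := fun s w => charField m F s (c w)
  let N : ℝ≥0 := ⟨max R B, hR.le.trans (le_max_left _ _)⟩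
  let A : ℝ≥0 := N * ⟨T, hT⟩
  have hPL : IsPicardLindelof v (tmin := 0) (tmax := T) ⟨t, ht⟩ z A 0 N (charLip L * 2) := by
    refine ⟨fun s hs => ?_, fun w _ => ?_, fun s hs w _ => ?_, ?_⟩
    · exact ((lipschitzWith_charField hF hs).comp hc).lipschitzOnWith
    · refine continuousOn_const.prodMk (ContinuousOn.neg ?_)
      exact hF.continuousOn.comp (f := fun s : ℝ => (s, (c w).1)) (by fun_prop)
        (fun s hs => ⟨hs, mem_univ _⟩)
    · rw [Prod.norm_def]
      refine max_le ?_ ?_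
      · exact (norm_velocity_le m _).trans ((norm_cap_le hR _).trans (le_max_left _ _))
      · change ‖-F s _‖ ≤ _
        rw [norm_neg]
        exact (hB s hs _).trans (le_max_right _ _)
    · have : max (T - t) (t - 0) ≤ T := max_le (by linarith [ht.1]) (by linarith [ht.2])
      have h := mul_le_mul_of_nonneg_left this N.2
      refine h.trans (le_of_eq ?_)
      rw [NNReal.coe_zero, sub_zero]
      rfl
  obtain ⟨Z, hZt, hZ⟩ := hPL.exists_eq_forall_mem_Icc_hasDerivWithinAt₀
  refine ⟨Z, fun s hs => ?_, hZt⟩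
  have hV : ∀ s ∈ Icc 0 T, HasDerivWithinAt (fun s => (Z s).2) (-F s (Z s).1) (Icc 0 T) s :=
    fun s hs => (hasFDerivAt_snd (p := Z s)).comp_hasDerivWithinAt s (hZ s hs)
  have hVb : ‖(Z s).2‖ ≤ R := by
    have h1 := (convex_Icc 0 T).norm_image_sub_le_of_norm_hasDerivWithin_le (C := B) hV
      (fun s hs => by rw [norm_neg]; exact hB s hs _) ht hs
    have h2 : ‖s - t‖ ≤ T := by
      rw [Real.norm_eq_abs, abs_le]; constructor <;> linarith [hs.1, hs.2, ht.1, ht.2]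
    have h3 := norm_sub_norm_le (Z s).2 (Z t).2
    have h4 : B * ‖s - t‖ ≤ B * T := mul_le_mul_of_nonneg_left h2 hB0
    rw [hZt] at h1 h3
    linarith
  have h5 : c (Z s) = Z s := by
    simp only [c, cap_of_le hR hVb]
  have h6 := hZ s hs
  simp only [v, h5] at h6
  exact h6

/-- A force whose characteristics run through every point of `[0, T] × ℝ⁶` on all of `[0, T]`. -/
structure HasFlow (m : Model) (T L : ℝ) (F : ℝ → Space → Space) : Prop extends IsForce T L F where
  through : ∀ t ∈ Icc 0 T, ∀ z, ∃ Z, IsIntegralCurveOn Z (charField m F) (Icc 0 T) ∧ Z t = z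

open Classical in
/-- The characteristic on `[0, T]` that passes through `z` at time `t`, with an arbitrary value
if there is none. -/
def evolution (m : Model) (T : ℝ) (F : ℝ → Space → Space) (t : ℝ) (z : Phase) : ℝ → Phase :=
  if h : ∃ Z, IsIntegralCurveOn Z (charField m F) (Icc 0 T) ∧ Z t = z then h.choose
  else fun _ => z

/-- The flow map `z ↦ Z(s, 0, z)` on `[0, T]`. -/
def forward (m : Model) (T : ℝ) (F : ℝ → Space → Space) (s : ℝ) (z : Phase) : Phase :=
  evolution m T F 0 z s

/-- The inverse flow map `z ↦ Z(0, t, z)` on `[0, T]`. -/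
def backward (m : Model) (T : ℝ) (F : ℝ → Space → Space) (t : ℝ) (z : Phase) : Phase :=
  evolution m T F t z 0

section Flow

variable {m : Model} {T L : ℝ} {F : ℝ → Space → Space}

theorem IsForce.hasFlow {B : ℝ} (hF : IsForce T L F) (hB : ∀ s ∈ Icc 0 T, ∀ x, ‖F s x‖ ≤ B) :
    HasFlow m T L F :=
  ⟨hF, fun _ ht z => exists_integralCurve hF hB ht z⟩

namespace HasFlow

theorem evolution_spec (H : HasFlow m T L F) {t : ℝ} (ht : t ∈ Icc 0 T) (z : Phase) :
    IsIntegralCurveOn (evolution m T F t z) (charField m F) (Icc 0 T) ∧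
      evolution m T F t z t = z := by
  rw [evolution, dif_pos (H.through t ht z)]
  exact (H.through t ht z).choose_spec

theorem eqOn (H : HasFlow m T L F) {Z W : ℝ → Phase}
    (hZ : IsIntegralCurveOn Z (charField m F) (Icc 0 T))
    (hW : IsIntegralCurveOn W (charField m F) (Icc 0 T)) {t : ℝ} (ht : t ∈ Icc 0 T)
    (h : Z t = W t) : EqOn Z W (Icc 0 T) :=
  integralCurve_eqOn (fun _ hs => lipschitzWith_charField H.toIsForce hs) hZ hW ht h

theorem zero_mem {t : ℝ} (ht : t ∈ Icc 0 T) : (0 : ℝ) ∈ Icc 0 T :=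
  ⟨le_rfl, ht.1.trans ht.2⟩

theorem forward_zero (H : HasFlow m T L F) (hT : 0 ≤ T) (z : Phase) : forward m T F 0 z = z :=
  (H.evolution_spec ⟨le_rfl, hT⟩ z).2

theorem integralCurve_forward (H : HasFlow m T L F) (hT : 0 ≤ T) (z : Phase) :
    IsIntegralCurveOn (fun s => forward m T F s z) (charField m F) (Icc 0 T) :=
  (H.evolution_spec ⟨le_rfl, hT⟩ z).1

theorem eq_forward (H : HasFlow m T L F) {Z : ℝ → Phase}
    (hZ : IsIntegralCurveOn Z (charField m F) (Icc 0 T)) {s : ℝ} (hs : s ∈ Icc 0 T) :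
    Z s = forward m T F s (Z 0) := by
  have h0 := zero_mem hs
  exact H.eqOn hZ (H.integralCurve_forward h0.2 _) h0 (H.forward_zero h0.2 _).symm hs

theorem backward_eq (H : HasFlow m T L F) {Z : ℝ → Phase}
    (hZ : IsIntegralCurveOn Z (charField m F) (Icc 0 T)) {t : ℝ} (ht : t ∈ Icc 0 T) :
    backward m T F t (Z t) = Z 0 := by
  have h := H.evolution_spec ht (Z t)
  exact H.eqOn h.1 hZ ht h.2 (zero_mem ht)

theorem backward_forward (H : HasFlow m T L F) {t : ℝ} (ht : t ∈ Icc 0 T) (z : Phase) :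
    backward m T F t (forward m T F t z) = z := by
  have h0 := (zero_mem ht).2
  rw [H.backward_eq (H.integralCurve_forward h0 z) ht, H.forward_zero h0]

theorem forward_backward (H : HasFlow m T L F) {t : ℝ} (ht : t ∈ Icc 0 T) (z : Phase) :
    forward m T F t (backward m T F t z) = z := by
  have h := H.evolution_spec ht z
  exact (H.eq_forward h.1 ht).symm.trans h.2

theorem dist_forward_le (H : HasFlow m T L F) {t : ℝ} (ht : t ∈ Icc 0 T) (z w : Phase) :
    dist (forward m T F t z) (forward m T F t w) ≤ dist z w * Real.exp (charLip L * t) := by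
  have h0 := (zero_mem ht).2
  have h := dist_integralCurve_le (fun _ hs => lipschitzWith_charField H.toIsForce hs)
    (H.integralCurve_forward h0 z) (H.integralCurve_forward h0 w) le_rfl ht.1 ht.2
  simpa [H.forward_zero h0] using h

theorem dist_backward_le (H : HasFlow m T L F) {t : ℝ} (ht : t ∈ Icc 0 T) (z w : Phase) :
    dist (backward m T F t z) (backward m T F t w) ≤ dist z w * Real.exp (charLip L * t) := by
  have h := dist_integralCurve_le' (fun _ hs => lipschitzWith_charField H.toIsForce hs)
    (H.evolution_spec ht z).1 (H.evolution_spec ht w).1 le_rfl ht.1 ht.2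
  rw [(H.evolution_spec ht z).2, (H.evolution_spec ht w).2, sub_zero] at h
  exact h

theorem continuousOn_forward (H : HasFlow m T L F) (hT : 0 ≤ T) (z : Phase) :
    ContinuousOn (fun s => forward m T F s z) (Icc 0 T) :=
  (H.integralCurve_forward hT z).continuousOn

theorem continuous_forward (H : HasFlow m T L F) {t : ℝ} (ht : t ∈ Icc 0 T) :
    Continuous (forward m T F t) :=
  (LipschitzWith.of_dist_le_mul (K := ⟨Real.exp (charLip L * t), (Real.exp_pos _).le⟩)
    fun z w => (H.dist_forward_le ht z w).trans_eq (mul_comm _ _)).continuous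

theorem continuous_backward (H : HasFlow m T L F) {t : ℝ} (ht : t ∈ Icc 0 T) :
    Continuous (backward m T F t) :=
  (LipschitzWith.of_dist_le_mul (K := ⟨Real.exp (charLip L * t), (Real.exp_pos _).le⟩)
    fun z w => (H.dist_backward_le ht z w).trans_eq (mul_comm _ _)).continuous

/-- The flow map at a fixed time as a homeomorphism of phase space. -/
def homeomorph (H : HasFlow m T L F) {t : ℝ} (ht : t ∈ Icc 0 T) : Phase ≃ₜ Phase where
  toFun := forward m T F t
  invFun := backward m T F t
  left_inv := H.backward_forward ht
  right_inv := H.forward_backward ht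
  continuous_toFun := H.continuous_forward ht
  continuous_invFun := H.continuous_backward ht

theorem exp_charLip_le {t : ℝ} (ht : t ∈ Icc 0 T) :
    Real.exp (charLip L * t) ≤ Real.exp (charLip L * T) :=
  Real.exp_le_exp.2 (mul_le_mul_of_nonneg_left ht.2 (charLip L).2)

theorem continuousOn_forward_uncurry (H : HasFlow m T L F) :
    ContinuousOn (fun p : ℝ × Phase => forward m T F p.1 p.2) (Icc 0 T ×ˢ univ) := by
  rintro ⟨t, z⟩ ⟨ht, -⟩
  have hT := (zero_mem ht).2
  rw [ContinuousWithinAt, tendsto_iff_dist_tendsto_zero]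
  have h1 : ContinuousWithinAt (fun p : ℝ × Phase => dist p.2 z * Real.exp (charLip L * T) +
      dist (forward m T F p.1 z) (forward m T F t z)) (Icc 0 T ×ˢ univ) (t, z) := by
    refine ContinuousWithinAt.add (by fun_prop) (Filter.Tendsto.dist ?_
      continuousWithinAt_const)
    exact ((H.continuousOn_forward hT z) t ht).comp (f := fun p : ℝ × Phase => p.1)
      continuousWithinAt_fst (fun p hp => hp.1)
  have h2 := h1.tendsto
  simp only [dist_self, zero_mul, add_zero] at h2
  refine squeeze_zero' (Filter.Eventually.of_forall fun _ => dist_nonneg) ?_ h2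
  filter_upwards [self_mem_nhdsWithin] with p hp
  refine (dist_triangle _ (forward m T F p.1 z) _).trans (add_le_add ?_ le_rfl)
  exact (H.dist_forward_le hp.1 _ _).trans
    (mul_le_mul_of_nonneg_left (exp_charLip_le hp.1) dist_nonneg)

theorem continuousOn_backward_uncurry (H : HasFlow m T L F) :
    ContinuousOn (fun p : ℝ × Phase => backward m T F p.1 p.2) (Icc 0 T ×ˢ univ) := by
  rintro ⟨t, z⟩ ⟨ht, -⟩
  have hT := (zero_mem ht).2
  set a := backward m T F t z with ha
  rw [ContinuousWithinAt, tendsto_iff_dist_tendsto_zero]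
  have h1 : ContinuousWithinAt (fun p : ℝ × Phase => dist p.2 (forward m T F p.1 a) *
      Real.exp (charLip L * T)) (Icc 0 T ×ˢ univ) (t, z) := by
    refine ContinuousWithinAt.mul (Filter.Tendsto.dist continuousWithinAt_snd ?_)
      continuousWithinAt_const
    exact ((H.continuousOn_forward hT a) t ht).comp (f := fun p : ℝ × Phase => p.1)
      continuousWithinAt_fst (fun p hp => hp.1)
  have h2 := h1.tendsto
  simp only [ha, H.forward_backward ht, dist_self, zero_mul] at h2
  refine squeeze_zero' (Filter.Eventually.of_forall fun _ => dist_nonneg) ?_ h2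
  filter_upwards [self_mem_nhdsWithin] with p hp
  have h3 := H.dist_backward_le hp.1 p.2 (forward m T F p.1 a)
  rw [H.backward_forward hp.1] at h3
  exact h3.trans (mul_le_mul_of_nonneg_left (exp_charLip_le hp.1) dist_nonneg)

end HasFlow

/-- Stability of characteristics in an exponentially weighted norm. The weight turns Grönwall's
inequality into a bound with a factor that is small when `l` is large. -/
theorem dist_integralCurve_le_of_force {F' : ℝ → Space → Space} (hF : IsForce T L F)
    {A l : ℝ} (hA : 0 ≤ A) (hl : charLip L < l)
    (hFF : ∀ s ∈ Icc 0 T, ∀ x, ‖F s x - F' s x‖ ≤ A * Real.exp (l * s)) {Z Z' : ℝ → Phase}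
    (hZ : IsIntegralCurveOn Z (charField m F) (Icc 0 T))
    (hZ' : IsIntegralCurveOn Z' (charField m F') (Icc 0 T)) (h0 : Z 0 = Z' 0)
    {s : ℝ} (hs : s ∈ Icc 0 T) :
    ‖Z s - Z' s‖ ≤ A / (l - charLip L) * Real.exp (l * s) := by
  have hd : 0 < l - charLip L := sub_pos.2 hl
  have key : ∀ A' > A, ‖Z s - Z' s‖ ≤ A' / (l - charLip L) * Real.exp (l * s) := by
    intro A' hA'
    have hder : ∀ t ∈ Ico 0 T, HasDerivWithinAt (fun t => Z t - Z' t)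
        (charField m F t (Z t) - charField m F' t (Z' t)) (Ici t) t := by
      intro t ht
      have ht' : t ∈ Icc 0 T := ⟨ht.1, ht.2.le⟩
      refine ((hZ t ht').sub (hZ' t ht')).mono_of_mem_nhdsWithin ?_
      exact Filter.mem_of_superset (Icc_mem_nhdsGE ht.2) (Icc_subset_Icc_left ht.1)
    refine image_norm_le_of_norm_deriv_right_lt_deriv_boundary
      (f := fun t => Z t - Z' t) (B := fun t => A' / (l - charLip L) * Real.exp (l * t))
      (B' := fun t => A' / (l - charLip L) * (Real.exp (l * t) * l))
      (hZ.continuousOn.sub hZ'.continuousOn) hder ?_ ?_ ?_ hs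
    · have : 0 ≤ A' := hA.trans hA'.le
      simp only [h0, sub_self, norm_zero]
      positivity
    · intro t
      have h := ((hasDerivAt_id t).const_mul l).exp.const_mul (A' / (l - charLip L))
      simpa using h
    · intro t ht heq
      have ht' : t ∈ Icc 0 T := ⟨ht.1, ht.2.le⟩
      have h1 : ‖charField m F t (Z t) - charField m F t (Z' t)‖ ≤
          charLip L * (A' / (l - charLip L) * Real.exp (l * t)) := by
        rw [← heq]; exact norm_charField_sub_le hF ht' _ _
      have h2 : ‖charField m F t (Z' t) - charField m F' t (Z' t)‖ ≤ A * Real.exp (l * t) := by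
        have : charField m F t (Z' t) - charField m F' t (Z' t) =
            (0, -(F t (Z' t).1 - F' t (Z' t).1)) := by
          simp [charField]; abel
        rw [this, Prod.norm_def, norm_zero, norm_neg, max_eq_right (norm_nonneg _)]
        exact hFF t ht' _
      have h3 := norm_sub_le_norm_sub_add_norm_sub (charField m F t (Z t))
        (charField m F t (Z' t)) (charField m F' t (Z' t))
      have h4 : A * Real.exp (l * t) < A' * Real.exp (l * t) :=
        mul_lt_mul_of_pos_right hA' (Real.exp_pos _)
      have h5 : A' / (l - charLip L) * (Real.exp (l * t) * l) =
          charLip L * (A' / (l - charLip L) * Real.exp (l * t)) + A' * Real.exp (l * t) := by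
        field_simp
        ring
      linarith
  have h1 : ‖Z s - Z' s‖ * (l - charLip L) / Real.exp (l * s) ≤ A := by
    refine le_of_forall_gt_imp_ge_of_dense fun A' hA' => ?_
    have := key A' hA'
    rw [div_le_iff₀ (Real.exp_pos _)]
    rw [div_mul_eq_mul_div, le_div_iff₀ hd] at this
    exact this
  rw [div_le_iff₀ (Real.exp_pos _)] at h1
  rwa [div_mul_eq_mul_div, le_div_iff₀ hd]

end Flow

/-! ### Conservation of phase-space volume -/

/-- One step of length `h` of the symplectic Euler scheme: a free drift followed by a kick. Both
are shears, hence preserve volume although the force is merely Lipschitz. -/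
def eulerStep (m : Model) (F : ℝ → Space → Space) (h s : ℝ) (z : Phase) : Phase :=
  (z.1 + h • m.velocity z.2, z.2 - h • F s (z.1 + h • m.velocity z.2))

/-- The symplectic Euler scheme with step length `h`, started at time `0`. -/
def eulerScheme (m : Model) (F : ℝ → Space → Space) (h : ℝ) : ℕ → Phase → Phase
  | 0, z => z
  | k + 1, z => eulerStep m F h (k * h) (eulerScheme m F h k z)

section

variable {m : Model} {T L : ℝ} {F : ℝ → Space → Space}

theorem IsForce.continuous (hF : IsForce T L F) {s : ℝ} (hs : s ∈ Icc 0 T) :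
    Continuous (F s) :=
  hF.continuousOn.comp_continuous (f := fun x : Space => (s, x)) (by fun_prop)
    fun _ => ⟨hs, mem_univ _⟩

theorem measurePreserving_drift (m : Model) (h : ℝ) :
    MeasurePreserving (fun z : Phase => (z.1 + h • m.velocity z.2, z.2)) := by
  have h1 : MeasurePreserving (fun z : Phase => (z.1, z.2 + h • m.velocity z.1)) := by
    refine (MeasurePreserving.id volume).skew_product
      (g := fun v x : Space => x + h • m.velocity v) ?_ ?_
    · have := (continuous_velocity m).measurable
      fun_prop
    · exact Filter.Eventually.of_forall fun v => (measurePreserving_add_right volume _).map_eq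
  exact (Measure.measurePreserving_swap.comp h1).comp Measure.measurePreserving_swap

theorem measurePreserving_kick (hF : IsForce T L F) {s : ℝ} (hs : s ∈ Icc 0 T) (h : ℝ) :
    MeasurePreserving (fun z : Phase => (z.1, z.2 - h • F s z.1)) := by
  refine (MeasurePreserving.id volume).skew_product
    (g := fun x v : Space => v - h • F s x) ?_ ?_
  · have := (hF.continuous hs).measurable
    fun_prop
  · exact Filter.Eventually.of_forall fun v => (measurePreserving_sub_right volume _).map_eq

theorem measurePreserving_eulerScheme (hF : IsForce T L F) {h : ℝ} (hh : 0 ≤ h) (k : ℕ)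
    (hk : k * h ≤ T) : MeasurePreserving (eulerScheme m F h k) := by
  induction k with
  | zero => exact MeasurePreserving.id _
  | succ k ih =>
    push_cast at hk
    have hk' : k * h ≤ T := by linarith
    have h1 := (measurePreserving_kick hF (s := k * h) ⟨by positivity, hk'⟩ h).comp
      ((measurePreserving_drift m h).comp (ih hk'))
    exact h1

theorem norm_eulerStep_sub_le (hF : IsForce T L F) {h s : ℝ} (hh : 0 ≤ h) (hs : s ∈ Icc 0 T)
    (z w : Phase) :
    ‖eulerStep m F h s z - eulerStep m F h s w‖ ≤ Real.exp (2 * charLip L * h) * ‖z - w‖ := by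
  set K : ℝ := (charLip L : ℝ)
  have hK2 : 2 ≤ K := two_le_charLip L
  have hKL : L ≤ K := le_charLip L
  have hKh : 0 ≤ K * h := by positivity
  have e1 : (1 + K * h) ^ 2 ≤ Real.exp (2 * K * h) := by
    have := Real.add_one_le_exp (K * h)
    calc (1 + K * h) ^ 2 ≤ Real.exp (K * h) ^ 2 := by gcongr; linarith
      _ = Real.exp (2 * K * h) := by rw [← Real.exp_nat_mul]; congr 1; push_cast; ring
  have d1 : ‖z.1 - w.1‖ ≤ ‖z - w‖ := norm_fst_le (z - w)
  have d2 : ‖z.2 - w.2‖ ≤ ‖z - w‖ := norm_snd_le (z - w)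
  have hN := norm_nonneg (z - w)
  have a1 : ‖(z.1 + h • m.velocity z.2) - (w.1 + h • m.velocity w.2)‖ ≤
      (1 + K * h) * ‖z - w‖ := by
    have : (z.1 + h • m.velocity z.2) - (w.1 + h • m.velocity w.2) =
        (z.1 - w.1) + h • (m.velocity z.2 - m.velocity w.2) := by rw [smul_sub]; abel
    rw [this]
    refine (norm_add_le _ _).trans ?_
    rw [norm_smul, Real.norm_of_nonneg hh]
    have h2 := norm_velocity_sub_le m z.2 w.2
    have h3 : ‖m.velocity z.2 - m.velocity w.2‖ ≤ K * ‖z - w‖ :=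
      h2.trans (mul_le_mul hK2 d2 (norm_nonneg _) (by linarith))
    have h4 := mul_le_mul_of_nonneg_left h3 hh
    nlinarith
  have a2 : ‖(z.2 - h • F s (z.1 + h • m.velocity z.2)) -
      (w.2 - h • F s (w.1 + h • m.velocity w.2))‖ ≤
      (1 + K * h * (1 + K * h)) * ‖z - w‖ := by
    have : (z.2 - h • F s (z.1 + h • m.velocity z.2)) -
        (w.2 - h • F s (w.1 + h • m.velocity w.2)) = (z.2 - w.2) -
        h • (F s (z.1 + h • m.velocity z.2) - F s (w.1 + h • m.velocity w.2)) := by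
      rw [smul_sub]; abel
    rw [this]
    refine (norm_sub_le _ _).trans ?_
    rw [norm_smul, Real.norm_of_nonneg hh]
    have h2 := hF.lipschitz s hs (z.1 + h • m.velocity z.2) (w.1 + h • m.velocity w.2)
    have h3 := h2.trans (mul_le_mul hKL a1 (norm_nonneg _) (by linarith))
    have h4 := mul_le_mul_of_nonneg_left h3 hh
    nlinarith
  rw [Prod.norm_def]
  refine (max_le (a1.trans ?_) (a2.trans ?_)).trans (mul_le_mul_of_nonneg_right e1 hN)
  · exact mul_le_mul_of_nonneg_right (by nlinarith) hN
  · exact mul_le_mul_of_nonneg_right (by nlinarith) hN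

/-- The symplectic Euler scheme converges pointwise to the exact characteristics. -/
theorem tendsto_eulerScheme (hF : IsForce T L F) {Z : ℝ → Phase}
    (hZ : IsIntegralCurveOn Z (charField m F) (Icc 0 T)) {t : ℝ} (ht : t ∈ Icc 0 T) :
    Filter.Tendsto (fun n : ℕ => eulerScheme m F (t / (n + 1)) (n + 1) (Z 0)) Filter.atTop
      (𝓝 (Z t)) := by
  set K : ℝ := (charLip L : ℝ) with hK
  have hK2 : 2 ≤ K := two_le_charLip L
  have hT : 0 ≤ T := ht.1.trans ht.2
  set g : ℝ → Phase := fun s => charField m F s (Z s) with hg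
  have hgc : ContinuousOn g (Icc 0 T) := by
    have h1 : ContinuousOn Z (Icc 0 T) := hZ.continuousOn
    refine ContinuousOn.prodMk ((continuous_velocity m).comp_continuousOn h1.snd) ?_
    refine ContinuousOn.neg ?_
    exact hF.continuousOn.comp (f := fun s => (s, (Z s).1)) (continuousOn_id.prodMk h1.fst)
      fun s hs => ⟨hs, mem_univ _⟩
  obtain ⟨G, hG⟩ := isCompact_Icc.exists_bound_of_continuousOn hgc
  have hG0 : 0 ≤ G := (norm_nonneg _).trans (hG 0 ⟨le_rfl, hT⟩)
  have huc := isCompact_Icc.uniformContinuousOn_of_continuous hgc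
  rw [Metric.uniformContinuousOn_iff] at huc
  -- the error after `k` steps, given the modulus of continuity of the vector field
  have err : ∀ η > 0, ∃ δ > 0, ∀ h, 0 ≤ h → h < δ → ∀ k : ℕ, k * h ≤ T →
      ‖Z (k * h) - eulerScheme m F h k (Z 0)‖ ≤
        k * h * (η + K * h * G) * Real.exp (2 * K * (k * h)) := by
    intro η hη
    obtain ⟨δ, hδ, hδ'⟩ := huc η hη
    refine ⟨δ, hδ, fun h hh hhδ k => ?_⟩
    induction k with
    | zero => simp [eulerScheme]
    | succ k ih =>
      intro hk
      push_cast at hk ⊢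
      have hk' : k * h ≤ T := by linarith
      set a : ℝ := k * h with ha
      have ha0 : 0 ≤ a := by positivity
      have haT : a ∈ Icc 0 T := ⟨ha0, hk'⟩
      have hsub : Icc a (a + h) ⊆ Icc 0 T := Icc_subset_Icc ha0 (by linarith)
      have hmv : ‖(Z (a + h) - (a + h) • g a) - (Z a - a • g a)‖ ≤ η * ‖(a + h) - a‖ := by
        refine (convex_Icc a (a + h)).norm_image_sub_le_of_norm_hasDerivWithin_le
          (f := fun s => Z s - s • g a) (f' := fun s => g s - (1 : ℝ) • g a) ?_ ?_
          ⟨le_rfl, by linarith⟩ ⟨by linarith, le_rfl⟩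
        · intro s hs
          exact ((hZ s (hsub hs)).mono hsub).sub
            ((hasDerivWithinAt_id s _).smul_const (g a))
        · intro s hs
          rw [one_smul, ← dist_eq_norm]
          refine (hδ' s (hsub hs) a haT ?_).le
          rw [Real.dist_eq, abs_of_nonneg (by linarith [hs.1])]
          linarith [hs.2]
      rw [add_sub_cancel_left, Real.norm_of_nonneg hh] at hmv
      have hloc : ‖Z a + h • g a - eulerStep m F h a (Z a)‖ ≤ h * (K * h * G) := by
        have e : Z a + h • g a - eulerStep m F h a (Z a) =
            (0, h • (F a ((Z a).1 + h • m.velocity (Z a).2) - F a (Z a).1)) := by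
          ext1
          · simp [eulerStep, hg, charField]
          · simp only [eulerStep, hg, charField, Prod.snd_sub, Prod.snd_add, Prod.smul_snd,
              smul_sub, smul_neg]
            abel
        rw [e, Prod.norm_def, norm_zero, max_eq_right (norm_nonneg _), norm_smul,
          Real.norm_of_nonneg hh]
        refine mul_le_mul_of_nonneg_left ?_ hh
        refine (hF.lipschitz a haT _ _).trans ?_
        rw [add_sub_cancel_left, norm_smul, Real.norm_of_nonneg hh]
        have hv : ‖m.velocity (Z a).2‖ ≤ G := (norm_fst_le (g a)).trans (hG a haT)
        have h1 : h * ‖m.velocity (Z a).2‖ ≤ h * G := mul_le_mul_of_nonneg_left hv hh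
        calc L * (h * ‖m.velocity (Z a).2‖) ≤ K * (h * G) :=
              mul_le_mul (le_charLip L) h1 (by positivity) (by linarith)
          _ = K * h * G := by ring
      have hstep := norm_eulerStep_sub_le (m := m) hF hh haT (Z a) (eulerScheme m F h k (Z 0))
      have ih' := ih hk'
      have hμ : 0 ≤ η + K * h * G := by positivity
      have hE : 1 ≤ Real.exp (2 * K * (a + h)) := Real.one_le_exp (by positivity)
      have hEE : Real.exp (2 * K * h) * Real.exp (2 * K * a) = Real.exp (2 * K * (a + h)) := by
        rw [← Real.exp_add]; congr 1; ring
      have e1 : ((k : ℝ) + 1) * h = a + h := by rw [ha]; ring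
      rw [e1]
      have e2 : Z (a + h) - eulerScheme m F h (k + 1) (Z 0) =
          ((Z (a + h) - (a + h) • g a) - (Z a - a • g a)) +
          (Z a + h • g a - eulerStep m F h a (Z a)) +
          (eulerStep m F h a (Z a) - eulerStep m F h a (eulerScheme m F h k (Z 0))) := by
        simp only [eulerScheme, add_smul]
        abel
      rw [e2]
      refine (norm_add₃_le).trans ?_
      have e3 : Real.exp (2 * K * h) * ‖Z a - eulerScheme m F h k (Z 0)‖ ≤
          a * (η + K * h * G) * Real.exp (2 * K * (a + h)) := by
        calc _ ≤ Real.exp (2 * K * h) * (a * (η + K * h * G) * Real.exp (2 * K * a)) :=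
              mul_le_mul_of_nonneg_left ih' (Real.exp_pos _).le
          _ = a * (η + K * h * G) * (Real.exp (2 * K * h) * Real.exp (2 * K * a)) := by ring
          _ = _ := by rw [hEE]
      have e4 : h * (η + K * h * G) * 1 ≤ h * (η + K * h * G) * Real.exp (2 * K * (a + h)) :=
        mul_le_mul_of_nonneg_left hE (by positivity)
      nlinarith
  rw [Metric.tendsto_atTop]
  intro ε hε
  set C : ℝ := (t + 1) * Real.exp (2 * K * t) with hC
  have hC0 : 0 < C := by have := ht.1; positivity
  obtain ⟨δ, hδ, hδ'⟩ := err (ε / (2 * C)) (by positivity)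
  have hlim : Filter.Tendsto (fun n : ℕ => t / ((n : ℝ) + 1)) Filter.atTop (𝓝 0) :=
    tendsto_const_div_atTop_nhds_zero_nat t |>.comp (Filter.tendsto_add_atTop_nat 1) |>.congr
      fun n => by simp
  have hlim2 : Filter.Tendsto (fun n : ℕ => K * (t / ((n : ℝ) + 1)) * G) Filter.atTop (𝓝 0) := by
    simpa using (hlim.const_mul K).mul_const G
  have ev := (hlim.eventually (gt_mem_nhds hδ)).and
    (hlim2.eventually (gt_mem_nhds (show 0 < ε / (2 * C) by positivity)))
  obtain ⟨N, hN⟩ := Filter.eventually_atTop.1 ev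
  refine ⟨N, fun n hn => ?_⟩
  obtain ⟨h1, h2⟩ := hN n hn
  have hn1 : ((n : ℝ) + 1) ≠ 0 := by positivity
  have e1 : ((n + 1 : ℕ) : ℝ) * (t / ((n : ℝ) + 1)) = t := by push_cast; field_simp
  have h3 := hδ' (t / ((n : ℝ) + 1)) (div_nonneg ht.1 (by positivity)) h1 (n + 1)
    (by rw [e1]; exact ht.2)
  rw [e1] at h3
  rw [dist_comm, dist_eq_norm]
  refine h3.trans_lt ?_
  have h4 : t * (ε / (2 * C) + K * (t / ((n : ℝ) + 1)) * G) * Real.exp (2 * K * t) ≤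
      t * (ε / C) * Real.exp (2 * K * t) := by
    have : ε / (2 * C) + K * (t / ((n : ℝ) + 1)) * G ≤ ε / C := by
      have : ε / C = ε / (2 * C) + ε / (2 * C) := by field_simp; ring
      linarith
    have := ht.1
    gcongr
  refine h4.trans_lt ?_
  have h5 : t * (ε / C) * Real.exp (2 * K * t) = ε * (t * Real.exp (2 * K * t) / C) := by ring
  rw [h5]
  refine mul_lt_of_lt_one_right hε ((div_lt_one hC0).2 ?_)
  rw [hC]
  exact mul_lt_mul_of_pos_right (by linarith) (Real.exp_pos _)

/-- A map that does not increase the volume of open sets does not increase the volume of any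
measurable set. -/
theorem volume_preimage_le_of_isOpen {f : Phase → Phase}
    (h : ∀ U, IsOpen U → volume (f ⁻¹' U) ≤ volume U) (S : Set Phase) :
    volume (f ⁻¹' S) ≤ volume S := by
  refine le_of_forall_gt fun r hr => ?_
  obtain ⟨U, hSU, hU, hUr⟩ := S.exists_isOpen_lt_of_lt r hr
  exact (measure_mono (preimage_mono hSU)).trans_lt ((h U hU).trans_lt hUr)

/-- Half of Liouville's theorem: the flow is a pointwise limit of volume-preserving maps, so Fatou's
lemma applies to preimages of open sets. -/
theorem HasFlow.volume_forward_preimage_le (H : HasFlow m T L F) {t : ℝ} (ht : t ∈ Icc 0 T)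
    (S : Set Phase) : volume (forward m T F t ⁻¹' S) ≤ volume S := by
  refine volume_preimage_le_of_isOpen (fun U hU => ?_) S
  have hT := (HasFlow.zero_mem ht).2
  have hmp : ∀ n : ℕ, MeasurePreserving (eulerScheme m F (t / ((n : ℝ) + 1)) (n + 1)) := by
    intro n
    refine measurePreserving_eulerScheme H.toIsForce (div_nonneg ht.1 (by positivity)) _ ?_
    have : ((n + 1 : ℕ) : ℝ) * (t / ((n : ℝ) + 1)) = t := by push_cast; field_simp
    rw [this]
    exact ht.2
  have hlim : ∀ z, Filter.Tendsto
      (fun n : ℕ => eulerScheme m F (t / ((n : ℝ) + 1)) (n + 1) z) Filter.atTop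
      (𝓝 (forward m T F t z)) := by
    intro z
    have h := tendsto_eulerScheme H.toIsForce (H.integralCurve_forward hT z) ht
    simpa only [H.forward_zero hT] using h
  have hmeas : MeasurableSet (forward m T F t ⁻¹' U) :=
    (H.continuous_forward ht).measurable hU.measurableSet
  calc volume (forward m T F t ⁻¹' U)
      = ∫⁻ z, (forward m T F t ⁻¹' U).indicator 1 z := (lintegral_indicator_one hmeas).symm
    _ ≤ ∫⁻ z, Filter.liminf (fun n : ℕ =>
          (eulerScheme m F (t / ((n : ℝ) + 1)) (n + 1) ⁻¹' U).indicator
            (1 : Phase → ENNReal) z) Filter.atTop := by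
        refine lintegral_mono fun z => ?_
        by_cases hz : forward m T F t z ∈ U
        · refine Filter.le_liminf_of_le (by isBoundedDefault) ?_
          filter_upwards [(hlim z).eventually (hU.mem_nhds hz)] with n hn
          rw [indicator_of_mem (show z ∈ _ ⁻¹' U from hn),
            indicator_of_mem (show z ∈ _ ⁻¹' U from hz)]
        · rw [indicator_of_notMem (show z ∉ _ ⁻¹' U from hz)]
          exact zero_le
    _ ≤ Filter.liminf (fun n : ℕ => ∫⁻ z,
          (eulerScheme m F (t / ((n : ℝ) + 1)) (n + 1) ⁻¹' U).indicator
            (1 : Phase → ENNReal) z) Filter.atTop := by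
        refine lintegral_liminf_le fun n => ?_
        exact measurable_one.indicator ((hmp n).measurable hU.measurableSet)
    _ = volume U := by
        have : ∀ n : ℕ, ∫⁻ z, (eulerScheme m F (t / ((n : ℝ) + 1)) (n + 1) ⁻¹' U).indicator
          (1 : Phase → ENNReal) z = volume U := fun n => by
          rw [lintegral_indicator_one ((hmp n).measurable hU.measurableSet),
            (hmp n).measure_preimage hU.measurableSet.nullMeasurableSet]
        simp [this]

/-- Reversal of velocities. -/
def flipVelocity (z : Phase) : Phase := (z.1, -z.2)

theorem measurePreserving_flipVelocity : MeasurePreserving flipVelocity :=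
  (MeasurePreserving.id volume).prod (Measure.measurePreserving_neg volume)

theorem flipVelocity_flipVelocity (z : Phase) : flipVelocity (flipVelocity z) = z := by
  simp [flipVelocity]

theorem integralCurve_flipVelocity {Z : ℝ → Phase}
    (hZ : IsIntegralCurveOn Z (charField m F) (Icc 0 T)) {t : ℝ} (ht : t ∈ Icc 0 T) :
    IsIntegralCurveOn (fun s => flipVelocity (Z (t - s))) (charField m fun s => F (t - s))
      (Icc 0 t) := by
  intro s hs
  have h := integralCurve_reverse hZ ht s hs
  have h1 := (hasFDerivAt_fst (p := Z (t - s))).comp_hasDerivWithinAt s h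
  have h2 := ((hasFDerivAt_snd (p := Z (t - s))).comp_hasDerivWithinAt s h).neg
  have h3 := h1.prodMk h2
  simpa [charField, flipVelocity, velocity_neg, Function.comp_def] using h3

theorem HasFlow.reverse (H : HasFlow m T L F) {t : ℝ} (ht : t ∈ Icc 0 T) :
    HasFlow m t L (fun s => F (t - s)) := by
  refine ⟨H.toIsForce.reverse ht, fun s hs z => ?_⟩
  obtain ⟨Z, hZ, hZs⟩ := H.through (t - s) ⟨by linarith [hs.2], by linarith [hs.1, ht.2]⟩
    (flipVelocity z)
  exact ⟨_, integralCurve_flipVelocity hZ ht, by rw [hZs, flipVelocity_flipVelocity]⟩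

theorem HasFlow.backward_eq_flip (H : HasFlow m T L F) {t : ℝ} (ht : t ∈ Icc 0 T) (z : Phase) :
    backward m T F t z =
      flipVelocity (forward m t (fun s => F (t - s)) t (flipVelocity z)) := by
  have h := H.evolution_spec ht z
  have h1 := (H.reverse ht).eq_forward (integralCurve_flipVelocity h.1 ht) ⟨ht.1, le_rfl⟩
  rw [sub_zero, sub_self, h.2] at h1
  rw [← h1, flipVelocity_flipVelocity]
  rfl

/-- The other half: the inverse flow is the flow of the reversed force, up to a reversal of
velocities. -/
theorem HasFlow.volume_backward_preimage_le (H : HasFlow m T L F) {t : ℝ} (ht : t ∈ Icc 0 T)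
    {S : Set Phase} (hS : MeasurableSet S) : volume (backward m T F t ⁻¹' S) ≤ volume S := by
  have h1 : backward m T F t ⁻¹' S = flipVelocity ⁻¹'
      (forward m t (fun s => F (t - s)) t ⁻¹' (flipVelocity ⁻¹' S)) := by
    ext z
    simp [H.backward_eq_flip ht]
  have ht' : t ∈ Icc 0 t := ⟨ht.1, le_rfl⟩
  have hS' := measurePreserving_flipVelocity.measurable hS
  rw [h1, measurePreserving_flipVelocity.measure_preimage
    (((H.reverse ht).continuous_forward ht').measurable hS').nullMeasurableSet]
  refine ((H.reverse ht).volume_forward_preimage_le ht' _).trans_eq ?_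
  exact measurePreserving_flipVelocity.measure_preimage hS.nullMeasurableSet

/-- Liouville's theorem for a Lipschitz force. -/
theorem HasFlow.measurePreserving_forward (H : HasFlow m T L F) {t : ℝ} (ht : t ∈ Icc 0 T) :
    MeasurePreserving (forward m T F t) := by
  have hm := (H.continuous_forward ht).measurable
  refine ⟨hm, Measure.ext fun S hS => ?_⟩
  rw [Measure.map_apply hm hS]
  refine le_antisymm (H.volume_forward_preimage_le ht S) ?_
  have h1 : backward m T F t ⁻¹' (forward m T F t ⁻¹' S) = S := by
    ext z
    simp [H.forward_backward ht]
  calc volume S = volume (backward m T F t ⁻¹' (forward m T F t ⁻¹' S)) := by rw [h1]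
    _ ≤ _ := H.volume_backward_preimage_le ht (hm hS)

theorem HasFlow.measurePreserving_backward (H : HasFlow m T L F) {t : ℝ} (ht : t ∈ Icc 0 T) :
    MeasurePreserving (backward m T F t) :=
  (H.measurePreserving_forward ht).symm (H.homeomorph ht).toMeasurableEquiv

end

/-! ### The radial field of a mass distribution -/

/-- The field `M(r) x / r³`, where `r = |x|` and `M(r)` is the mass in the open ball of radius `r`.
For a rotationally invariant mass distribution this is the gravitational field. -/
def radialField (μ : Measure Space) (x : Space) : Space :=
  (μ.real (Metric.ball 0 ‖x‖) / ‖x‖ ^ 3) • x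

/-- The measure `μ` is finite and has a density bounded by `D` with respect to Lebesgue measure. -/
structure DensityLe (μ : Measure Space) (D : ℝ) : Prop where
  finite : IsFiniteMeasure μ
  nonneg : 0 ≤ D
  le : μ ≤ ENNReal.ofReal D • volume

/-- The volume of the unit ball of `ℝ³`. -/
def unitBallVolume : ℝ := volume.real (Metric.ball (0 : Space) 1)

theorem unitBallVolume_pos : 0 < unitBallVolume :=
  ENNReal.toReal_pos (Metric.measure_ball_pos _ _ one_pos).ne' measure_ball_lt_top.ne

theorem volume_real_ball {r : ℝ} (hr : 0 ≤ r) :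
    volume.real (Metric.ball (0 : Space) r) = unitBallVolume * r ^ 3 := by
  rw [measureReal_def, Measure.addHaar_ball _ _ hr, finrank_euclideanSpace_fin, ENNReal.toReal_mul,
    ENNReal.toReal_ofReal (by positivity), mul_comm]
  rfl

section

variable {μ : Measure Space} {D : ℝ}

theorem DensityLe.real_le (h : DensityLe μ D) {S : Set Space} (hS : volume S ≠ ⊤) :
    μ.real S ≤ D * volume.real S := by
  have h1 : μ S ≤ ENNReal.ofReal D * volume S := h.le S
  have h2 := ENNReal.toReal_mono (ENNReal.mul_ne_top ENNReal.ofReal_ne_top hS) h1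
  rwa [ENNReal.toReal_mul, ENNReal.toReal_ofReal h.nonneg] at h2

/-- The mass in a spherical shell. -/
theorem DensityLe.real_ball_sub_le (h : DensityLe μ D) {s r : ℝ} (hs : 0 ≤ s) (hsr : s ≤ r) :
    μ.real (Metric.ball 0 r) - μ.real (Metric.ball 0 s) ≤
      unitBallVolume * D * (r ^ 3 - s ^ 3) := by
  have := h.finite
  have hsub : Metric.ball (0 : Space) s ⊆ Metric.ball 0 r := Metric.ball_subset_ball hsr
  rw [← measureReal_sdiff hsub Metric.isOpen_ball.measurableSet]
  refine (h.real_le ((measure_mono sdiff_subset).trans_lt measure_ball_lt_top).ne).trans_eq ?_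
  rw [measureReal_sdiff hsub Metric.isOpen_ball.measurableSet measure_ball_lt_top.ne,
    volume_real_ball (hs.trans hsr), volume_real_ball hs]
  ring

theorem DensityLe.real_ball_le (h : DensityLe μ D) {r : ℝ} (hr : 0 ≤ r) :
    μ.real (Metric.ball 0 r) ≤ unitBallVolume * D * r ^ 3 := by
  simpa using h.real_ball_sub_le le_rfl hr

theorem real_ball_mono (h : DensityLe μ D) {s r : ℝ} (hsr : s ≤ r) :
    μ.real (Metric.ball 0 s) ≤ μ.real (Metric.ball 0 r) :=
  have := h.finite
  measureReal_mono (Metric.ball_subset_ball hsr)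

@[simp]
theorem radialField_zero : radialField μ 0 = 0 := by simp [radialField]

theorem norm_radialField (μ : Measure Space) (x : Space) :
    ‖radialField μ x‖ = μ.real (Metric.ball 0 ‖x‖) / ‖x‖ ^ 2 := by
  rw [radialField, norm_smul, norm_div, norm_pow, norm_norm, Real.norm_of_nonneg measureReal_nonneg]
  rcases eq_or_ne ‖x‖ 0 with h | h
  · simp [h]
  · field_simp

theorem norm_radialField_le_div [IsFiniteMeasure μ] (x : Space) :
    ‖radialField μ x‖ ≤ μ.real univ / ‖x‖ ^ 2 := by
  rw [norm_radialField]
  have : μ.real (Metric.ball 0 ‖x‖) ≤ μ.real univ := measureReal_mono (subset_univ _)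
  gcongr

theorem DensityLe.norm_radialField_le_mul (h : DensityLe μ D) (x : Space) :
    ‖radialField μ x‖ ≤ unitBallVolume * D * ‖x‖ := by
  rw [norm_radialField]
  rcases eq_or_ne ‖x‖ 0 with h0 | h0
  · simp [h0]
  · rw [div_le_iff₀ (by positivity)]
    calc _ ≤ _ := h.real_ball_le (norm_nonneg x)
      _ = _ := by ring

/-- Interpolation of the two preceding bounds: far from the origin the total mass bounds the field,
and near the origin the density does. -/
theorem DensityLe.norm_radialField_le (h : DensityLe μ D) {R : ℝ} (hR : 0 < R) (x : Space) :
    ‖radialField μ x‖ ≤ μ.real univ / R ^ 2 + unitBallVolume * D * R := by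
  have := h.finite
  have hc : 0 ≤ unitBallVolume * D := mul_nonneg unitBallVolume_pos.le h.nonneg
  rcases le_total R ‖x‖ with hx | hx
  · refine (norm_radialField_le_div x).trans ?_
    have : μ.real univ / ‖x‖ ^ 2 ≤ μ.real univ / R ^ 2 := by gcongr
    have : 0 ≤ unitBallVolume * D * R := by positivity
    linarith
  · refine (h.norm_radialField_le_mul x).trans ?_
    have : unitBallVolume * D * ‖x‖ ≤ unitBallVolume * D * R := by gcongr
    have : 0 ≤ μ.real univ / R ^ 2 := by positivity
    linarith

theorem DensityLe.norm_radialField_sub_le (h : DensityLe μ D) (x y : Space) :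
    ‖radialField μ x - radialField μ y‖ ≤ 4 * unitBallVolume * D * ‖x - y‖ := by
  have hc : 0 ≤ unitBallVolume * D := mul_nonneg unitBallVolume_pos.le h.nonneg
  wlog hxy : ‖y‖ ≤ ‖x‖ generalizing x y
  · rw [norm_sub_rev, norm_sub_rev x]
    exact this y x (le_of_not_ge hxy)
  rcases eq_or_ne y 0 with rfl | hy
  · rw [radialField_zero, sub_zero, sub_zero]
    refine (h.norm_radialField_le_mul x).trans ?_
    nlinarith [mul_nonneg hc (norm_nonneg x)]
  set r := ‖x‖
  set s := ‖y‖ with hs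
  have hs0 : 0 < s := norm_pos_iff.2 hy
  have hr0 : 0 < r := hs0.trans_le hxy
  set M : ℝ → ℝ := fun r => μ.real (Metric.ball 0 r) with hM
  have e : radialField μ x - radialField μ y =
      (M r / r ^ 3) • (x - y) + (M r / r ^ 3 - M s / s ^ 3) • y := by
    simp only [radialField, smul_sub, sub_smul, hM]
    abel
  rw [e]
  refine (norm_add_le _ _).trans ?_
  rw [norm_smul, norm_smul, Real.norm_of_nonneg (div_nonneg measureReal_nonneg (by positivity)),
    Real.norm_eq_abs, ← hs]
  have h1 : M r / r ^ 3 ≤ unitBallVolume * D := by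
    rw [div_le_iff₀ (by positivity)]; exact h.real_ball_le hr0.le
  have h2 : M s / s ^ 3 ≤ unitBallVolume * D := by
    rw [div_le_iff₀ (by positivity)]; exact h.real_ball_le hs0.le
  have h2' : 0 ≤ M s / s ^ 3 := div_nonneg measureReal_nonneg (by positivity)
  have h3 : M r - M s ≤ unitBallVolume * D * (r ^ 3 - s ^ 3) := h.real_ball_sub_le hs0.le hxy
  have h3' : M s ≤ M r := real_ball_mono h hxy
  have hq : 0 ≤ (r ^ 3 - s ^ 3) / r ^ 3 :=
    div_nonneg (sub_nonneg.2 (pow_le_pow_left₀ hs0.le hxy 3)) (by positivity)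
  have e2 : M r / r ^ 3 - M s / s ^ 3 =
      (M r - M s) / r ^ 3 - (M s / s ^ 3) * ((r ^ 3 - s ^ 3) / r ^ 3) := by
    field_simp
    ring
  have h4 : (M r - M s) / r ^ 3 ≤ unitBallVolume * D * ((r ^ 3 - s ^ 3) / r ^ 3) := by
    rw [← mul_div_assoc]; gcongr
  have h4' : 0 ≤ (M r - M s) / r ^ 3 := div_nonneg (sub_nonneg.2 h3') (by positivity)
  have h5 : (M s / s ^ 3) * ((r ^ 3 - s ^ 3) / r ^ 3) ≤
      unitBallVolume * D * ((r ^ 3 - s ^ 3) / r ^ 3) := mul_le_mul_of_nonneg_right h2 hq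
  have h5' : 0 ≤ (M s / s ^ 3) * ((r ^ 3 - s ^ 3) / r ^ 3) := mul_nonneg h2' hq
  have h6 : |M r / r ^ 3 - M s / s ^ 3| ≤ unitBallVolume * D * ((r ^ 3 - s ^ 3) / r ^ 3) := by
    rw [e2, abs_le]; constructor <;> linarith
  have h7 : (r ^ 3 - s ^ 3) / r ^ 3 * s ≤ 3 * (r - s) := by
    rw [div_mul_eq_mul_div, div_le_iff₀ (by positivity)]
    have : r ^ 3 - s ^ 3 ≤ 3 * (r - s) * r ^ 2 := by
      have : 3 * (r - s) * r ^ 2 - (r ^ 3 - s ^ 3) = (r - s) ^ 2 * (2 * r + s) := by ring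
      nlinarith [mul_nonneg (sq_nonneg (r - s)) (show 0 ≤ 2 * r + s by positivity)]
    calc (r ^ 3 - s ^ 3) * s ≤ 3 * (r - s) * r ^ 2 * r :=
          mul_le_mul this hxy hs0.le
            (mul_nonneg (mul_nonneg (by norm_num) (sub_nonneg.2 hxy)) (by positivity))
      _ = 3 * (r - s) * r ^ 3 := by ring
  have h8 : r - s ≤ ‖x - y‖ := norm_sub_norm_le x y
  have h9 : |M r / r ^ 3 - M s / s ^ 3| * s ≤ unitBallVolume * D * (3 * ‖x - y‖) := by
    calc _ ≤ unitBallVolume * D * ((r ^ 3 - s ^ 3) / r ^ 3) * s :=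
          mul_le_mul_of_nonneg_right h6 hs0.le
      _ = unitBallVolume * D * ((r ^ 3 - s ^ 3) / r ^ 3 * s) := by ring
      _ ≤ unitBallVolume * D * (3 * ‖x - y‖) :=
          mul_le_mul_of_nonneg_left (by linarith) hc
  have h10 : M r / r ^ 3 * ‖x - y‖ ≤ unitBallVolume * D * ‖x - y‖ :=
    mul_le_mul_of_nonneg_right h1 (norm_nonneg _)
  linarith

end

/-- Moving every particle by at most `δ` changes the mass in a ball of radius `r` only through the
shell of thickness `δ` around the sphere of radius `r`; hence the radial field changes by at most a
multiple of `δ`, uniformly in space. This replaces a Lipschitz bound for the singular kernel. -/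
theorem norm_radialField_map_sub_le {α : Type*} [MeasurableSpace α] {ν : Measure α}
    [IsFiniteMeasure ν] {X Y : α → Space} (hX : Measurable X) (hY : Measurable Y) {D δ : ℝ}
    (hμX : DensityLe (ν.map X) D) (hμY : DensityLe (ν.map Y) D)
    (hδ : ∀ᵐ a ∂ν, ‖X a - Y a‖ ≤ δ) (hδ0 : 0 ≤ δ) (x : Space) :
    ‖radialField (ν.map X) x - radialField (ν.map Y) x‖ ≤ 7 * unitBallVolume * D * δ := by
  have hc : 0 ≤ unitBallVolume * D := mul_nonneg unitBallVolume_pos.le hμX.nonneg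
  rcases eq_or_ne x 0 with rfl | hx
  · simp only [radialField_zero, sub_self, norm_zero]
    nlinarith [mul_nonneg hc hδ0]
  set r := ‖x‖ with hr
  have hr0 : 0 < r := norm_pos_iff.2 hx
  have shift : ∀ {X Y : α → Space}, Measurable X → Measurable Y →
      (∀ᵐ a ∂ν, ‖X a - Y a‖ ≤ δ) →
      (ν.map X).real (Metric.ball 0 r) ≤ (ν.map Y).real (Metric.ball 0 (r + δ)) := by
    intro X Y hX hY h
    rw [map_measureReal_apply hX Metric.isOpen_ball.measurableSet,
      map_measureReal_apply hY Metric.isOpen_ball.measurableSet]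
    refine ENNReal.toReal_mono (measure_ne_top _ _) (measure_mono_ae ?_)
    filter_upwards [h] with a ha hXa
    have h1 : ‖X a‖ < r := mem_ball_zero_iff.1 hXa
    have h2 : ‖Y a‖ ≤ ‖X a‖ + ‖X a - Y a‖ := by
      have := norm_sub_le (X a) (X a - Y a)
      simpa using this
    change Y a ∈ Metric.ball 0 (r + δ)
    rw [mem_ball_zero_iff]
    linarith
  have hδ' : ∀ᵐ a ∂ν, ‖Y a - X a‖ ≤ δ := by
    filter_upwards [hδ] with a ha
    rwa [norm_sub_rev]
  have key : |(ν.map X).real (Metric.ball 0 r) - (ν.map Y).real (Metric.ball 0 r)| ≤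
      7 * unitBallVolume * D * δ * r ^ 2 := by
    rcases le_total δ r with h | h
    · have a1 := shift hX hY hδ
      have a2 := shift hY hX hδ'
      have b1 := hμX.real_ball_sub_le hr0.le (by linarith : r ≤ r + δ)
      have b2 := hμY.real_ball_sub_le hr0.le (by linarith : r ≤ r + δ)
      have c1 : (r + δ) ^ 3 - r ^ 3 ≤ 7 * δ * r ^ 2 := by
        nlinarith [mul_nonneg hδ0 (mul_nonneg hδ0 (sub_nonneg.2 h)),
          mul_nonneg hδ0 (mul_nonneg hr0.le (sub_nonneg.2 h))]
      have c2 := mul_le_mul_of_nonneg_left c1 hc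
      rw [abs_le]
      constructor <;> nlinarith
    · have a1 := hμX.real_ball_le hr0.le
      have a2 := hμY.real_ball_le hr0.le
      have a3 : 0 ≤ (ν.map X).real (Metric.ball 0 r) := measureReal_nonneg
      have a4 : 0 ≤ (ν.map Y).real (Metric.ball 0 r) := measureReal_nonneg
      have c1 : r ^ 3 ≤ 7 * δ * r ^ 2 := by nlinarith [mul_nonneg (sub_nonneg.2 h) (sq_nonneg r)]
      have c2 := mul_le_mul_of_nonneg_left c1 hc
      rw [abs_le]
      constructor <;> nlinarith
  have e : radialField (ν.map X) x - radialField (ν.map Y) x =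
      (((ν.map X).real (Metric.ball 0 r) - (ν.map Y).real (Metric.ball 0 r)) / r ^ 3) • x := by
    rw [radialField, radialField, ← sub_smul, sub_div]
  rw [e, norm_smul, norm_div, Real.norm_eq_abs, Real.norm_of_nonneg (by positivity), ← hr,
    div_mul_eq_mul_div, div_le_iff₀ (by positivity)]
  calc _ ≤ 7 * unitBallVolume * D * δ * r ^ 2 * r := mul_le_mul_of_nonneg_right key hr0.le
    _ = _ := by ring

/-! ### States as mass distributions -/

/-- The mass distribution on phase space with density `g`. -/
def massMeasure (g : Phase → ℝ) : Measure Phase :=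
  volume.withDensity fun z => ENNReal.ofReal (g z)

/-- The state `g` lives on velocities of length at most `P`. -/
def VelocityLe (g : Phase → ℝ) (P : ℝ) : Prop := ∀ z, g z ≠ 0 → ‖z.2‖ ≤ P

section

variable {g : Phase → ℝ}

theorem IsState.integrable (hg : IsState g) : Integrable g := by
  obtain ⟨C, hC⟩ := hg.bounded
  refine (integrableOn_iff_integrable_of_support_subset (subset_tsupport g)).1 ?_
  refine Measure.integrableOn_of_bounded hg.hasCompactSupport.measure_lt_top.ne
    hg.measurable.aestronglyMeasurable (M := C) (Filter.Eventually.of_forall fun z => ?_)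
  rw [Real.norm_of_nonneg (hg.nonneg z)]
  exact hC z

theorem IsState.isFiniteMeasure (hg : IsState g) : IsFiniteMeasure (massMeasure g) :=
  isFiniteMeasure_withDensity_ofReal hg.integrable.2

theorem IsState.integral_massMeasure (hg : IsState g) {E : Type*} [NormedAddCommGroup E]
    [NormedSpace ℝ E] (φ : Phase → E) : ∫ z, φ z ∂massMeasure g = ∫ z, g z • φ z := by
  rw [massMeasure, integral_withDensity_eq_integral_toReal_smul
    hg.measurable.ennreal_ofReal (Filter.Eventually.of_forall fun _ => ENNReal.ofReal_lt_top)]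
  simp [ENNReal.toReal_ofReal (hg.nonneg _)]

theorem IsState.ae_massMeasure (hg : IsState g) {p : Phase → Prop} (hp : ∀ z, g z ≠ 0 → p z) :
    ∀ᵐ z ∂massMeasure g, p z := by
  rw [massMeasure, ae_withDensity_iff hg.measurable.ennreal_ofReal]
  refine Filter.Eventually.of_forall fun z hz => hp z fun h => hz ?_
  simp [h]

theorem IsState.exists_velocityLe (hg : IsState g) : ∃ P, 0 < P ∧ VelocityLe g P := by
  obtain ⟨P, hP⟩ := hg.hasCompactSupport.isBounded.exists_norm_le
  exact ⟨max P 1, by positivity, fun z hz =>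
    (norm_snd_le z).trans ((hP z (subset_tsupport g hz)).trans (le_max_left _ _))⟩

/-- A state bounded by `C` with velocities bounded by `P` has a spatial density bounded by `C`
times the volume of the ball of radius `P`. -/
theorem IsState.densityLe (hg : IsState g) {C P : ℝ} (hC0 : 0 ≤ C) (hC : ∀ z, g z ≤ C)
    (hP : VelocityLe g P) :
    DensityLe ((massMeasure g).map Prod.fst)
      (C * volume.real (Metric.closedBall (0 : Space) P)) := by
  have := hg.isFiniteMeasure
  refine ⟨inferInstance, by positivity, Measure.le_iff.2 fun S hS => ?_⟩
  rw [Measure.map_apply measurable_fst hS, massMeasure,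
    withDensity_apply _ (measurable_fst hS), Measure.smul_apply, smul_eq_mul,
    ENNReal.ofReal_mul hC0, measureReal_def, ENNReal.ofReal_toReal measure_closedBall_lt_top.ne]
  calc ∫⁻ z in Prod.fst ⁻¹' S, ENNReal.ofReal (g z)
      ≤ ∫⁻ z in Prod.fst ⁻¹' S,
          (univ ×ˢ Metric.closedBall (0 : Space) P).indicator (fun _ => ENNReal.ofReal C) z := by
        refine lintegral_mono fun z => ?_
        by_cases hz : g z = 0
        · simp [hz]
        · rw [indicator_of_mem (show z ∈ univ ×ˢ Metric.closedBall (0 : Space) P from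
            ⟨mem_univ _, by simpa using hP z hz⟩)]
          exact ENNReal.ofReal_le_ofReal (hC z)
    _ = ENNReal.ofReal C * volume (S ×ˢ Metric.closedBall (0 : Space) P) := by
        rw [lintegral_indicator (MeasurableSet.univ.prod measurableSet_closedBall),
          lintegral_const, Measure.restrict_restrict
            (MeasurableSet.univ.prod measurableSet_closedBall), Measure.restrict_apply_univ]
        congr 2
        ext z
        simp [and_comm]
    _ = _ := by
        rw [Measure.volume_eq_prod, Measure.prod_prod]
        ring

end

/-! ### Newton's shell theorem -/

/-- Polar coordinates in a Euclidean plane, for radial integrands. -/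
theorem lintegral_norm_of_finrank_eq_two {W : Type*} [NormedAddCommGroup W]
    [InnerProductSpace ℝ W] [FiniteDimensional ℝ W] [MeasurableSpace W] [BorelSpace W]
    (hW : Module.finrank ℝ W = 2) {f : ℝ → ℝ≥0∞} (hf : Measurable f) :
    ∫⁻ w : W, f ‖w‖ =
      (volume : Measure W).toSphere univ * ∫⁻ s in Ioi (0 : ℝ), ENNReal.ofReal s * f s := by
  have : Nontrivial W := Module.nontrivial_of_finrank_pos (R := ℝ) (by omega)
  calc ∫⁻ w : W, f ‖w‖
      = ∫⁻ w : ({(0)}ᶜ : Set W), f ‖w.1‖ ∂(Measure.comap Subtype.val volume) := by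
        rw [lintegral_subtype_comap (measurableSet_singleton _).compl fun w => f ‖w‖,
          restrict_compl_singleton]
    _ = ∫⁻ x, f x.2 ∂((volume : Measure W).toSphere.prod (.volumeIoiPow 1)) := by
        have h := (volume : Measure W).measurePreserving_homeomorphUnitSphereProd
        rw [hW] at h
        rw [← h.lintegral_comp (f := fun x => f x.2) (by fun_prop)]
        simp
    _ = (volume : Measure W).toSphere univ * ∫⁻ s : Ioi (0 : ℝ), f s ∂(.volumeIoiPow 1) := by
        rw [lintegral_prod_symm _ (by fun_prop)]
        simp only [lintegral_const]
        rw [lintegral_mul_const _ (by fun_prop), mul_comm]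
    _ = _ := by
        rw [Measure.volumeIoiPow, lintegral_withDensity_eq_lintegral_mul _ (by fun_prop)
          (by fun_prop)]
        simp only [Pi.mul_apply, pow_one]
        rw [lintegral_subtype_comap measurableSet_Ioi fun s => ENNReal.ofReal s * f s]

/-- The substitution `u = √(z² + s²)`. -/
theorem lintegral_sqrt_add_sq (z : ℝ) (f : ℝ → ℝ≥0∞) :
    ∫⁻ s in Ioi (0 : ℝ), ENNReal.ofReal s * f (Real.sqrt (z ^ 2 + s ^ 2)) =
      ∫⁻ u in Ioi |z|, ENNReal.ofReal u * f u := by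
  have himg : (fun s : ℝ => Real.sqrt (z ^ 2 + s ^ 2)) '' Ioi 0 = Ioi |z| := by
    ext u
    constructor
    · rintro ⟨s, hs, rfl⟩
      refine Real.lt_sqrt_of_sq_lt ?_
      rw [sq_abs]
      have : 0 < s ^ 2 := pow_pos hs 2
      linarith
    · intro hu
      have hu0 : 0 < u := (abs_nonneg z).trans_lt hu
      have h1 : z ^ 2 < u ^ 2 := by
        rw [← sq_abs z]; exact pow_lt_pow_left₀ hu (abs_nonneg z) two_ne_zero
      refine ⟨Real.sqrt (u ^ 2 - z ^ 2), Real.sqrt_pos.2 (by linarith), ?_⟩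
      beta_reduce
      rw [Real.sq_sqrt (by linarith), add_sub_cancel, Real.sqrt_sq hu0.le]
  rw [← himg, lintegral_image_eq_lintegral_abs_deriv_mul measurableSet_Ioi
    (f' := fun s => s / Real.sqrt (z ^ 2 + s ^ 2))]
  · refine setLIntegral_congr_fun measurableSet_Ioi fun s hs => ?_
    have hs' : (0 : ℝ) < s := hs
    have hw : 0 < Real.sqrt (z ^ 2 + s ^ 2) := Real.sqrt_pos.2 (by positivity)
    rw [abs_of_nonneg (by positivity), ← mul_assoc, ← ENNReal.ofReal_mul (by positivity),
      div_mul_cancel₀ _ hw.ne']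
  · intro s hs
    have hs' : (0 : ℝ) < s := hs
    have h := (((hasDerivAt_id s).pow 2).const_add (z ^ 2)).sqrt
      (show z ^ 2 + s ^ 2 ≠ 0 by positivity)
    refine HasDerivAt.hasDerivWithinAt (h.congr_deriv ?_)
    simp only [Nat.cast_ofNat, Nat.add_one_sub_one, pow_one, mul_one, Pi.pow_apply, id]
    exact mul_div_mul_left _ _ two_ne_zero
  · intro a ha b hb hab
    have ha' : (0 : ℝ) < a := ha
    have hb' : (0 : ℝ) < b := hb
    have h := (Real.sqrt_inj (by positivity) (by positivity)).1 hab
    exact (sq_eq_sq₀ ha'.le hb'.le).1 (by linarith)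

/-- The pairs `(⟪e, y⟫, ‖y‖)` that occur for some `y` off the axis spanned by `e`. -/
def axialRegion : Set (ℝ × ℝ) := {p | |p.1| < p.2}

theorem measurableSet_axialRegion : MeasurableSet axialRegion :=
  measurableSet_lt (by fun_prop) measurable_snd

/-- Archimedes' hat-box theorem: under `y ↦ (⟪e, y⟫, ‖y‖)`, Lebesgue measure on `ℝ³` becomes a
multiple of `u dz du` on `|z| < u`. The value of the constant is irrelevant here. -/
theorem exists_map_inner_norm (e : Space) (he : ‖e‖ = 1) : ∃ c : ℝ≥0∞, c ≠ ⊤ ∧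
    (volume : Measure Space).map (fun y => (inner ℝ e y, ‖y‖)) =
      c • ((volume : Measure (ℝ × ℝ)).restrict axialRegion).withDensity
        fun p => ENNReal.ofReal p.2 := by
  let K : Submodule ℝ Space := Submodule.span ℝ {e}
  have he0 : e ≠ 0 := by rintro rfl; simp at he
  have hK2 : Module.finrank ℝ Kᗮ = 2 := by
    have : Fact (Module.finrank ℝ Space = 2 + 1) := ⟨by simp⟩
    exact Submodule.finrank_orthogonal_span_singleton he0
  refine ⟨(volume : Measure Kᗮ).toSphere univ, measure_ne_top _ _, Measure.ext fun S hS => ?_⟩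
  let ι := LinearIsometryEquiv.toSpanUnitSingleton (𝕜 := ℝ) e he
  have hΨ : MeasurePreserving (fun y : Space => (K.orthogonalDecomposition y).ofLp) :=
    (WithLp.volume_preserving_ofLp K Kᗮ).comp K.orthogonalDecomposition.measurePreserving
  have hι : MeasurePreserving (fun p : ℝ × Kᗮ => ((ι p.1, p.2) : K × Kᗮ)) :=
    ι.measurePreserving.prod (MeasurePreserving.id volume)
  have hmap : Measurable fun y : Space => (inner ℝ e y, ‖y‖) := by fun_prop
  set G : ℝ × ℝ → ℝ≥0∞ := S.indicator 1 with hG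
  have hGm : Measurable G := measurable_one.indicator hS
  -- in the coordinates `(k, w)` of `K × Kᗮ` the pair becomes `(⟪e, k⟫, √(‖k‖² + ‖w‖²))`
  have hcoord : ∀ y : Space, (inner ℝ e y, ‖y‖) =
      (inner ℝ e ((K.orthogonalDecomposition y).ofLp.1 : Space),
        Real.sqrt (‖(K.orthogonalDecomposition y).ofLp.1‖ ^ 2 +
          ‖(K.orthogonalDecomposition y).ofLp.2‖ ^ 2)) := by
    intro y
    ext1
    · have h := K.inner_starProjection_left_eq_right e y
      rw [K.starProjection_eq_self_iff.2 (Submodule.mem_span_singleton_self e)] at h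
      simpa using h
    · have h := WithLp.prod_norm_eq_of_L2 (K.orthogonalDecomposition y)
      rw [LinearIsometryEquiv.norm_map] at h
      exact h
  calc (volume : Measure Space).map (fun y => (inner ℝ e y, ‖y‖)) S
      = ∫⁻ y : Space, G (inner ℝ e y, ‖y‖) := by
        rw [← lintegral_indicator_one hS, lintegral_map hGm hmap]
    _ = ∫⁻ q : K × Kᗮ, G (inner ℝ e (q.1 : Space), Real.sqrt (‖q.1‖ ^ 2 + ‖q.2‖ ^ 2)) := by
        rw [← hΨ.lintegral_comp (f := fun q : K × Kᗮ =>
          G (inner ℝ e (q.1 : Space), Real.sqrt (‖q.1‖ ^ 2 + ‖q.2‖ ^ 2)))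
          (hGm.comp (by fun_prop))]
        exact lintegral_congr fun y => by rw [hcoord y]
    _ = ∫⁻ p : ℝ × Kᗮ, G (p.1, Real.sqrt (p.1 ^ 2 + ‖p.2‖ ^ 2)) := by
        rw [← hι.lintegral_comp (f := fun q : K × Kᗮ =>
          G (inner ℝ e (q.1 : Space), Real.sqrt (‖q.1‖ ^ 2 + ‖q.2‖ ^ 2)))
          (hGm.comp (by fun_prop))]
        refine lintegral_congr fun p => ?_
        have h1 : ‖ι p.1‖ ^ 2 = p.1 ^ 2 := by
          rw [LinearIsometryEquiv.norm_map, Real.norm_eq_abs, sq_abs]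
        have h2 : inner ℝ e ((ι p.1 : K) : Space) = p.1 := by
          rw [LinearIsometryEquiv.toSpanUnitSingleton_apply]
          simp [inner_smul_right, he]
        rw [h1, h2]
    _ = ∫⁻ z : ℝ, ∫⁻ w : Kᗮ, G (z, Real.sqrt (z ^ 2 + ‖w‖ ^ 2)) := by
        exact lintegral_prod (fun p : ℝ × Kᗮ => G (p.1, Real.sqrt (p.1 ^ 2 + ‖p.2‖ ^ 2)))
          (hGm.comp (by fun_prop)).aemeasurable
    _ = ∫⁻ z : ℝ, (volume : Measure Kᗮ).toSphere univ *
          ∫⁻ u : ℝ, (Ioi |z|).indicator (fun u => ENNReal.ofReal u * G (z, u)) u := by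
        refine lintegral_congr fun z => ?_
        rw [lintegral_norm_of_finrank_eq_two hK2 (f := fun s => G (z, Real.sqrt (z ^ 2 + s ^ 2)))
          (hGm.comp (by fun_prop)), lintegral_sqrt_add_sq z fun u => G (z, u),
          lintegral_indicator measurableSet_Ioi]
    _ = (volume : Measure Kᗮ).toSphere univ *
          ∫⁻ p : ℝ × ℝ, axialRegion.indicator (fun p => ENNReal.ofReal p.2 * G p) p := by
        have hm : Measurable fun p : ℝ × ℝ => ENNReal.ofReal p.2 * G p := by fun_prop
        rw [lintegral_const_mul' _ _ (measure_ne_top _ _), Measure.volume_eq_prod,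
          lintegral_prod _ (hm.indicator measurableSet_axialRegion).aemeasurable]
        rfl
    _ = _ := by
        rw [Measure.smul_apply, smul_eq_mul, withDensity_apply _ hS,
          lintegral_indicator measurableSet_axialRegion, ← lintegral_indicator hS]
        congr 2
        ext p
        by_cases hp : p ∈ S <;> simp [hG, hp]

/-- The axial component of the kernel, seen from a point at distance `r` from the origin and
integrated over the sphere of radius `u` in the coordinate `z = ⟪e, y⟫`. It vanishes if the point
lies inside the sphere, and is the value for a point mass at the centre if it lies outside. -/
theorem integral_axial_kernel {r u : ℝ} (hr : 0 < r) (hu : 0 < u) (hur : u ≠ r) :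
    ∫ z in Ioo (-u) u, (r - z) / Real.sqrt (r ^ 2 - 2 * r * z + u ^ 2) ^ 3 =
      if u < r then 2 * u / r ^ 2 else 0 := by
  have hpos : ∀ z ∈ Icc (-u) u, 0 < r ^ 2 - 2 * r * z + u ^ 2 := by
    intro z hz
    have h1 : 0 < (u - r) ^ 2 := by have := sub_ne_zero.2 hur; positivity
    nlinarith [hz.2]
  have hder : ∀ z ∈ uIcc (-u) u, HasDerivAt
      (fun z => (z * r - u ^ 2) / (r ^ 2 * Real.sqrt (r ^ 2 - 2 * r * z + u ^ 2)))
      ((r - z) / Real.sqrt (r ^ 2 - 2 * r * z + u ^ 2) ^ 3) z := by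
    intro z hz
    rw [uIcc_of_le (by linarith)] at hz
    have h0 := hpos z hz
    have hw : 0 < Real.sqrt (r ^ 2 - 2 * r * z + u ^ 2) := Real.sqrt_pos.2 h0
    have hw2 := Real.sq_sqrt h0.le
    have h1 : HasDerivAt (fun z => r ^ 2 - 2 * r * z + u ^ 2) (-(2 * r)) z := by
      simpa using (((hasDerivAt_id z).const_mul (2 * r)).const_sub (r ^ 2)).add_const (u ^ 2)
    have h2 := (h1.sqrt h0.ne').const_mul (r ^ 2)
    have h3 : HasDerivAt (fun z => z * r - u ^ 2) r z := by
      simpa using ((hasDerivAt_id z).mul_const r).sub_const (u ^ 2)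
    have h4 := h3.div h2 (by positivity)
    refine h4.congr_deriv ?_
    set w := Real.sqrt (r ^ 2 - 2 * r * z + u ^ 2) with hwdef
    field_simp
    rw [hw2]
    ring
  have hcont : ContinuousOn
      (fun z => (r - z) / Real.sqrt (r ^ 2 - 2 * r * z + u ^ 2) ^ 3) (uIcc (-u) u) := by
    rw [uIcc_of_le (by linarith)]
    refine ContinuousOn.div (by fun_prop) (by fun_prop) fun z hz => ?_
    exact (pow_pos (Real.sqrt_pos.2 (hpos z hz)) 3).ne'
  have h := intervalIntegral.integral_eq_sub_of_hasDerivAt hder hcont.intervalIntegrable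
  rw [← integral_Ioc_eq_integral_Ioo, ← intervalIntegral.integral_of_le (by linarith), h]
  have e1 : r ^ 2 - 2 * r * u + u ^ 2 = (r - u) ^ 2 := by ring
  have e2 : r ^ 2 - 2 * r * -u + u ^ 2 = (r + u) ^ 2 := by ring
  rw [e1, e2, Real.sqrt_sq_eq_abs, Real.sqrt_sq (by positivity)]
  split_ifs with hlt
  · rw [abs_of_pos (by linarith)]
    have : r - u ≠ 0 := by linarith
    field_simp
    ring
  · have hgt : r < u := lt_of_le_of_ne (not_lt.1 hlt) hur.symm
    rw [abs_of_neg (by linarith)]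
    have : r - u ≠ 0 := by linarith
    have : u - r ≠ 0 := by linarith
    field_simp
    ring

/-- Axially symmetric integrals in the coordinates `z = ⟪e, y⟫` and `u = ‖y‖`. -/
theorem exists_integral_inner_norm (e : Space) (he : ‖e‖ = 1) : ∃ c : ℝ, ∀ G : ℝ × ℝ → ℝ,
    Measurable G → Integrable (fun y : Space => G (inner ℝ e y, ‖y‖)) →
    ∫ y : Space, G (inner ℝ e y, ‖y‖) =
      c * ∫ u in Ioi (0 : ℝ), u * ∫ z in Ioo (-u) u, G (z, u) := by
  obtain ⟨c, hc, hmap⟩ := exists_map_inner_norm e he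
  refine ⟨c.toReal, fun G hG hint => ?_⟩
  have hm : Measurable fun y : Space => (inner ℝ e y, ‖y‖) := by fun_prop
  have hw : Measurable fun p : ℝ × ℝ => ENNReal.ofReal p.2 := by fun_prop
  have hw' : ∀ᵐ p : ℝ × ℝ ∂(volume.restrict axialRegion), ENNReal.ofReal p.2 < ⊤ :=
    Filter.Eventually.of_forall fun _ => ENNReal.ofReal_lt_top
  have e1 : ∫ y : Space, G (inner ℝ e y, ‖y‖) =
      ∫ p, G p ∂((volume : Measure Space).map fun y => (inner ℝ e y, ‖y‖)) :=
    (integral_map hm.aemeasurable hG.aestronglyMeasurable).symm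
  have i1 : Integrable G ((volume : Measure Space).map fun y => (inner ℝ e y, ‖y‖)) :=
    (integrable_map_measure hG.aestronglyMeasurable hm.aemeasurable).2 hint
  rw [hmap] at e1 i1
  rw [e1, integral_smul_measure, smul_eq_mul]
  rcases eq_or_ne c 0 with rfl | hc0
  · simp
  congr 1
  rw [integrable_smul_measure hc0 hc, integrable_withDensity_iff_integrable_smul' hw hw'] at i1
  rw [integral_withDensity_eq_integral_toReal_smul hw hw',
    ← integral_indicator measurableSet_axialRegion, Measure.volume_eq_prod]
  have i2 : Integrable (axialRegion.indicator fun p : ℝ × ℝ =>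
      (ENNReal.ofReal p.2).toReal • G p) ((volume : Measure ℝ).prod volume) :=
    (integrable_indicator_iff measurableSet_axialRegion).2 i1
  rw [integral_prod_symm _ i2, ← integral_indicator measurableSet_Ioi]
  congr 1
  ext1 u
  by_cases hu : 0 < u
  · rw [indicator_of_mem (show u ∈ Ioi 0 from hu), ← integral_const_mul,
      ← integral_indicator measurableSet_Ioo]
    congr 1
    ext1 z
    by_cases hz : |z| < u
    · rw [indicator_of_mem (show (z, u) ∈ axialRegion from hz),
        indicator_of_mem (show z ∈ Ioo (-u) u from abs_lt.1 hz), ENNReal.toReal_ofReal hu.le,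
        smul_eq_mul]
    · rw [indicator_of_notMem (show (z, u) ∉ axialRegion from hz),
        indicator_of_notMem (show z ∉ Ioo (-u) u from fun h => hz (abs_lt.2 h))]
  · rw [indicator_of_notMem (show u ∉ Ioi 0 from hu)]
    refine integral_eq_zero_of_ae (Filter.Eventually.of_forall fun z => ?_)
    exact indicator_of_notMem (show (z, u) ∉ axialRegion from fun h =>
      hu ((abs_nonneg z).trans_lt h)) _

/-- **Newton's shell theorem**: the field of a rotationally invariant mass distribution at `x` is
that of the mass closer to the origin than `x`, concentrated at the origin. -/
theorem shell_theorem {ρ : Space → ℝ} {h : ℝ → ℝ} (hh : Measurable h) (hρ : ∀ y, ρ y = h ‖y‖)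
    (hint : Integrable ρ) (x : Space)
    (hK : Integrable fun y => (ρ y / ‖x - y‖ ^ 3) • (x - y)) :
    ∫ y, (ρ y / ‖x - y‖ ^ 3) • (x - y) =
      ((∫ y in Metric.ball 0 ‖x‖, ρ y) / ‖x‖ ^ 3) • x := by
  set F : Space := ∫ y, (ρ y / ‖x - y‖ ^ 3) • (x - y) with hF
  -- the half-turn about the axis through `x` leaves the field at `x` invariant
  have hax : F ∈ Submodule.span ℝ {x} := by
    set R := (Submodule.span ℝ {x}).reflection with hR
    rw [← Submodule.reflection_eq_self_iff, ← hR]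
    have hRx : R x = x := Submodule.reflection_mem_subspace_eq_self
      (Submodule.mem_span_singleton_self x)
    have h1 : R F = ∫ y, R ((ρ y / ‖x - y‖ ^ 3) • (x - y)) :=
      (R.toContinuousLinearEquiv.toContinuousLinearMap.integral_comp_comm hK).symm
    rw [h1, hF, ← R.measurePreserving.integral_comp R.toHomeomorph.measurableEmbedding
      (fun y => (ρ y / ‖x - y‖ ^ 3) • (x - y))]
    congr 1
    ext1 y
    have h2 : x - R y = R (x - y) := by rw [map_sub, hRx]
    rw [h2, LinearIsometryEquiv.norm_map, hρ (R y), LinearIsometryEquiv.norm_map, ← hρ, map_smul]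
  obtain ⟨a, ha⟩ := Submodule.mem_span_singleton.1 hax
  rcases eq_or_ne x 0 with rfl | hx
  · rw [← ha]; simp
  set r := ‖x‖ with hr
  have hr0 : 0 < r := norm_pos_iff.2 hx
  set e : Space := r⁻¹ • x with he
  have hxe : x = r • e := by rw [he, smul_smul, mul_inv_cancel₀ hr0.ne', one_smul]
  have he1 : ‖e‖ = 1 := by
    rw [he, norm_smul, norm_inv, Real.norm_of_nonneg hr0.le, inv_mul_cancel₀ hr0.ne']
  obtain ⟨c, hc⟩ := exists_integral_inner_norm e he1
  let G₁ : ℝ × ℝ → ℝ := fun p =>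
    h p.2 * ((r - p.1) / Real.sqrt (r ^ 2 - 2 * r * p.1 + p.2 ^ 2) ^ 3)
  let G₂ : ℝ × ℝ → ℝ := fun p => (Iio r).indicator h p.2
  have hG₁ : Measurable G₁ := by fun_prop
  have hG₂ : Measurable G₂ := (hh.indicator measurableSet_Iio).comp measurable_snd
  have e1 : ∀ y : Space, G₁ (inner ℝ e y, ‖y‖) =
      inner ℝ e ((ρ y / ‖x - y‖ ^ 3) • (x - y)) := by
    intro y
    have h1 : ‖x - y‖ = Real.sqrt (r ^ 2 - 2 * r * inner ℝ e y + ‖y‖ ^ 2) := by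
      rw [← Real.sqrt_sq (norm_nonneg (x - y)), norm_sub_sq_real, hxe, inner_smul_left, ← hxe]
      simp only [conj_trivial]
      congr 2
      ring
    have h2 : inner ℝ e (x - y) = r - inner ℝ e y := by
      rw [inner_sub_right]
      congr 1
      rw [hxe, inner_smul_right, real_inner_self_eq_norm_sq, he1]
      ring
    rw [inner_smul_right, h2, h1, hρ]
    simp only [G₁]
    ring
  have e2 : ∀ y : Space, G₂ (inner ℝ e y, ‖y‖) = (Metric.ball (0 : Space) r).indicator ρ y := by
    intro y
    simp only [G₂, indicator, mem_Iio, mem_ball_zero_iff, hρ]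
  have h1 := hc G₁ hG₁ (by
    simp_rw [e1]
    exact hK.const_inner e)
  have h2 := hc G₂ hG₂ (by
    simp_rw [e2]
    exact hint.indicator Metric.isOpen_ball.measurableSet)
  simp_rw [e1] at h1
  simp_rw [e2] at h2
  rw [integral_inner hK, ← hF] at h1
  rw [integral_indicator Metric.isOpen_ball.measurableSet] at h2
  have key : ∫ u in Ioi (0 : ℝ), u * ∫ z in Ioo (-u) u, G₁ (z, u) =
      (r ^ 2)⁻¹ * ∫ u in Ioi (0 : ℝ), u * ∫ z in Ioo (-u) u, G₂ (z, u) := by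
    rw [← integral_const_mul]
    refine integral_congr_ae ?_
    have hne : ∀ᵐ u : ℝ ∂(volume.restrict (Ioi 0)), u ≠ r := by
      refine ae_restrict_of_ae ?_
      simp [ae_iff]
    filter_upwards [hne, ae_restrict_mem measurableSet_Ioi] with u hur hu
    have hu' : (0 : ℝ) < u := hu
    simp only [G₁, G₂]
    rw [integral_const_mul, integral_axial_kernel hr0 hu' hur, setIntegral_const]
    have hv : volume.real (Ioo (-u) u) = 2 * u := by
      rw [Real.volume_real_Ioo_of_le (by linarith)]; ring
    rw [hv, smul_eq_mul]
    by_cases hlt : u < r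
    · rw [if_pos hlt, indicator_of_mem (show u ∈ Iio r from hlt)]
      field_simp
    · rw [if_neg hlt, indicator_of_notMem (show u ∉ Iio r from hlt)]
      ring
  rw [key, mul_left_comm, ← h2, ← ha, inner_smul_right] at h1
  have h3 : inner ℝ e x = r := by
    rw [hxe, inner_smul_right, real_inner_self_eq_norm_sq, he1]
    ring
  rw [h3] at h1
  rw [← ha]
  congr 1
  field_simp
  field_simp at h1
  linarith

/-! ### Rotations -/

theorem norm_rotate (A : Matrix.specialOrthogonalGroup (Fin 3) ℝ) (x : Space) :
    ‖rotate A x‖ = ‖x‖ := by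
  have hA : (A : Matrix (Fin 3) (Fin 3) ℝ).conjTranspose * (A : Matrix (Fin 3) (Fin 3) ℝ) = 1 :=
    (Matrix.mem_specialOrthogonalGroup_iff.1 A.2).1.1
  have h : inner ℝ (rotate A x) (rotate A x) = inner ℝ x x := by
    unfold rotate
    rw [← LinearMap.adjoint_inner_left, ← Matrix.toEuclideanLin_conjTranspose_eq_adjoint]
    congr 1
    unfold Matrix.toEuclideanLin
    rw [← LinearMap.comp_apply, ← Matrix.toLpLin_mul_same, hA]
    simp
  rw [real_inner_self_eq_norm_sq, real_inner_self_eq_norm_sq] at h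
  exact (sq_eq_sq₀ (norm_nonneg _) (norm_nonneg _)).1 h

/-- The rotation `A` as a linear isometry. -/
def rotation (A : Matrix.specialOrthogonalGroup (Fin 3) ℝ) : Space ≃ₗᵢ[ℝ] Space :=
  LinearIsometry.toLinearIsometryEquiv
    ⟨Matrix.toEuclideanLin (A : Matrix (Fin 3) (Fin 3) ℝ), norm_rotate A⟩ rfl

theorem exists_rotate_eq_reflection {w : Space} (hw : w ≠ 0) :
    ∃ A : Matrix.specialOrthogonalGroup (Fin 3) ℝ, ∀ x,
      rotate A x = (Submodule.span ℝ {w}).reflection x := by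
  set U := (Submodule.span ℝ {w}).reflection with hU
  let b := EuclideanSpace.basisFun (Fin 3) ℝ
  set A : Matrix (Fin 3) (Fin 3) ℝ := LinearMap.toMatrix b.toBasis b.toBasis U.toLinearMap with hA
  have hlin : Matrix.toEuclideanLin A = U.toLinearMap := by
    rw [Matrix.toEuclideanLin_eq_toLin_orthonormal, hA, Matrix.toLin_toMatrix]
  have hAA : A.conjTranspose * A = 1 := by
    apply Matrix.toEuclideanLin.injective
    ext1 x
    refine ext_inner_right ℝ fun y => ?_
    have h1 : Matrix.toEuclideanLin (A.conjTranspose * A) x =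
        Matrix.toEuclideanLin A.conjTranspose (Matrix.toEuclideanLin A x) := by
      simp [Matrix.toEuclideanLin]
    have h2 : Matrix.toEuclideanLin (1 : Matrix (Fin 3) (Fin 3) ℝ) x = x := by
      simp [Matrix.toEuclideanLin]
    rw [h1, h2, Matrix.toEuclideanLin_conjTranspose_eq_adjoint, LinearMap.adjoint_inner_left, hlin]
    exact U.inner_map_map x y
  have hdet : A.det = 1 := by
    have h1 : Module.finrank ℝ (Submodule.span ℝ {w})ᗮ = 2 := by
      have : Fact (Module.finrank ℝ Space = 2 + 1) := ⟨by simp⟩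
      exact Submodule.finrank_orthogonal_span_singleton hw
    have h2 := Submodule.det_reflection (Submodule.span ℝ {w})
    rw [h1] at h2
    rw [hA, LinearMap.det_toMatrix]
    exact h2.trans (by norm_num)
  refine ⟨⟨A, Matrix.mem_specialOrthogonalGroup_iff.2
    ⟨(Matrix.mem_orthogonalGroup_iff' _ _).2 hAA, hdet⟩⟩, fun x => ?_⟩
  change Matrix.toEuclideanLin A x = U x
  rw [hlin]
  rfl

/-- `SO(3)` acts transitively on spheres. Half-turns about suitable axes already do. -/
theorem exists_rotate_eq {x y : Space} (h : ‖x‖ = ‖y‖) :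
    ∃ A : Matrix.specialOrthogonalGroup (Fin 3) ℝ, rotate A x = y := by
  by_cases hxy : x + y = 0
  · -- antipodal points: turn about an axis orthogonal to `x`
    have hy : y = -x := by rw [eq_neg_iff_add_eq_zero, add_comm]; exact hxy
    obtain ⟨w, hw, hw0⟩ : ∃ w ∈ (Submodule.span ℝ {x})ᗮ, w ≠ 0 := by
      refine Submodule.exists_mem_ne_zero_of_ne_bot fun hbot => ?_
      have h1 := Submodule.finrank_add_finrank_orthogonal (Submodule.span ℝ {x})
      have h2 : Module.finrank ℝ (Submodule.span ℝ {x}) ≤ 1 :=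
        (finrank_span_le_card _).trans (by simp)
      rw [hbot, finrank_bot, finrank_euclideanSpace_fin] at h1
      omega
    obtain ⟨A, hA⟩ := exists_rotate_eq_reflection hw0
    refine ⟨A, ?_⟩
    have h3 : inner ℝ w x = 0 := by
      rw [real_inner_comm]
      exact (Submodule.mem_orthogonal _ w).1 hw x (Submodule.mem_span_singleton_self x)
    rw [hA, Submodule.reflection_singleton_apply, h3, hy]
    simp
  · obtain ⟨A, hA⟩ := exists_rotate_eq_reflection hxy
    refine ⟨A, ?_⟩
    have h1 : ‖x + y‖ ^ 2 = 2 * inner ℝ (x + y) x := by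
      rw [norm_add_sq_real, inner_add_left, real_inner_self_eq_norm_sq, real_inner_comm x y, ← h]
      ring
    have h2 : inner ℝ (x + y) x / ‖x + y‖ ^ 2 = 1 / 2 := by
      have : ‖x + y‖ ^ 2 ≠ 0 := pow_ne_zero 2 (norm_ne_zero_iff.2 hxy)
      rw [div_eq_div_iff this two_ne_zero, h1]
      ring
    rw [hA, Submodule.reflection_singleton_apply]
    simp only [RCLike.ofReal_real_eq_id, id]
    rw [h2, two_nsmul, ← add_smul]
    norm_num

/-! ### The gravitational field of a state -/

/-- The kernel `y / |y|³` of the gravitational field. -/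
def kernel (y : Space) : Space := (‖y‖ ^ 3)⁻¹ • y

theorem measurable_kernel : Measurable kernel := by unfold kernel; fun_prop

theorem norm_kernel (y : Space) : ‖kernel y‖ = (‖y‖ ^ 2)⁻¹ := by
  rw [kernel, norm_smul, norm_inv, norm_pow, norm_norm]
  rcases eq_or_ne ‖y‖ 0 with h | h
  · simp [h]
  · field_simp

theorem integrableOn_inv_norm_sq (R : ℝ) :
    IntegrableOn (fun y : Space => (‖y‖ ^ 2)⁻¹) (Metric.ball 0 R) := by
  rw [integrableOn_fun_norm_addHaar volume (f := fun s : ℝ => (s ^ 2)⁻¹),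
    finrank_euclideanSpace_fin]
  refine (integrableOn_const (s := Ioo 0 R) (C := (1 : ℝ)) (by simp)).congr_fun ?_
    measurableSet_Ioo
  intro s hs
  have : s ≠ 0 := hs.1.ne'
  simp only [Nat.add_one_sub_one, smul_eq_mul]
  field_simp

theorem DensityLe.restrict_le {μ : Measure Space} {D : ℝ} (h : DensityLe μ D) (S : Set Space) :
    μ.restrict S ≤ ENNReal.ofReal D • volume.restrict S := by
  rw [← Measure.restrict_smul]
  exact Measure.restrict_mono subset_rfl h.le

/-- A function of `x - y` that is integrable near the origin and bounded away from it is integrable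
in `y`, with a bound that does not depend on `x`. -/
theorem DensityLe.integral_comp_sub_le {μ : Measure Space} {D c : ℝ} (h : DensityLe μ D)
    {φ : Space → ℝ} (hm : Measurable φ) (h0 : ∀ y, 0 ≤ φ y)
    (hφ : IntegrableOn φ (Metric.ball 0 1)) (hc : ∀ y, 1 ≤ ‖y‖ → φ y ≤ c) (x : Space) :
    Integrable (fun y => φ (x - y)) μ ∧
      ∫ y, φ (x - y) ∂μ ≤ D * (∫ y in Metric.ball 0 1, φ y) + c * μ.real univ := by
  have := h.finite
  have hm' : Measurable fun y => φ (x - y) := hm.comp (by fun_prop)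
  have hmp := Measure.measurePreserving_sub_left (volume : Measure Space) x
  have he := (Homeomorph.subLeft x).measurableEmbedding
  have h3 : (fun y => x - y) ⁻¹' Metric.ball 0 1 = Metric.ball x 1 := by
    ext y; simp [dist_eq_norm, norm_sub_rev]
  have h1 : IntegrableOn (fun y => φ (x - y)) (Metric.ball x 1) := by
    have h2 := hmp.integrableOn_comp_preimage he (f := φ) (s := Metric.ball 0 1)
    rw [h3] at h2
    exact h2.2 hφ
  have h4 := Integrable.smul_measure h1 (ENNReal.ofReal_ne_top (r := D))
  have h5 : ∀ᵐ y ∂μ.restrict (Metric.ball x 1)ᶜ, φ (x - y) ≤ c := by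
    filter_upwards [ae_restrict_mem Metric.isOpen_ball.measurableSet.compl] with y hy
    rw [mem_compl_iff, Metric.mem_ball, not_lt, dist_comm, dist_eq_norm] at hy
    exact hc _ hy
  have hin : IntegrableOn (fun y => φ (x - y)) (Metric.ball x 1) μ :=
    h4.mono_measure (h.restrict_le _)
  have hout : IntegrableOn (fun y => φ (x - y)) (Metric.ball x 1)ᶜ μ := by
    refine Measure.integrableOn_of_bounded (M := c) (measure_ne_top _ _)
      hm'.aestronglyMeasurable ?_
    filter_upwards [h5] with y hy
    rwa [Real.norm_of_nonneg (h0 _)]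
  have hint : Integrable (fun y => φ (x - y)) μ := by
    rw [← integrableOn_univ, ← union_compl_self (Metric.ball x 1), integrableOn_union]
    exact ⟨hin, hout⟩
  refine ⟨hint, ?_⟩
  rw [← integral_add_compl Metric.isOpen_ball.measurableSet hint]
  refine add_le_add ?_ ?_
  · refine (integral_mono_measure (h.restrict_le _)
      (Filter.Eventually.of_forall fun _ => h0 _) h4).trans_eq ?_
    have h6 := hmp.setIntegral_preimage_emb he φ (Metric.ball 0 1)
    rw [h3] at h6
    rw [integral_smul_measure, ENNReal.toReal_ofReal h.nonneg, smul_eq_mul, h6]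
  · have hc0 : 0 ≤ c := by
      let e : Space := EuclideanSpace.single 0 1
      exact (h0 e).trans (hc e (by simp [e]))
    calc ∫ y in (Metric.ball x 1)ᶜ, φ (x - y) ∂μ
        ≤ ∫ _ in (Metric.ball x 1)ᶜ, c ∂μ := integral_mono_ae hout (integrable_const c) h5
      _ = c * μ.real (Metric.ball x 1)ᶜ := by simp [mul_comm]
      _ ≤ c * μ.real univ := mul_le_mul_of_nonneg_left (measureReal_mono (subset_univ _)) hc0

theorem DensityLe.integrable_inv_norm_sq {μ : Measure Space} {D : ℝ} (h : DensityLe μ D)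
    (x : Space) : Integrable (fun y => (‖x - y‖ ^ 2)⁻¹) μ :=
  (h.integral_comp_sub_le (φ := fun y => (‖y‖ ^ 2)⁻¹) (c := 1) (by fun_prop)
    (fun _ => by positivity) (integrableOn_inv_norm_sq 1)
    (fun _ hy => inv_le_one_of_one_le₀ (one_le_pow₀ hy)) x).1

theorem DensityLe.integrable_kernel {μ : Measure Space} {D : ℝ} (h : DensityLe μ D)
    (x : Space) : Integrable (fun y => kernel (x - y)) μ := by
  have hm : Measurable fun y : Space => kernel (x - y) := measurable_kernel.comp (by fun_prop)
  refine (h.integrable_inv_norm_sq x).mono' hm.aestronglyMeasurable ?_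
  exact Filter.Eventually.of_forall fun y => (norm_kernel _).le

section

variable {g : Phase → ℝ}

theorem IsState.exists_bound (hg : IsState g) : ∃ C, 0 ≤ C ∧ ∀ z, g z ≤ C := by
  obtain ⟨C, hC⟩ := hg.bounded
  exact ⟨C, (hg.nonneg 0).trans (hC 0), hC⟩

theorem IsState.exists_densityLe (hg : IsState g) :
    ∃ D, DensityLe ((massMeasure g).map Prod.fst) D := by
  obtain ⟨C, hC0, hC⟩ := hg.exists_bound
  obtain ⟨P, -, hP⟩ := hg.exists_velocityLe
  exact ⟨_, hg.densityLe hC0 hC hP⟩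

theorem IsState.integrable_slice (hg : IsState g) (x : Space) :
    Integrable fun v : Space => g (x, v) := by
  obtain ⟨C, hC0, hC⟩ := hg.exists_bound
  obtain ⟨P, -, hP⟩ := hg.exists_velocityLe
  refine (integrableOn_iff_integrable_of_support_subset
    (s := Metric.closedBall (0 : Space) P) fun v hv => by simpa using hP _ hv).1 ?_
  refine Measure.integrableOn_of_bounded (M := C) measure_closedBall_lt_top.ne
    (hg.measurable.comp measurable_prodMk_left).aestronglyMeasurable
    (Filter.Eventually.of_forall fun v => ?_)
  rw [Real.norm_of_nonneg (hg.nonneg _)]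
  exact hC _

theorem IsState.density_nonneg (hg : IsState g) (x : Space) : 0 ≤ density g x :=
  integral_nonneg fun _ => hg.nonneg _

theorem IsState.measurable_density (hg : IsState g) : Measurable (density g) :=
  (hg.measurable.stronglyMeasurable.integral_prod_right' (ν := volume)).measurable

theorem IsState.integrable_density (hg : IsState g) : Integrable (density g) :=
  Integrable.integral_prod_left (μ := volume) (ν := volume) hg.integrable

/-- The spatial marginal of the mass distribution has density `ρ`. -/
theorem IsState.map_fst_massMeasure (hg : IsState g) :
    (massMeasure g).map Prod.fst = volume.withDensity fun x => ENNReal.ofReal (density g x) := by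
  refine Measure.ext fun S hS => ?_
  rw [Measure.map_apply measurable_fst hS, massMeasure, withDensity_apply _ (measurable_fst hS),
    withDensity_apply _ hS, ← prod_univ, Measure.volume_eq_prod, ← Measure.prod_restrict,
    Measure.restrict_univ, lintegral_prod _ hg.measurable.ennreal_ofReal.aemeasurable]
  refine lintegral_congr fun x => ?_
  exact (ofReal_integral_eq_lintegral_ofReal (hg.integrable_slice x)
    (Filter.Eventually.of_forall fun _ => hg.nonneg _)).symm

theorem IsState.integral_map_fst (hg : IsState g) {E : Type*} [NormedAddCommGroup E]
    [NormedSpace ℝ E] (φ : Space → E) :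
    ∫ y, φ y ∂((massMeasure g).map Prod.fst) = ∫ y, density g y • φ y := by
  rw [hg.map_fst_massMeasure, integral_withDensity_eq_integral_toReal_smul
    hg.measurable_density.ennreal_ofReal
    (Filter.Eventually.of_forall fun _ => ENNReal.ofReal_lt_top)]
  simp [ENNReal.toReal_ofReal (hg.density_nonneg _)]

theorem fieldIntegrand_eq (g : Phase → ℝ) (x y : Space) :
    fieldIntegrand g x y = density g y • kernel (x - y) := by
  rw [fieldIntegrand, kernel, smul_smul, div_eq_mul_inv]

theorem IsState.integrable_fieldIntegrand (hg : IsState g) (x : Space) :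
    Integrable (fieldIntegrand g x) := by
  obtain ⟨D, hD⟩ := hg.exists_densityLe
  have h := hD.integrable_kernel x
  rw [hg.map_fst_massMeasure, integrable_withDensity_iff_integrable_smul'
    hg.measurable_density.ennreal_ofReal
    (Filter.Eventually.of_forall fun _ => ENNReal.ofReal_lt_top)] at h
  refine h.congr (Filter.Eventually.of_forall fun y => ?_)
  simp only
  rw [fieldIntegrand_eq, ENNReal.toReal_ofReal (hg.density_nonneg _)]

theorem IsState.field_eq_integral_kernel (hg : IsState g) (x : Space) :
    field g x = ∫ z, kernel (x - z.1) ∂massMeasure g := by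
  have h1 : ∫ z, kernel (x - z.1) ∂massMeasure g =
      ∫ y, kernel (x - y) ∂((massMeasure g).map Prod.fst) :=
    (integral_map measurable_fst.aemeasurable
      (measurable_kernel.comp (measurable_const.sub measurable_id)).aestronglyMeasurable).symm
  rw [h1, hg.integral_map_fst, field]
  simp_rw [fieldIntegrand_eq]

theorem SphericallySymmetric.density_eq (hs : SphericallySymmetric g) {x y : Space}
    (h : ‖x‖ = ‖y‖) : density g x = density g y := by
  obtain ⟨A, rfl⟩ := exists_rotate_eq h
  have h1 : density g (rotate A x) = ∫ v : Space, g (rotate A x, rotation A v) :=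
    ((rotation A).measurePreserving.integral_comp
      (rotation A).toHomeomorph.measurableEmbedding (fun v => g (rotate A x, v))).symm
  rw [h1]
  simp_rw [show ∀ v, rotation A v = rotate A v from fun _ => rfl, hs A]
  rfl

theorem IsState.field_eq_radialField (hg : IsState g) (hs : SphericallySymmetric g) (x : Space) :
    field g x = radialField ((massMeasure g).map Prod.fst) x := by
  let e : Space := EuclideanSpace.single 0 1
  have he : ‖e‖ = 1 := by simp [e]
  have hρ : ∀ y, density g y = (fun u : ℝ => density g (u • e)) ‖y‖ := fun y =>
    hs.density_eq (by rw [norm_smul, norm_norm, he, mul_one])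
  have h := shell_theorem (h := fun u : ℝ => density g (u • e))
    (hg.measurable_density.comp (by fun_prop)) hρ hg.integrable_density x
    (hg.integrable_fieldIntegrand x)
  rw [field]
  refine h.trans ?_
  rw [radialField]
  congr 2
  rw [measureReal_def, hg.map_fst_massMeasure,
    withDensity_apply _ Metric.isOpen_ball.measurableSet,
    integral_eq_lintegral_of_nonneg_ae
      (Filter.Eventually.of_forall fun _ => hg.density_nonneg _)
      hg.measurable_density.aestronglyMeasurable]

end

/-! ### Transport of a state along the flow -/

/-- The spatial mass distribution at time `s` when the state `f₀` is transported along the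
characteristics of the force `F`. -/
def cloud (m : Model) (T : ℝ) (F : ℝ → Space → Space) (f₀ : Phase → ℝ) (s : ℝ) : Measure Space :=
  (massMeasure f₀).map fun z => (forward m T F s z).1

/-- A bound for the spatial density of a state bounded by `C` with velocities bounded by `P`. -/
def densityBound (C P : ℝ) : ℝ := C * volume.real (Metric.closedBall (0 : Space) P)

theorem densityBound_eq (C : ℝ) {P : ℝ} (hP : 0 ≤ P) :
    densityBound C P = C * (unitBallVolume * P ^ 3) := by
  rw [densityBound, Measure.addHaar_real_closedBall_eq_addHaar_real_ball, volume_real_ball hP]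

theorem densityBound_nonneg {C P : ℝ} (hC : 0 ≤ C) : 0 ≤ densityBound C P := by
  unfold densityBound; positivity

section

variable {m : Model} {T L : ℝ} {F : ℝ → Space → Space} {f₀ : Phase → ℝ}

theorem HasFlow.isState_comp_backward (H : HasFlow m T L F) (hf : IsState f₀) {t : ℝ}
    (ht : t ∈ Icc 0 T) : IsState fun z => f₀ (backward m T F t z) where
  nonneg _ := hf.nonneg _
  measurable := hf.measurable.comp (H.continuous_backward ht).measurable
  bounded := let ⟨C, hC⟩ := hf.bounded; ⟨C, fun _ => hC _⟩
  hasCompactSupport := hf.hasCompactSupport.comp_homeomorph (H.homeomorph ht).symm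

theorem HasFlow.massMeasure_comp_backward (H : HasFlow m T L F) (hf : IsState f₀) {t : ℝ}
    (ht : t ∈ Icc 0 T) : massMeasure (fun z => f₀ (backward m T F t z)) =
      (massMeasure f₀).map (forward m T F t) := by
  have hmp := H.measurePreserving_forward ht
  refine Measure.ext fun S hS => ?_
  have hm : Measurable fun z => ENNReal.ofReal (f₀ (backward m T F t z)) :=
    (hf.measurable.comp (H.continuous_backward ht).measurable).ennreal_ofReal
  rw [Measure.map_apply hmp.measurable hS, massMeasure, massMeasure,
    withDensity_apply _ hS, withDensity_apply _ (hmp.measurable hS),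
    ← hmp.setLIntegral_comp_preimage hS hm]
  simp_rw [H.backward_forward ht]

theorem HasFlow.cloud_eq (H : HasFlow m T L F) (hf : IsState f₀) {t : ℝ} (ht : t ∈ Icc 0 T) :
    cloud m T F f₀ t =
      (massMeasure fun z => f₀ (backward m T F t z)).map Prod.fst := by
  rw [H.massMeasure_comp_backward hf ht,
    Measure.map_map measurable_fst (H.continuous_forward ht).measurable]
  rfl

theorem HasFlow.measurable_forward_fst (H : HasFlow m T L F) {t : ℝ} (ht : t ∈ Icc 0 T) :
    Measurable fun z => (forward m T F t z).1 :=
  (H.continuous_forward ht).fst.measurable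

theorem HasFlow.densityLe_cloud (H : HasFlow m T L F) (hf : IsState f₀) {C P : ℝ} (hC0 : 0 ≤ C)
    (hC : ∀ z, f₀ z ≤ C) {t : ℝ} (ht : t ∈ Icc 0 T)
    (hP : ∀ z, f₀ z ≠ 0 → ‖(forward m T F t z).2‖ ≤ P) :
    DensityLe (cloud m T F f₀ t) (densityBound C P) := by
  rw [H.cloud_eq hf ht]
  refine (H.isState_comp_backward hf ht).densityLe hC0 (fun _ => hC _) fun z hz => ?_
  have := hP _ hz
  rwa [H.forward_backward ht] at this

theorem HasFlow.hasDerivWithinAt_forward_snd (H : HasFlow m T L F) (z : Phase) {s : ℝ}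
    (hs : s ∈ Icc 0 T) : HasDerivWithinAt (fun s => (forward m T F s z).2)
      (-F s (forward m T F s z).1) (Icc 0 T) s :=
  (hasFDerivAt_snd (p := forward m T F s z)).comp_hasDerivWithinAt s
    (H.integralCurve_forward (HasFlow.zero_mem hs).2 z s hs)

theorem HasFlow.hasDerivWithinAt_forward_fst (H : HasFlow m T L F) (z : Phase) {s : ℝ}
    (hs : s ∈ Icc 0 T) : HasDerivWithinAt (fun s => (forward m T F s z).1)
      (m.velocity (forward m T F s z).2) (Icc 0 T) s :=
  (hasFDerivAt_fst (p := forward m T F s z)).comp_hasDerivWithinAt s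
    (H.integralCurve_forward (HasFlow.zero_mem hs).2 z s hs)

/-- A bounded force increases velocities at most linearly in time. -/
theorem HasFlow.norm_forward_snd_le (H : HasFlow m T L F) {B : ℝ}
    (hB : ∀ s ∈ Icc 0 T, ∀ x, ‖F s x‖ ≤ B) {t : ℝ} (ht : t ∈ Icc 0 T) (z : Phase) :
    ‖(forward m T F t z).2‖ ≤ ‖z.2‖ + B * T := by
  have h0 := HasFlow.zero_mem ht
  have hB0 : 0 ≤ B := (norm_nonneg _).trans (hB t ht 0)
  have h1 := (convex_Icc 0 T).norm_image_sub_le_of_norm_hasDerivWithin_le (C := B)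
    (fun s hs => H.hasDerivWithinAt_forward_snd z hs)
    (fun s hs => by rw [norm_neg]; exact hB s hs _) h0 ht
  rw [H.forward_zero h0.2, sub_zero, Real.norm_of_nonneg ht.1] at h1
  have h2 := norm_sub_norm_le (forward m T F t z).2 z.2
  have h3 : B * t ≤ B * T := mul_le_mul_of_nonneg_left ht.2 hB0
  linarith

/-- With velocities bounded by `P`, particles move at speed at most `P`. -/
theorem HasFlow.norm_forward_fst_sub_le (H : HasFlow m T L F) {P : ℝ} {z : Phase}
    (hP : ∀ s ∈ Icc 0 T, ‖(forward m T F s z).2‖ ≤ P) {s t : ℝ} (hs : s ∈ Icc 0 T)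
    (ht : t ∈ Icc 0 T) : ‖(forward m T F t z).1 - (forward m T F s z).1‖ ≤ P * |t - s| :=
  (convex_Icc 0 T).norm_image_sub_le_of_norm_hasDerivWithin_le
    (fun _ hs => H.hasDerivWithinAt_forward_fst z hs)
    (fun s hs => (norm_velocity_le m _).trans (hP s hs)) hs ht

/-- The radial field of the transported mass distribution is Lipschitz in time. -/
theorem HasFlow.norm_radialField_cloud_sub_le (H : HasFlow m T L F) (hf : IsState f₀) {C P : ℝ}
    (hC0 : 0 ≤ C) (hC : ∀ z, f₀ z ≤ C) (hP0 : 0 ≤ P)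
    (hP : ∀ s ∈ Icc 0 T, ∀ z, f₀ z ≠ 0 → ‖(forward m T F s z).2‖ ≤ P) {s t : ℝ}
    (hs : s ∈ Icc 0 T) (ht : t ∈ Icc 0 T) (x : Space) :
    ‖radialField (cloud m T F f₀ t) x - radialField (cloud m T F f₀ s) x‖ ≤
      7 * unitBallVolume * densityBound C P * (P * |t - s|) := by
  have := hf.isFiniteMeasure
  refine norm_radialField_map_sub_le (H.measurable_forward_fst ht) (H.measurable_forward_fst hs)
    (H.densityLe_cloud hf hC0 hC ht (hP t ht)) (H.densityLe_cloud hf hC0 hC hs (hP s hs))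
    (hf.ae_massMeasure fun z hz => ?_) (by positivity) x
  exact H.norm_forward_fst_sub_le (fun s hs => hP s hs z hz) hs ht

theorem HasFlow.continuousOn_radialField_cloud (H : HasFlow m T L F) (hf : IsState f₀) {P : ℝ}
    (hP0 : 0 ≤ P) (hP : ∀ s ∈ Icc 0 T, ∀ z, f₀ z ≠ 0 → ‖(forward m T F s z).2‖ ≤ P) :
    ContinuousOn (fun p : ℝ × Space => radialField (cloud m T F f₀ p.1) p.2)
      (Icc 0 T ×ˢ univ) := by
  obtain ⟨C, hC0, hC⟩ := hf.exists_bound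
  rintro ⟨t, x⟩ ⟨ht, -⟩
  rw [ContinuousWithinAt, tendsto_iff_dist_tendsto_zero]
  have h1 : Filter.Tendsto (fun p : ℝ × Space =>
      7 * unitBallVolume * densityBound C P * (P * |p.1 - t|) +
        4 * unitBallVolume * densityBound C P * ‖p.2 - x‖)
      (𝓝[Icc 0 T ×ˢ univ] (t, x)) (𝓝 0) := by
    have h : Continuous fun p : ℝ × Space =>
      7 * unitBallVolume * densityBound C P * (P * |p.1 - t|) +
        4 * unitBallVolume * densityBound C P * ‖p.2 - x‖ := by fun_prop
    simpa using (h.tendsto (t, x)).mono_left nhdsWithin_le_nhds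
  refine squeeze_zero' (Filter.Eventually.of_forall fun _ => dist_nonneg) ?_ h1
  filter_upwards [self_mem_nhdsWithin] with p hp
  rw [dist_eq_norm]
  have h2 := H.norm_radialField_cloud_sub_le hf hC0 hC hP0 hP ht hp.1 x
  have h3 := (H.densityLe_cloud hf hC0 hC hp.1 (hP p.1 hp.1)).norm_radialField_sub_le p.2 x
  have h4 := norm_sub_le_norm_sub_add_norm_sub (radialField (cloud m T F f₀ p.1) p.2)
    (radialField (cloud m T F f₀ p.1) x) (radialField (cloud m T F f₀ t) x)
  linarith

/-- The nonlinear stability estimate: weighted closeness of two forces is inherited by the fields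
that their flows generate, with a factor that is small for large `l`. -/
theorem HasFlow.norm_radialField_cloud_sub_le_of_force {L' : ℝ} {F' : ℝ → Space → Space}
    (H : HasFlow m T L F) (H' : HasFlow m T L' F') (hf : IsState f₀) {D A l : ℝ} {s : ℝ}
    (hs : s ∈ Icc 0 T) (hD : DensityLe (cloud m T F f₀ s) D)
    (hD' : DensityLe (cloud m T F' f₀ s) D) (hA : 0 ≤ A) (hl : charLip L < l)
    (hFF : ∀ s ∈ Icc 0 T, ∀ x, ‖F s x - F' s x‖ ≤ A * Real.exp (l * s)) (x : Space) :
    ‖radialField (cloud m T F f₀ s) x - radialField (cloud m T F' f₀ s) x‖ ≤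
      7 * unitBallVolume * D * (A / (l - charLip L) * Real.exp (l * s)) := by
  have := hf.isFiniteMeasure
  have h0 := (HasFlow.zero_mem hs).2
  have hd : 0 < l - charLip L := sub_pos.2 hl
  refine norm_radialField_map_sub_le (H.measurable_forward_fst hs) (H'.measurable_forward_fst hs)
    hD hD' (Filter.Eventually.of_forall fun z => ?_) (by positivity) x
  refine (norm_fst_le _).trans (dist_integralCurve_le_of_force H.toIsForce hA hl hFF
    (H.integralCurve_forward h0 z) (H'.integralCurve_forward h0 z) ?_ hs)
  rw [H.forward_zero h0, H'.forward_zero h0]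

end

/-! ### The problem with a cut-off force -/

/-- The force `F` is the cut-off at height `B` of the radial field that it generates by transporting
`f₀`. The cut-off makes this problem globally solvable; as long as the generated field
stays below `B`, it is the Vlasov–Poisson system. -/
structure IsCutoffSolution (m : Model) (f₀ : Phase → ℝ) (T B : ℝ) (F : ℝ → Space → Space) :
    Prop where
  hasFlow : ∃ L, HasFlow m T L F
  eq_cap : ∀ s ∈ Icc 0 T, ∀ x, F s x = cap B (radialField (cloud m T F f₀ s) x)

section

variable {m : Model} {T B : ℝ} {f₀ : Phase → ℝ}

theorem HasFlow.densityLe_cloud_of_bound {L : ℝ} {F : ℝ → Space → Space} (H : HasFlow m T L F)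
    (hf : IsState f₀) {C P : ℝ} (hC0 : 0 ≤ C) (hC : ∀ z, f₀ z ≤ C) (hP : VelocityLe f₀ P)
    (hB : ∀ s ∈ Icc 0 T, ∀ x, ‖F s x‖ ≤ B) {s : ℝ} (hs : s ∈ Icc 0 T) :
    DensityLe (cloud m T F f₀ s) (densityBound C (P + B * T)) :=
  H.densityLe_cloud hf hC0 hC hs fun z hz =>
    (H.norm_forward_snd_le hB hs z).trans (by linarith [hP z hz])

/-- A rate for which the nonlinear stability estimate contracts by a factor of two. -/
def contractionRate (L D : ℝ) : ℝ := charLip L + (28 * unitBallVolume * D + 1)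

theorem norm_cap_radialField_cloud_sub_le {L L' D : ℝ} {F F' : ℝ → Space → Space}
    (H : HasFlow m T L F) (H' : HasFlow m T L' F') (hf : IsState f₀) (hB0 : 0 < B)
    (hD : ∀ s ∈ Icc 0 T, DensityLe (cloud m T F f₀ s) D)
    (hD' : ∀ s ∈ Icc 0 T, DensityLe (cloud m T F' f₀ s) D) {A : ℝ} (hA : 0 ≤ A)
    (hFF : ∀ s ∈ Icc 0 T, ∀ x,
      ‖F s x - F' s x‖ ≤ A * Real.exp (contractionRate L D * s)) :
    ∀ s ∈ Icc 0 T, ∀ x, ‖cap B (radialField (cloud m T F f₀ s) x) -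
      cap B (radialField (cloud m T F' f₀ s) x)‖ ≤
        A / 2 * Real.exp (contractionRate L D * s) := by
  intro s hs x
  have hc : 0 ≤ unitBallVolume * D := mul_nonneg unitBallVolume_pos.le (hD s hs).nonneg
  refine (norm_cap_sub_le hB0 _ _).trans ?_
  have h := H.norm_radialField_cloud_sub_le_of_force H' hf hs (hD s hs) (hD' s hs) hA
    (l := contractionRate L D) (by unfold contractionRate; linarith) hFF x
  have e : contractionRate L D - charLip L = 28 * unitBallVolume * D + 1 := by
    unfold contractionRate; ring
  rw [e] at h
  have hE := Real.exp_pos (contractionRate L D * s)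
  have h1 : 2 * (7 * unitBallVolume * D * (A / (28 * unitBallVolume * D + 1))) ≤ A / 2 := by
    have hp : 0 < 28 * unitBallVolume * D + 1 := by linarith
    rw [← mul_div_assoc, ← mul_div_assoc, div_le_div_iff₀ hp two_pos]
    nlinarith
  calc _ ≤ 2 * (7 * unitBallVolume * D * (A / (28 * unitBallVolume * D + 1) *
        Real.exp (contractionRate L D * s))) := by linarith
    _ = 2 * (7 * unitBallVolume * D * (A / (28 * unitBallVolume * D + 1))) *
        Real.exp (contractionRate L D * s) := by ring
    _ ≤ _ := mul_le_mul_of_nonneg_right h1 hE.le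

theorem IsCutoffSolution.norm_le {F : ℝ → Space → Space} (h : IsCutoffSolution m f₀ T B F)
    (hB : 0 < B) : ∀ s ∈ Icc 0 T, ∀ x, ‖F s x‖ ≤ B := fun s hs x => by
  rw [h.eq_cap s hs]; exact norm_cap_le hB _

theorem IsCutoffSolution.eq {F F' : ℝ → Space → Space} (hf : IsState f₀) (hB : 0 < B)
    (h : IsCutoffSolution m f₀ T B F) (h' : IsCutoffSolution m f₀ T B F') :
    ∀ s ∈ Icc 0 T, ∀ x, F s x = F' s x := by
  obtain ⟨C, hC0, hC⟩ := hf.exists_bound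
  obtain ⟨P, -, hP⟩ := hf.exists_velocityLe
  obtain ⟨L, H⟩ := h.hasFlow
  obtain ⟨L', H'⟩ := h'.hasFlow
  set D := densityBound C (P + B * T)
  have hD := fun s (hs : s ∈ Icc 0 T) => H.densityLe_cloud_of_bound hf hC0 hC hP (h.norm_le hB) hs
  have hD' := fun s (hs : s ∈ Icc 0 T) =>
    H'.densityLe_cloud_of_bound hf hC0 hC hP (h'.norm_le hB) hs
  have key : ∀ n : ℕ, ∀ s ∈ Icc 0 T, ∀ x, ‖F s x - F' s x‖ ≤
      2 * B * (1 / 2) ^ n * Real.exp (contractionRate L D * s) := by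
    intro n
    induction n with
    | zero =>
      intro s hs x
      have hr : 0 ≤ contractionRate L D * s := by
        refine mul_nonneg ?_ hs.1
        have := (hD s hs).nonneg
        have := unitBallVolume_pos
        unfold contractionRate
        positivity
      have h1 := norm_sub_le (F s x) (F' s x)
      have h2 := h.norm_le hB s hs x
      have h3 := h'.norm_le hB s hs x
      have h4 := Real.one_le_exp hr
      nlinarith
    | succ n ih =>
      intro s hs x
      have h1 := norm_cap_radialField_cloud_sub_le H H' hf hB hD hD' (by positivity) ih s hs x
      rw [← h.eq_cap s hs, ← h'.eq_cap s hs] at h1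
      refine h1.trans_eq ?_
      rw [pow_succ]
      ring
  intro s hs x
  have hlim : Filter.Tendsto (fun n : ℕ => 2 * B * (1 / 2) ^ n *
      Real.exp (contractionRate L D * s)) Filter.atTop (𝓝 0) := by
    have := ((tendsto_pow_atTop_nhds_zero_of_lt_one (r := (1 / 2 : ℝ)) (by norm_num)
      (by norm_num)).const_mul (2 * B)).mul_const (Real.exp (contractionRate L D * s))
    simpa using this
  have h0 := ge_of_tendsto' hlim fun n => key n s hs x
  exact sub_eq_zero.1 (norm_le_zero_iff.1 h0)

/-- The Picard iteration for the problem with a cut-off force. -/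
def picardForce (m : Model) (f₀ : Phase → ℝ) (T B : ℝ) : ℕ → ℝ → Space → Space
  | 0 => fun _ _ => 0
  | n + 1 => fun s x => cap B (radialField (cloud m T (picardForce m f₀ T B n) f₀ s) x)

theorem IsForce.cap_radialField_cloud {L C P : ℝ} {F : ℝ → Space → Space} (H : HasFlow m T L F)
    (hf : IsState f₀) (hC0 : 0 ≤ C) (hC : ∀ z, f₀ z ≤ C) (hP : VelocityLe f₀ P) (hP0 : 0 ≤ P)
    (hB0 : 0 < B) (hT : 0 ≤ T) (hB : ∀ s ∈ Icc 0 T, ∀ x, ‖F s x‖ ≤ B) :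
    IsForce T (8 * unitBallVolume * densityBound C (P + B * T))
      fun s x => cap B (radialField (cloud m T F f₀ s) x) := by
  refine ⟨(continuous_cap hB0).comp_continuousOn (H.continuousOn_radialField_cloud hf
    (P := P + B * T) (by positivity) fun s hs z hz =>
      (H.norm_forward_snd_le hB hs z).trans (by linarith [hP z hz])), fun s hs x y => ?_⟩
  refine (norm_cap_sub_le hB0 _ _).trans ?_
  have := (H.densityLe_cloud_of_bound hf hC0 hC hP hB hs).norm_radialField_sub_le x y
  linarith

theorem exists_isCutoffSolution (m : Model) (hf : IsState f₀) (hB : 0 < B) (hT : 0 ≤ T) :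
    ∃ F, IsCutoffSolution m f₀ T B F := by
  obtain ⟨C, hC0, hC⟩ := hf.exists_bound
  obtain ⟨P, hP0, hP⟩ := hf.exists_velocityLe
  set D := densityBound C (P + B * T) with hDdef
  have hD0 : 0 ≤ D := densityBound_nonneg hC0
  set L := 8 * unitBallVolume * D with hL
  have hL0 : 0 ≤ L := by have := unitBallVolume_pos; positivity
  set Fn := picardForce m f₀ T B with hFn
  -- all iterates are bounded by `B` and have the same Lipschitz constant in space
  have hclass : ∀ n, IsForce T L (Fn n) ∧ ∀ s ∈ Icc 0 T, ∀ x, ‖Fn n s x‖ ≤ B := by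
    intro n
    induction n with
    | zero =>
      refine ⟨⟨continuousOn_const, fun s hs x y => ?_⟩, fun s hs x => ?_⟩
      · simp only [hFn, picardForce, sub_self, norm_zero]; positivity
      · simp only [hFn, picardForce, norm_zero]; exact hB.le
    | succ n ih =>
      exact ⟨IsForce.cap_radialField_cloud (ih.1.hasFlow ih.2) hf hC0 hC hP hP0.le hB hT ih.2,
        fun s hs x => norm_cap_le hB _⟩
  have H : ∀ n, HasFlow m T L (Fn n) := fun n => (hclass n).1.hasFlow (hclass n).2
  have hD : ∀ n, ∀ s ∈ Icc 0 T, DensityLe (cloud m T (Fn n) f₀ s) D := fun n s hs =>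
    (H n).densityLe_cloud_of_bound hf hC0 hC hP (hclass n).2 hs
  set l := contractionRate L D with hl
  have hl0 : 0 ≤ l := by
    have := unitBallVolume_pos
    rw [hl]; unfold contractionRate; positivity
  have hstep : ∀ n : ℕ, ∀ s ∈ Icc 0 T, ∀ x, ‖Fn n s x - Fn (n + 1) s x‖ ≤
      B * (1 / 2) ^ n * Real.exp (l * s) := by
    intro n
    induction n with
    | zero =>
      intro s hs x
      have h1 := (hclass 1).2 s hs x
      have h2 := Real.one_le_exp (mul_nonneg hl0 hs.1)
      have h3 : Fn 0 s x - Fn 1 s x = -Fn 1 s x := by simp [hFn, picardForce]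
      rw [h3, norm_neg, pow_zero]
      nlinarith
    | succ n ih =>
      intro s hs x
      have h1 := norm_cap_radialField_cloud_sub_le (H n) (H (n + 1)) hf hB (hD n) (hD (n + 1))
        (by positivity) ih s hs x
      refine h1.trans_eq ?_
      rw [pow_succ]
      ring
  have hex : ∀ s x, ∃ a, s ∈ Icc 0 T → Filter.Tendsto (fun n => Fn n s x) Filter.atTop (𝓝 a) := by
    intro s x
    by_cases hs : s ∈ Icc 0 T
    · have hc : CauchySeq fun n => Fn n s x := by
        refine cauchySeq_of_le_geometric (1 / 2) (B * Real.exp (l * s)) (by norm_num) fun n => ?_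
        rw [dist_eq_norm]
        refine (hstep n s hs x).trans_eq ?_
        ring
      obtain ⟨a, ha⟩ := cauchySeq_tendsto_of_complete hc
      exact ⟨a, fun _ => ha⟩
    · exact ⟨0, fun h => absurd h hs⟩
  choose F hF using hex
  have hdist : ∀ n : ℕ, ∀ s ∈ Icc 0 T, ∀ x, ‖Fn n s x - F s x‖ ≤
      2 * B * (1 / 2) ^ n * Real.exp (l * s) := by
    intro n s hs x
    rw [← dist_eq_norm]
    refine (dist_le_of_le_geometric_of_tendsto (1 / 2) (B * Real.exp (l * s)) (by norm_num)
      (fun n => ?_) (hF s x hs) n).trans_eq (by ring)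
    rw [dist_eq_norm]
    refine (hstep n s hs x).trans_eq ?_
    ring
  have hgeom : ∀ c : ℝ, Filter.Tendsto (fun n : ℕ => 2 * B * (1 / 2) ^ n * c) Filter.atTop
      (𝓝 0) := by
    intro c
    have := ((tendsto_pow_atTop_nhds_zero_of_lt_one (r := (1 / 2 : ℝ)) (by norm_num)
      (by norm_num)).const_mul (2 * B)).mul_const c
    simpa using this
  have hFB : ∀ s ∈ Icc 0 T, ∀ x, ‖F s x‖ ≤ B := fun s hs x =>
    le_of_tendsto' (hF s x hs).norm fun n => (hclass n).2 s hs x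
  have hFf : IsForce T L F := by
    refine ⟨?_, fun s hs x y => ?_⟩
    · have hu : TendstoUniformlyOn (fun n (p : ℝ × Space) => Fn n p.1 p.2) (fun p => F p.1 p.2)
          Filter.atTop (Icc 0 T ×ˢ univ) := by
        rw [Metric.tendstoUniformlyOn_iff]
        intro ε hε
        filter_upwards [(hgeom (Real.exp (l * T))).eventually (gt_mem_nhds hε)] with n hn p hp
        rw [dist_comm, dist_eq_norm]
        refine (hdist n p.1 hp.1 p.2).trans_lt (lt_of_le_of_lt ?_ hn)
        have : l * p.1 ≤ l * T := mul_le_mul_of_nonneg_left hp.1.2 hl0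
        gcongr
      exact hu.continuousOn (Filter.Frequently.of_forall fun n => (hclass n).1.continuousOn)
    · exact le_of_tendsto' ((hF s x hs).sub (hF s y hs)).norm
        fun n => (hclass n).1.lipschitz s hs x y
  have HF : HasFlow m T L F := hFf.hasFlow hFB
  have hDF : ∀ s ∈ Icc 0 T, DensityLe (cloud m T F f₀ s) D := fun s hs =>
    HF.densityLe_cloud_of_bound hf hC0 hC hP hFB hs
  refine ⟨F, ⟨L, HF⟩, fun s hs x => ?_⟩
  have h1 : Filter.Tendsto (fun n => Fn (n + 1) s x) Filter.atTop
      (𝓝 (cap B (radialField (cloud m T F f₀ s) x))) := by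
    rw [tendsto_iff_dist_tendsto_zero]
    refine squeeze_zero (fun _ => dist_nonneg) (fun n => ?_) (hgeom (1 / 2 * Real.exp (l * s)))
    rw [dist_eq_norm]
    refine (norm_cap_radialField_cloud_sub_le (H n) HF hf hB (hD n) hDF (by positivity)
      (hdist n) s hs x).trans_eq ?_
    ring
  exact tendsto_nhds_unique ((hF s x hs).comp (Filter.tendsto_add_atTop_nat 1)) h1

end

/-! ### Restriction to shorter time intervals -/

section

variable {m : Model} {T L : ℝ} {F : ℝ → Space → Space} {f₀ : Phase → ℝ}

theorem integralCurve_congr {F' : ℝ → Space → Space} {Z : ℝ → Phase}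
    (hZ : IsIntegralCurveOn Z (charField m F) (Icc 0 T))
    (h : ∀ s ∈ Icc 0 T, ∀ x, F s x = F' s x) :
    IsIntegralCurveOn Z (charField m F') (Icc 0 T) := fun s hs => by
  have h1 := hZ s hs
  rwa [charField, h s hs] at h1

namespace HasFlow

theorem mono (H : HasFlow m T L F) {T' : ℝ} (h : T' ≤ T) : HasFlow m T' L F :=
  ⟨H.toIsForce.mono h, fun t ht z => by
    obtain ⟨Z, hZ, hZt⟩ := H.through t ⟨ht.1, ht.2.trans h⟩ z
    exact ⟨Z, hZ.mono (Icc_subset_Icc_right h), hZt⟩⟩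

theorem congr (H : HasFlow m T L F) {F' : ℝ → Space → Space}
    (h : ∀ s ∈ Icc 0 T, ∀ x, F s x = F' s x) : HasFlow m T L F' :=
  ⟨H.toIsForce.congr fun s hs x => (h s hs x).symm, fun t ht z => by
    obtain ⟨Z, hZ, hZt⟩ := H.through t ht z
    exact ⟨Z, integralCurve_congr hZ h, hZt⟩⟩

theorem forward_congr (H : HasFlow m T L F) {F' : ℝ → Space → Space}
    (h : ∀ s ∈ Icc 0 T, ∀ x, F s x = F' s x) {t : ℝ} (ht : t ∈ Icc 0 T) (z : Phase) :
    forward m T F' t z = forward m T F t z := by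
  have h0 := (zero_mem ht).2
  have := (H.congr h).eq_forward (integralCurve_congr (H.integralCurve_forward h0 z) h) ht
  rw [H.forward_zero h0] at this
  exact this.symm

theorem backward_congr (H : HasFlow m T L F) {F' : ℝ → Space → Space}
    (h : ∀ s ∈ Icc 0 T, ∀ x, F s x = F' s x) {t : ℝ} (ht : t ∈ Icc 0 T) (z : Phase) :
    backward m T F' t z = backward m T F t z := by
  have h1 := H.evolution_spec ht z
  have := (H.congr h).backward_eq (integralCurve_congr h1.1 h) ht
  rw [h1.2] at this
  exact this

theorem forward_mono (H : HasFlow m T L F) {T' : ℝ} (h : T' ≤ T) {t : ℝ} (ht : t ∈ Icc 0 T')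
    (z : Phase) : forward m T' F t z = forward m T F t z := by
  have h0 := ((zero_mem ht).2).trans h
  have := (H.mono h).eq_forward ((H.integralCurve_forward h0 z).mono (Icc_subset_Icc_right h)) ht
  rw [H.forward_zero h0] at this
  exact this.symm

theorem backward_mono (H : HasFlow m T L F) {T' : ℝ} (h : T' ≤ T) {t : ℝ} (ht : t ∈ Icc 0 T')
    (z : Phase) : backward m T' F t z = backward m T F t z := by
  have h1 := H.evolution_spec (Icc_subset_Icc_right h ht) z
  have := (H.mono h).backward_eq (h1.1.mono (Icc_subset_Icc_right h)) ht
  rw [h1.2] at this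
  exact this

theorem backward_zero (H : HasFlow m T L F) (hT : 0 ≤ T) (z : Phase) :
    backward m T F 0 z = z := (H.evolution_spec ⟨le_rfl, hT⟩ z).2

end HasFlow

end

/-! ### Lagrangian solutions and their forces -/

theorem Icc_subset_timeInterval {T : EReal} {q : ℝ} (hq : (q : EReal) < T) :
    Icc 0 q ⊆ timeInterval T := fun _ ht =>
  ⟨ht.1, (EReal.coe_le_coe_iff.2 ht.2).trans_lt hq⟩

/-- Within `[0, T[`, the interval `[0, q]` is a neighbourhood of each of its points before `q`. -/
theorem Icc_mem_nhdsWithin_timeInterval {T : EReal} {q s : ℝ} (hsq : s < q) :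
    Icc 0 q ∈ 𝓝[timeInterval T] s := by
  filter_upwards [self_mem_nhdsWithin, mem_nhdsWithin_of_mem_nhds (Iio_mem_nhds hsq)] with u hu hu'
  exact ⟨hu.1, le_of_lt hu'⟩

theorem exists_real_btwn {T : EReal} {s : ℝ} (hs : s ∈ timeInterval T) :
    ∃ q : ℝ, 0 < q ∧ s < q ∧ (q : EReal) < T := by
  obtain ⟨q, h1, h2⟩ := EReal.lt_iff_exists_real_btwn.1 hs.2
  have h3 : s < q := EReal.coe_lt_coe_iff.1 h1
  exact ⟨q, hs.1.trans_lt h3, h3, h2⟩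

/-- Transport along the flow of a force `F` is a strong Lagrangian solution as soon as `F` is the
gravitational field of the transported state. It suffices to know the flow on every compact
subinterval of `[0, T[`. -/
theorem isStrongLagrangianSolution_of_transport {m : Model} {T : EReal} (hT : 0 < T)
    {F : ℝ → Space → Space} {f₀ : Phase → ℝ} {f : ℝ → Phase → ℝ} (hf : IsState f₀)
    (hflow : ∀ q : ℝ, 0 < q → (q : EReal) < T → ∃ L, HasFlow m q L F)
    (htrans : ∀ q : ℝ, 0 < q → (q : EReal) < T → ∀ t ∈ Icc 0 q, ∀ z,
      f t z = f₀ (backward m q F t z))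
    (hfield : ∀ t ∈ timeInterval T, ∀ x, field (f t) x = F t x) :
    IsStrongLagrangianSolution m T f := by
  have hstate : ∀ t ∈ timeInterval T, IsState (f t) := by
    intro t ht
    obtain ⟨q, hq0, hsq, hqT⟩ := exists_real_btwn ht
    obtain ⟨L, H⟩ := hflow q hq0 hqT
    have htq : t ∈ Icc 0 q := ⟨ht.1, hsq.le⟩
    rw [funext (htrans q hq0 hqT t htq)]
    exact H.isState_comp_backward hf htq
  -- the flow maps do not depend on the interval `[0, q]` on which they are computed
  have hb : ∀ q : ℝ, 0 < q → (q : EReal) < T → ∀ t ∈ Icc 0 q, ∀ z,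
      backward m t F t z = backward m q F t z := by
    intro q hq0 hqT t ht z
    obtain ⟨L, H⟩ := hflow q hq0 hqT
    exact H.backward_mono ht.2 ⟨ht.1, le_rfl⟩ z
  have hfw : ∀ q : ℝ, 0 < q → (q : EReal) < T → ∀ t ∈ Icc 0 q, ∀ z,
      forward m t F t z = forward m q F t z := by
    intro q hq0 hqT t ht z
    obtain ⟨L, H⟩ := hflow q hq0 hqT
    exact H.forward_mono ht.2 ⟨ht.1, le_rfl⟩ z
  have hchar : ∀ Z : ℝ → Phase, IsCharacteristic m T (fun s => field (f s)) Z →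
      ∀ q : ℝ, (q : EReal) < T → IsIntegralCurveOn Z (charField m F) (Icc 0 q) := by
    intro Z hZ q hqT s hs
    have h1 := hZ s (Icc_subset_timeInterval hqT hs)
    simp only [hfield s (Icc_subset_timeInterval hqT hs)] at h1
    exact h1.mono (Icc_subset_timeInterval hqT)
  refine ⟨hT, ?_, fun t ht x => (hstate t ht).integrable_slice x,
    fun t ht x => (hstate t ht).integrable_fieldIntegrand x, ?_, ?_, ?_⟩
  · have hβ : Continuous fun p : timeInterval T × Phase => backward m p.1 F p.1 p.2 := by
      refine continuous_iff_continuousAt.2 fun p => ?_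
      obtain ⟨q, hq0, hsq, hqT⟩ := exists_real_btwn p.1.2
      obtain ⟨L, H⟩ := hflow q hq0 hqT
      have hev : ∀ᶠ p' : timeInterval T × Phase in 𝓝 p, (p'.1 : ℝ) ∈ Icc 0 q := by
        have : Continuous fun p' : timeInterval T × Phase => (p'.1 : ℝ) := by fun_prop
        filter_upwards [this.continuousAt.eventually (Iio_mem_nhds hsq)] with p' hp'
        exact ⟨p'.1.2.1, le_of_lt hp'⟩
      have h1 := (H.continuousOn_backward_uncurry (p.1, p.2)
        ⟨⟨p.1.2.1, hsq.le⟩, mem_univ _⟩).tendsto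
      have h2 : Filter.Tendsto (fun p' : timeInterval T × Phase => ((p'.1 : ℝ), p'.2)) (𝓝 p)
          (𝓝[Icc 0 q ×ˢ univ] ((p.1 : ℝ), p.2)) := by
        refine tendsto_nhdsWithin_iff.2 ⟨?_, hev.mono fun p' hp' => ⟨hp', mem_univ _⟩⟩
        exact (show Continuous fun p' : timeInterval T × Phase => ((p'.1 : ℝ), p'.2) by
          fun_prop).tendsto p
      have h3 := h1.comp h2
      rw [ContinuousAt, hb q hq0 hqT _ ⟨p.1.2.1, hsq.le⟩]
      exact h3.congr' (hev.mono fun p' hp' => (hb q hq0 hqT _ hp' _).symm)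
    have h4 : (fun p : timeInterval T × Phase => f p.1 p.2) =
        fun p => f₀ (backward m p.1 F p.1 p.2) := by
      ext p
      obtain ⟨q, hq0, hsq, hqT⟩ := exists_real_btwn p.1.2
      have hp : (p.1 : ℝ) ∈ Icc 0 q := ⟨p.1.2.1, hsq.le⟩
      rw [htrans q hq0 hqT _ hp, hb q hq0 hqT _ hp]
    rw [h4]
    exact hf.measurable.comp hβ.measurable
  · rintro ⟨t, x⟩ ⟨ht, -⟩
    obtain ⟨q, hq0, hsq, hqT⟩ := exists_real_btwn ht
    obtain ⟨L, H⟩ := hflow q hq0 hqT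
    have h1 := H.continuousOn (t, x) ⟨⟨ht.1, hsq.le⟩, mem_univ _⟩
    have h2 : ContinuousWithinAt (fun p : ℝ × Space => F p.1 p.2) (timeInterval T ×ˢ univ)
        (t, x) := by
      refine h1.mono_of_mem_nhdsWithin ?_
      rw [nhdsWithin_prod_eq]
      exact Filter.prod_mem_prod (Icc_mem_nhdsWithin_timeInterval hsq) self_mem_nhdsWithin
    exact h2.congr (fun p hp => hfield _ hp.1 _) (hfield _ ht _)
  · intro q hq0 hqT
    obtain ⟨L, H⟩ := hflow q hq0 hqT
    refine ⟨max L 1, by positivity, fun t ht x x' => ?_⟩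
    have ht' := Icc_subset_timeInterval hqT ht
    rw [hfield t ht', hfield t ht']
    exact (H.lipschitz t ht x x').trans
      (mul_le_mul_of_nonneg_right (le_max_left _ _) (norm_nonneg _))
  · intro t ht z
    set a := backward m t F t z with ha
    refine ⟨fun s => forward m s F s a, ?_, ?_, ?_, ?_⟩
    · intro s hs
      obtain ⟨q, hq0, hsq, hqT⟩ := exists_real_btwn hs
      obtain ⟨L, H⟩ := hflow q hq0 hqT
      have hs' : s ∈ Icc 0 q := ⟨hs.1, hsq.le⟩
      have h1 := (H.integralCurve_forward hq0.le a s hs').mono_of_mem_nhdsWithin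
        (Icc_mem_nhdsWithin_timeInterval (T := T) hsq)
      have h2 := h1.congr_of_eventuallyEq (f₁ := fun s => forward m s F s a) (by
        filter_upwards [Icc_mem_nhdsWithin_timeInterval (T := T) hsq] with u hu
        exact hfw q hq0 hqT u hu a) (hfw q hq0 hqT s hs' a)
      refine h2.congr_deriv ?_
      change _ = (m.velocity (forward m s F s a).2, -field (f s) (forward m s F s a).1)
      rw [hfield s hs, hfw q hq0 hqT s hs' a]
      rfl
    · obtain ⟨q, hq0, hsq, hqT⟩ := exists_real_btwn ht
      obtain ⟨L, H⟩ := hflow q hq0 hqT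
      exact (H.mono hsq.le).forward_backward ⟨ht.1, le_rfl⟩ z
    · intro Z' hZ' hZt s hs
      obtain ⟨q, hq0, htq, hqT⟩ := exists_real_btwn ht
      obtain ⟨q', hq0', hsq', hqT'⟩ := exists_real_btwn hs
      have hQ : ((max q q' : ℝ) : EReal) < T := by
        rcases max_choice q q' with h | h <;> rw [h] <;> assumption
      have hQ0 : 0 < max q q' := hq0.trans_le (le_max_left _ _)
      obtain ⟨L, H⟩ := hflow _ hQ0 hQ
      have htQ : t ∈ Icc 0 (max q q') := ⟨ht.1, htq.le.trans (le_max_left _ _)⟩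
      have hsQ : s ∈ Icc 0 (max q q') := ⟨hs.1, hsq'.le.trans (le_max_right _ _)⟩
      have hZc := hchar Z' hZ' _ hQ
      simp only
      rw [hfw _ hQ0 hQ s hsQ, ha, hb _ hQ0 hQ t htQ, H.eq_forward hZc hsQ, ← hZt,
        H.backward_eq hZc htQ]
    · intro s hs
      obtain ⟨q, hq0, htq, hqT⟩ := exists_real_btwn ht
      obtain ⟨q', hq0', hsq', hqT'⟩ := exists_real_btwn hs
      obtain ⟨L', H'⟩ := hflow _ hq0' hqT'
      have hs' : s ∈ Icc 0 q' := ⟨hs.1, hsq'.le⟩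
      have ht' : t ∈ Icc 0 q := ⟨ht.1, htq.le⟩
      simp only
      rw [htrans q' hq0' hqT' s hs', htrans q hq0 hqT t ht', hfw q' hq0' hqT' s hs',
        H'.backward_forward hs', ha, hb q hq0 hqT t ht']

section

variable {m : Model} {f₀ : Phase → ℝ} {T : EReal} {f : ℝ → Phase → ℝ}

theorem IsSymmetricSolution.exists_hasFlow (h : IsSymmetricSolution m f₀ T f) {q : ℝ}
    (hq0 : 0 < q) (hq : (q : EReal) < T) : ∃ L, HasFlow m q L fun s => field (f s) := by
  obtain ⟨L, -, hL⟩ := h.solution.field_lipschitz q hq0 hq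
  refine ⟨L, ⟨h.solution.field_continuous.mono
    (prod_mono (Icc_subset_timeInterval hq) subset_rfl), hL⟩, fun t ht z => ?_⟩
  obtain ⟨Z, hZ, hZt, -⟩ := h.solution.constant_along t (Icc_subset_timeInterval hq ht) z
  exact ⟨Z, fun s hs => (hZ s (Icc_subset_timeInterval hq hs)).mono
    (Icc_subset_timeInterval hq), hZt⟩

theorem IsSymmetricSolution.eq_transport (h : IsSymmetricSolution m f₀ T f) {q : ℝ}
    (hq0 : 0 < q) (hq : (q : EReal) < T) {t : ℝ} (ht : t ∈ Icc 0 q) (z : Phase) :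
    f t z = f₀ (backward m q (fun s => field (f s)) t z) := by
  obtain ⟨L, H⟩ := h.exists_hasFlow hq0 hq
  obtain ⟨Z, hZ, hZt, -, hconst⟩ :=
    h.solution.constant_along t (Icc_subset_timeInterval hq ht) z
  have h1 := H.backward_eq (fun s hs => (hZ s (Icc_subset_timeInterval hq hs)).mono
    (Icc_subset_timeInterval hq)) ht
  rw [hZt] at h1
  rw [h1, ← h.initial]
  exact (hconst 0 (Icc_subset_timeInterval hq ⟨le_rfl, hq0.le⟩)).symm

theorem IsSymmetricSolution.isState (h : IsSymmetricSolution m f₀ T f) (hf : IsState f₀) {t : ℝ}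
    (ht : t ∈ timeInterval T) : IsState (f t) := by
  obtain ⟨q, hq0, htq, hqT⟩ := exists_real_btwn ht
  obtain ⟨L, H⟩ := h.exists_hasFlow hq0 hqT
  have ht' : t ∈ Icc 0 q := ⟨ht.1, htq.le⟩
  rw [funext (h.eq_transport hq0 hqT ht')]
  exact H.isState_comp_backward hf ht'

theorem IsSymmetricSolution.field_eq (h : IsSymmetricSolution m f₀ T f) (hf : IsState f₀) {q : ℝ}
    (hq0 : 0 < q) (hq : (q : EReal) < T) {t : ℝ} (ht : t ∈ Icc 0 q) (x : Space) :
    field (f t) x = radialField (cloud m q (fun s => field (f s)) f₀ t) x := by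
  obtain ⟨L, H⟩ := h.exists_hasFlow hq0 hq
  have ht' := Icc_subset_timeInterval hq ht
  rw [(h.isState hf ht').field_eq_radialField (h.symmetric t ht'), H.cloud_eq hf ht,
    ← funext (h.eq_transport hq0 hq ht)]

/-- Velocities in the support of a transported state stay bounded on compact time intervals. -/
theorem HasFlow.exists_velocity_bound {q L : ℝ} {F : ℝ → Space → Space} (H : HasFlow m q L F)
    (hf : IsState f₀) : ∃ P, 0 < P ∧
      ∀ s ∈ Icc 0 q, ∀ z, f₀ z ≠ 0 → ‖(forward m q F s z).2‖ ≤ P := by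
  have hK : IsCompact (Icc 0 q ×ˢ tsupport f₀) := isCompact_Icc.prod hf.hasCompactSupport
  obtain ⟨P, hP⟩ := hK.exists_bound_of_continuousOn
    (H.continuousOn_forward_uncurry.mono (prod_mono subset_rfl (subset_univ _))).snd
  exact ⟨max P 1, by positivity, fun s hs z hz =>
    (hP (s, z) ⟨hs, subset_tsupport f₀ hz⟩).trans (le_max_left _ _)⟩

/-- A bound for the radial field of a cloud in terms of a bound for the velocities. -/
def fieldBound (f₀ : Phase → ℝ) (C P : ℝ) : ℝ :=
  (massMeasure f₀).real univ + unitBallVolume * densityBound C P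

theorem HasFlow.norm_radialField_cloud_le {q L : ℝ} {F : ℝ → Space → Space} (H : HasFlow m q L F)
    (hf : IsState f₀) {C P : ℝ} (hC0 : 0 ≤ C) (hC : ∀ z, f₀ z ≤ C) {t : ℝ} (ht : t ∈ Icc 0 q)
    (hP : ∀ z, f₀ z ≠ 0 → ‖(forward m q F t z).2‖ ≤ P) {R : ℝ} (hR : 0 < R) (x : Space) :
    ‖radialField (cloud m q F f₀ t) x‖ ≤
      (massMeasure f₀).real univ / R ^ 2 + unitBallVolume * densityBound C P * R := by
  have h := (H.densityLe_cloud hf hC0 hC ht hP).norm_radialField_le hR x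
  rwa [cloud, map_measureReal_apply (H.measurable_forward_fst ht) MeasurableSet.univ,
    preimage_univ] at h

theorem HasFlow.norm_radialField_cloud_le_fieldBound {q L : ℝ} {F : ℝ → Space → Space}
    (H : HasFlow m q L F) (hf : IsState f₀) {C P : ℝ} (hC0 : 0 ≤ C) (hC : ∀ z, f₀ z ≤ C) {t : ℝ}
    (ht : t ∈ Icc 0 q) (hP : ∀ z, f₀ z ≠ 0 → ‖(forward m q F t z).2‖ ≤ P) (x : Space) :
    ‖radialField (cloud m q F f₀ t) x‖ ≤ fieldBound f₀ C P := by
  simpa [fieldBound] using H.norm_radialField_cloud_le hf hC0 hC ht hP one_pos x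

theorem IsSymmetricSolution.isCutoffSolution (h : IsSymmetricSolution m f₀ T f)
    (hf : IsState f₀) {q : ℝ} (hq0 : 0 < q) (hq : (q : EReal) < T) {B : ℝ} (hB0 : 0 < B)
    (hB : ∀ t ∈ Icc 0 q, ∀ x, ‖field (f t) x‖ ≤ B) :
    IsCutoffSolution m f₀ q B fun s => field (f s) := by
  refine ⟨h.exists_hasFlow hq0 hq, fun s hs x => ?_⟩
  have h1 := hB s hs x
  rw [h.field_eq hf hq0 hq hs] at h1 ⊢
  rw [cap_of_le hB0 h1]

theorem IsSymmetricSolution.exists_field_bound (h : IsSymmetricSolution m f₀ T f)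
    (hf : IsState f₀) {q : ℝ} (hq0 : 0 < q) (hq : (q : EReal) < T) :
    ∃ B, ∀ t ∈ Icc 0 q, ∀ x, ‖field (f t) x‖ ≤ B := by
  obtain ⟨L, H⟩ := h.exists_hasFlow hq0 hq
  obtain ⟨C, hC0, hC⟩ := hf.exists_bound
  obtain ⟨P, -, hP⟩ := H.exists_velocity_bound hf
  refine ⟨fieldBound f₀ C P, fun t ht x => ?_⟩
  rw [h.field_eq hf hq0 hq ht]
  exact H.norm_radialField_cloud_le_fieldBound hf hC0 hC ht (hP t ht) x

/-- Uniqueness of spherically symmetric solutions. -/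
theorem IsSymmetricSolution.eq (hf : IsState f₀) {T' : EReal} {g : ℝ → Phase → ℝ}
    (h : IsSymmetricSolution m f₀ T f) (h' : IsSymmetricSolution m f₀ T' g) {t : ℝ}
    (ht : t ∈ timeInterval T) (ht' : t ∈ timeInterval T') : f t = g t := by
  rcases ht.1.eq_or_lt with h0 | h0
  · rw [← h0, h.initial, h'.initial]
  obtain ⟨B, hB⟩ := h.exists_field_bound hf h0 ht.2
  obtain ⟨B', hB'⟩ := h'.exists_field_bound hf h0 ht'.2
  have hM : 0 < max (max B B') 1 := by positivity
  have hc := h.isCutoffSolution hf h0 ht.2 hM fun s hs x =>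
    (hB s hs x).trans ((le_max_left _ _).trans (le_max_left _ _))
  have hc' := h'.isCutoffSolution hf h0 ht'.2 hM fun s hs x =>
    (hB' s hs x).trans ((le_max_right _ _).trans (le_max_left _ _))
  obtain ⟨L, H⟩ := h.exists_hasFlow h0 ht.2
  have htt : t ∈ Icc 0 t := ⟨h0.le, le_rfl⟩
  ext z
  rw [h.eq_transport h0 ht.2 htt, h'.eq_transport h0 ht'.2 htt,
    H.backward_congr (hc.eq hf hM hc') htt]

end

/-! ### From the cut-off problem to solutions -/

theorem radialField_rotate (μ : Measure Space) (A : Matrix.specialOrthogonalGroup (Fin 3) ℝ)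
    (x : Space) : radialField μ (rotate A x) = rotate A (radialField μ x) := by
  simp only [radialField, norm_rotate]
  exact ((rotation A).map_smul _ _).symm

theorem cap_rotate (B : ℝ) (A : Matrix.specialOrthogonalGroup (Fin 3) ℝ) (x : Space) :
    cap B (rotate A x) = rotate A (cap B x) := by
  simp only [cap, norm_rotate]
  exact ((rotation A).map_smul _ _).symm

theorem velocity_rotate (m : Model) (A : Matrix.specialOrthogonalGroup (Fin 3) ℝ) (v : Space) :
    m.velocity (rotate A v) = rotate A (m.velocity v) := by
  cases m with
  | nonrelativistic => rfl
  | relativistic =>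
    simp only [Model.velocity, norm_rotate]
    exact ((rotation A).map_smul _ _).symm

section

variable {m : Model} {f₀ : Phase → ℝ} {T B : ℝ} {F : ℝ → Space → Space}

theorem HasFlow.backward_rotate {L : ℝ} (H : HasFlow m T L F)
    (hrot : ∀ s ∈ Icc 0 T, ∀ A x, F s (rotate A x) = rotate A (F s x)) {t : ℝ}
    (ht : t ∈ Icc 0 T) (A : Matrix.specialOrthogonalGroup (Fin 3) ℝ) (x v : Space) :
    backward m T F t (rotate A x, rotate A v) =
      (rotate A (backward m T F t (x, v)).1, rotate A (backward m T F t (x, v)).2) := by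
  have h := H.evolution_spec ht (x, v)
  set Z := evolution m T F t (x, v) with hZ
  let R := (rotation A).toContinuousLinearEquiv.toContinuousLinearMap
  have hc : IsIntegralCurveOn (fun s => ((rotate A (Z s).1, rotate A (Z s).2) : Phase))
      (charField m F) (Icc 0 T) := by
    intro s hs
    have h1 := (hasFDerivAt_fst (p := Z s)).comp_hasDerivWithinAt s (h.1 s hs)
    have h2 := (hasFDerivAt_snd (p := Z s)).comp_hasDerivWithinAt s (h.1 s hs)
    have h3 := R.hasFDerivAt.comp_hasDerivWithinAt s h1
    have h4 := R.hasFDerivAt.comp_hasDerivWithinAt s h2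
    have h5 := h3.prodMk h4
    rw [charField, velocity_rotate, hrot s hs]
    refine h5.congr_deriv ?_
    ext1
    · rfl
    · exact map_neg (rotation A) _
  have h6 := H.backward_eq hc ht
  simp only [h.2] at h6
  exact h6

/-- As long as the generated field stays below the cut-off, the cut-off problem yields a spherically
symmetric solution. -/
theorem IsCutoffSolution.isSymmetricSolution (h : IsCutoffSolution m f₀ T B F) (hB0 : 0 < B)
    (hf : IsState f₀) (hs : SphericallySymmetric f₀) {τ : ℝ} (hτ0 : 0 < τ) (hτ : τ ≤ T)
    (hB : ∀ s ∈ Ico 0 τ, ∀ x, ‖radialField (cloud m T F f₀ s) x‖ ≤ B) :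
    IsSymmetricSolution m f₀ τ fun t z => f₀ (backward m T F t z) := by
  obtain ⟨L, H⟩ := h.hasFlow
  have hmem : ∀ {t : ℝ}, t ∈ timeInterval τ → t ∈ Ico 0 τ := fun ht =>
    ⟨ht.1, EReal.coe_lt_coe_iff.1 ht.2⟩
  have hmem' : ∀ {t : ℝ}, t ∈ timeInterval τ → t ∈ Icc 0 T := fun ht =>
    ⟨ht.1, (hmem ht).2.le.trans hτ⟩
  have hsymm : ∀ t ∈ Icc 0 T, SphericallySymmetric fun z => f₀ (backward m T F t z) := by
    intro t ht A x v
    simp only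
    rw [H.backward_rotate (fun s hs A x => ?_) ht, hs]
    rw [h.eq_cap s hs, h.eq_cap s hs, radialField_rotate, cap_rotate]
  refine ⟨isStrongLagrangianSolution_of_transport (F := F) (by exact_mod_cast hτ0) hf
    (fun q hq0 hqτ => ⟨L, H.mono ((EReal.coe_lt_coe_iff.1 hqτ).le.trans hτ)⟩)
    (fun q hq0 hqτ t ht z => ?_) fun t ht x => ?_, fun t ht => hsymm t (hmem' ht), ?_⟩
  · rw [H.backward_mono ((EReal.coe_lt_coe_iff.1 hqτ).le.trans hτ) ht]
  · have ht' := hmem' ht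
    rw [(H.isState_comp_backward hf ht').field_eq_radialField (hsymm t ht'),
      ← H.cloud_eq hf ht', h.eq_cap t ht', cap_of_le hB0 (hB t (hmem ht) x)]
  · ext z
    rw [H.backward_zero (hτ0.le.trans hτ)]

/-- If the field of a solution of the cut-off problem stays below `B - 1` up to some time, it stays
below `B` for a further time that does not depend on that time. -/
theorem IsCutoffSolution.exists_extension (h : IsCutoffSolution m f₀ T B F) (hB0 : 0 < B)
    (hf : IsState f₀) (hs : SphericallySymmetric f₀) : ∃ ε > 0, ∀ t₁ ∈ Ico 0 T,
      (∀ s ∈ Icc 0 t₁, ∀ x, ‖radialField (cloud m T F f₀ s) x‖ ≤ B - 1) →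
      IsSymmetricSolution m f₀ (min (t₁ + ε) T : ℝ) fun t z => f₀ (backward m T F t z) := by
  obtain ⟨L, H⟩ := h.hasFlow
  obtain ⟨C, hC0, hC⟩ := hf.exists_bound
  obtain ⟨P, hP0, hP⟩ := H.exists_velocity_bound hf
  set M := 7 * unitBallVolume * densityBound C P * P with hM
  have hM0 : 0 ≤ M := by
    have := unitBallVolume_pos
    have := densityBound_nonneg (P := P) hC0
    positivity
  refine ⟨1 / (M + 1), by positivity, fun t₁ ht₁ hb => ?_⟩
  have hε : 0 < 1 / (M + 1) := by positivity
  refine h.isSymmetricSolution hB0 hf hs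
    (lt_min (by linarith [ht₁.1]) (ht₁.1.trans_lt ht₁.2)) (min_le_right _ _) fun s hs x => ?_
  rcases le_total s t₁ with hst | hst
  · linarith [hb s ⟨hs.1, hst⟩ x]
  · have hsT : s ∈ Icc 0 T := ⟨hs.1, hs.2.le.trans (min_le_right _ _)⟩
    have h1 := H.norm_radialField_cloud_sub_le hf hC0 hC hP0.le hP ⟨ht₁.1, ht₁.2.le⟩ hsT x
    have h2 := hb t₁ ⟨ht₁.1, le_rfl⟩ x
    have h3 := norm_le_norm_add_norm_sub' (radialField (cloud m T F f₀ s) x)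
      (radialField (cloud m T F f₀ t₁) x)
    have h4 : s - t₁ ≤ 1 / (M + 1) := by linarith [hs.2.trans_le (min_le_left _ _)]
    have h5 : M * (s - t₁) ≤ 1 := by
      calc M * (s - t₁) ≤ M * (1 / (M + 1)) := mul_le_mul_of_nonneg_left h4 hM0
        _ ≤ 1 := by rw [mul_one_div, div_le_one (by positivity)]; linarith
    rw [abs_of_nonneg (sub_nonneg.2 hst)] at h1
    have h6 : 7 * unitBallVolume * densityBound C P * (P * (s - t₁)) = M * (s - t₁) := by
      rw [hM]; ring
    linarith

end

/-! ### The maximal solution -/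

section

variable {m : Model} {f₀ : Phase → ℝ}

/-- The supremum of all times up to which a spherically symmetric solution exists. -/
def lifespan (m : Model) (f₀ : Phase → ℝ) : EReal :=
  sSup {T : EReal | ∃ g, IsSymmetricSolution m f₀ T g}

open Classical in
/-- The union of all spherically symmetric solutions; zero at times that no solution reaches. -/
def maximalSolution (m : Model) (f₀ : Phase → ℝ) (t : ℝ) : Phase → ℝ :=
  if h : ∃ T : EReal, ∃ g, IsSymmetricSolution m f₀ T g ∧ t ∈ timeInterval T then
    h.choose_spec.choose t else 0

theorem maximalSolution_eq (hf : IsState f₀) {T : EReal} {g : ℝ → Phase → ℝ}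
    (h : IsSymmetricSolution m f₀ T g) {t : ℝ} (ht : t ∈ timeInterval T) :
    maximalSolution m f₀ t = g t := by
  have hex : ∃ T : EReal, ∃ g, IsSymmetricSolution m f₀ T g ∧ t ∈ timeInterval T :=
    ⟨T, g, h, ht⟩
  rw [maximalSolution, dif_pos hex]
  exact IsSymmetricSolution.eq hf hex.choose_spec.choose_spec.1 h
    hex.choose_spec.choose_spec.2 ht

theorem IsSymmetricSolution.le_lifespan {T : EReal} {g : ℝ → Phase → ℝ}
    (h : IsSymmetricSolution m f₀ T g) : T ≤ lifespan m f₀ := le_sSup ⟨g, h⟩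

theorem exists_of_lt_lifespan {q : EReal} (hq : q < lifespan m f₀) :
    ∃ T : EReal, ∃ g, IsSymmetricSolution m f₀ T g ∧ q < T := by
  obtain ⟨T, ⟨g, hg⟩, hqT⟩ := lt_sSup_iff.1 hq
  exact ⟨T, g, hg, hqT⟩

/-- Solutions agree where they overlap, so they can be glued to a solution on `[0, lifespan[`. -/
theorem isSymmetricSolution_maximalSolution (hf : IsState f₀) {T : EReal} {g : ℝ → Phase → ℝ}
    (h : IsSymmetricSolution m f₀ T g) :
    IsSymmetricSolution m f₀ (lifespan m f₀) (maximalSolution m f₀) := by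
  have h0 : (0 : ℝ) ∈ timeInterval T := ⟨le_rfl, h.solution.pos⟩
  have key : ∀ {T : EReal} {g : ℝ → Phase → ℝ} (_ : IsSymmetricSolution m f₀ T g) {q : ℝ},
      0 < q → (q : EReal) < T → ∀ s ∈ Icc 0 q, ∀ x,
        field (g s) x = field (maximalSolution m f₀ s) x := by
    intro T g h q _ hqT s hs x
    rw [maximalSolution_eq hf h (Icc_subset_timeInterval hqT hs)]
  refine ⟨isStrongLagrangianSolution_of_transport
    (F := fun s => field (maximalSolution m f₀ s)) (h.solution.pos.trans_le h.le_lifespan) hf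
    (fun q hq0 hq => ?_) (fun q hq0 hq t ht z => ?_) fun t _ x => rfl, fun t ht => ?_, ?_⟩
  · obtain ⟨T, g, h, hqT⟩ := exists_of_lt_lifespan hq
    obtain ⟨L, H⟩ := h.exists_hasFlow hq0 hqT
    exact ⟨L, H.congr (key h hq0 hqT)⟩
  · obtain ⟨T, g, h, hqT⟩ := exists_of_lt_lifespan hq
    obtain ⟨L, H⟩ := h.exists_hasFlow hq0 hqT
    rw [H.backward_congr (key h hq0 hqT) ht, ← h.eq_transport hq0 hqT ht,
      maximalSolution_eq hf h (Icc_subset_timeInterval hqT ht)]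
  · obtain ⟨T, g, h, hqT⟩ := exists_of_lt_lifespan ht.2
    rw [maximalSolution_eq hf h ⟨ht.1, hqT⟩]
    exact h.symmetric t ⟨ht.1, hqT⟩
  · rw [maximalSolution_eq hf h h0, h.initial]

/-! ### Local existence and continuation -/

theorem HasFlow.cloud_mono {T T' L : ℝ} {F : ℝ → Space → Space} (H : HasFlow m T L F)
    (h : T' ≤ T) {t : ℝ} (ht : t ∈ Icc 0 T') : cloud m T' F f₀ t = cloud m T F f₀ t := by
  simp only [cloud, H.forward_mono h ht]

theorem HasFlow.cloud_congr {T L : ℝ} {F F' : ℝ → Space → Space} (H : HasFlow m T L F)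
    (h : ∀ s ∈ Icc 0 T, ∀ x, F s x = F' s x) {t : ℝ} (ht : t ∈ Icc 0 T) :
    cloud m T F' f₀ t = cloud m T F f₀ t := by
  simp only [cloud, H.forward_congr h ht]

theorem IsCutoffSolution.mono {T T' B : ℝ} {F : ℝ → Space → Space}
    (h : IsCutoffSolution m f₀ T B F) (hT : T' ≤ T) : IsCutoffSolution m f₀ T' B F := by
  obtain ⟨L, H⟩ := h.hasFlow
  refine ⟨⟨L, H.mono hT⟩, fun s hs x => ?_⟩
  rw [H.cloud_mono hT hs, h.eq_cap s (Icc_subset_Icc_right hT hs)]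

theorem fieldBound_nonneg (f₀ : Phase → ℝ) {C : ℝ} (hC : 0 ≤ C) (P : ℝ) :
    0 ≤ fieldBound f₀ C P := by
  have := unitBallVolume_pos
  have := densityBound_nonneg (P := P) hC
  unfold fieldBound
  positivity

/-- Local existence. -/
theorem exists_isSymmetricSolution (m : Model) (hf : IsState f₀)
    (hs : SphericallySymmetric f₀) : ∃ (T : EReal) (g : _), IsSymmetricSolution m f₀ T g := by
  obtain ⟨C, hC0, hC⟩ := hf.exists_bound
  obtain ⟨P, -, hP⟩ := hf.exists_velocityLe
  have hB0 : 0 < fieldBound f₀ C P + 1 := by linarith [fieldBound_nonneg f₀ hC0 P]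
  obtain ⟨F, hF⟩ := exists_isCutoffSolution m hf hB0 zero_le_one
  obtain ⟨L, H⟩ := hF.hasFlow
  obtain ⟨ε, -, hε⟩ := hF.exists_extension hB0 hf hs
  refine ⟨_, _, hε 0 ⟨le_rfl, one_pos⟩ fun s hs x => ?_⟩
  obtain rfl : s = 0 := le_antisymm hs.2 hs.1
  rw [add_sub_cancel_right]
  refine H.norm_radialField_cloud_le_fieldBound hf hC0 hC ⟨le_rfl, zero_le_one⟩ (fun z hz => ?_) x
  rw [H.forward_zero zero_le_one]
  exact hP z hz

/-- A solution whose velocities stay bounded can be continued: it solves a cut-off problem, whose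
solution exists for all times, with a cut-off that is not yet active at time `T`. -/
theorem IsSymmetricSolution.exists_continuation {T : ℝ} {f : ℝ → Phase → ℝ}
    (h : IsSymmetricSolution m f₀ T f) (hf : IsState f₀) (hs : SphericallySymmetric f₀) {P : ℝ}
    (hP : ∀ q : ℝ, 0 < q → q < T → ∀ t ∈ Icc 0 q, ∀ z, f₀ z ≠ 0 →
      ‖(forward m q (fun s => field (f s)) t z).2‖ ≤ P) :
    ∃ (T' : EReal) (g : _), IsSymmetricSolution m f₀ T' g ∧ (T : EReal) < T' := by
  have hT0 : 0 < T := by exact_mod_cast h.solution.pos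
  obtain ⟨C, hC0, hC⟩ := hf.exists_bound
  -- a cut-off one unit above the bound for the field leaves room to go on
  have hB0 : 0 < fieldBound f₀ C P + 1 := by linarith [fieldBound_nonneg f₀ hC0 P]
  obtain ⟨F, hF⟩ := exists_isCutoffSolution m hf hB0 (T := T + 1) (by linarith)
  obtain ⟨LF, HF⟩ := hF.hasFlow
  obtain ⟨ε, hε0, hε⟩ := hF.exists_extension hB0 hf hs
  set t₁ := max 0 (T - ε / 2) with ht₁
  have h1 : 0 ≤ t₁ := le_max_left _ _
  have h2 : t₁ < T := max_lt hT0 (by linarith)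
  have h3 : T < t₁ + ε := by linarith [le_max_right 0 (T - ε / 2)]
  refine ⟨_, _, hε t₁ ⟨h1, by linarith⟩ fun s hs x => ?_,
    EReal.coe_lt_coe_iff.2 (lt_min h3 (by linarith))⟩
  -- compare with the given solution on an interval `[0, q]` with `t₁ < q < T`
  obtain ⟨q, htq, hqT⟩ := exists_between h2
  have hq0 : 0 < q := h1.trans_lt htq
  have hqT' : (q : EReal) < T := EReal.coe_lt_coe_iff.2 hqT
  obtain ⟨L, H⟩ := h.exists_hasFlow hq0 hqT'
  have hfield : ∀ t ∈ Icc 0 q, ∀ x, ‖field (f t) x‖ ≤ fieldBound f₀ C P := fun t ht x => by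
    rw [h.field_eq hf hq0 hqT' ht]
    exact H.norm_radialField_cloud_le_fieldBound hf hC0 hC ht (hP q hq0 hqT t ht) x
  have hle : q ≤ T + 1 := by linarith
  have hsq : s ∈ Icc 0 q := ⟨hs.1, hs.2.trans htq.le⟩
  have heq := (h.isCutoffSolution hf hq0 hqT' hB0 fun t ht x =>
    (hfield t ht x).trans (by linarith)).eq hf hB0 (hF.mono hle)
  rw [add_sub_cancel_right, ← HF.cloud_mono hle hsq, H.cloud_congr heq hsq,
    ← h.field_eq hf hq0 hqT' hsq]
  exact hfield s hsq x

/-- If the velocities of the maximal solution stay bounded on bounded time intervals, it is global.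
-/
theorem lifespan_eq_top (hf : IsState f₀) (hs : SphericallySymmetric f₀)
    (hP : ∀ T : ℝ, lifespan m f₀ = T → ∃ P, ∀ q : ℝ, 0 < q → q < T → ∀ t ∈ Icc 0 q, ∀ z,
      f₀ z ≠ 0 → ‖(forward m q (fun s => field (maximalSolution m f₀ s)) t z).2‖ ≤ P) :
    lifespan m f₀ = ⊤ := by
  obtain ⟨T₀, g₀, h₀⟩ := exists_isSymmetricSolution m hf hs
  have h := isSymmetricSolution_maximalSolution hf h₀
  rcases hT : lifespan m f₀ with _ | _ | T
  · have := h.solution.pos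
    rw [hT] at this
    exact absurd this (not_lt_bot (a := (0 : EReal)))
  · rfl
  · obtain ⟨P, hP⟩ := hP T hT
    rw [hT] at h
    obtain ⟨T', g, h', hlt⟩ := IsSymmetricSolution.exists_continuation h hf hs hP
    have := h'.le_lifespan
    rw [hT] at this
    exact absurd hlt (not_lt.2 this)

/-- The continuation criterion in terms of the velocity support. -/
theorem lifespan_eq_top_of_bddAbove (hf : IsState f₀) (hs : SphericallySymmetric f₀)
    (hb : BddAbove {p : ℝ | ∃ t ∈ timeInterval (lifespan m f₀),
      ∃ z ∈ tsupport (maximalSolution m f₀ t), p = ‖z.2‖}) : lifespan m f₀ = ⊤ := by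
  obtain ⟨T₀, g₀, h₀⟩ := exists_isSymmetricSolution m hf hs
  have h := isSymmetricSolution_maximalSolution hf h₀
  obtain ⟨P, hP⟩ := hb
  refine lifespan_eq_top hf hs fun T hT => ⟨P, fun q hq0 hqT t ht z hz => ?_⟩
  have hq : (q : EReal) < lifespan m f₀ := by rw [hT]; exact_mod_cast hqT
  obtain ⟨L, H⟩ := h.exists_hasFlow hq0 hq
  refine hP ⟨t, Icc_subset_timeInterval hq ht, _, subset_tsupport _ ?_, rfl⟩
  rwa [Function.mem_support, h.eq_transport hq0 hq ht, H.backward_forward ht]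

end

/-! ### Velocity bounds in the non-relativistic case -/

/-- The speed gained in one-dimensional motion under a force that is dominated by a function of
the position alone: while the velocity `η` has a sign, `η ^ 2 / 2 - H ξ` is monotone. -/
theorem sq_velocity_le_of_pos {t K : ℝ} {ξ η a g H : ℝ → ℝ} (ht : 0 ≤ t)
    (hξ : ∀ s ∈ Icc 0 t, HasDerivWithinAt ξ (η s) (Icc 0 t) s)
    (hη : ∀ s ∈ Icc 0 t, HasDerivWithinAt η (a s) (Icc 0 t) s)
    (ha : ∀ s ∈ Icc 0 t, |a s| ≤ g (ξ s)) (hH : ∀ x, HasDerivAt H (g x) x)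
    (hK : ∀ x, |H x| ≤ K) (hpos : 0 < η t) : η t ^ 2 ≤ η 0 ^ 2 + 4 * K := by
  have hηc : ContinuousOn η (Icc 0 t) := fun s hs => (hη s hs).continuousWithinAt
  -- `τ` is the last zero of the velocity, or the initial time
  obtain ⟨τ, hτ, hτ0, hτp⟩ : ∃ τ ∈ Icc 0 t, η τ ^ 2 ≤ η 0 ^ 2 ∧ ∀ s ∈ Ioo τ t, 0 < η s := by
    have hzero : ∀ s ∈ Icc 0 t, η s ≤ 0 → ∃ r ∈ Icc s t, η r = 0 := fun s hs h0 =>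
      intermediate_value_Icc hs.2 (hηc.mono (Icc_subset_Icc_left hs.1)) ⟨h0, hpos.le⟩
    rcases (Icc 0 t ∩ η ⁻¹' {0}).eq_empty_or_nonempty with he | hne
    · refine ⟨0, ⟨le_rfl, ht⟩, le_rfl, fun s hs => lt_of_not_ge fun h0 => ?_⟩
      obtain ⟨r, hr, hr0⟩ := hzero s ⟨hs.1.le, hs.2.le⟩ h0
      have : r ∈ Icc 0 t ∩ η ⁻¹' {0} := ⟨⟨hs.1.le.trans hr.1, hr.2⟩, hr0⟩
      rw [he] at this
      exact this
    · have hc : IsCompact (Icc 0 t ∩ η ⁻¹' {0}) :=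
        isCompact_Icc.of_isClosed_subset (hηc.preimage_isClosed_of_isClosed isClosed_Icc
          isClosed_singleton) inter_subset_left
      obtain ⟨τ, ⟨hτ, hτ0⟩, hmax⟩ := hc.exists_isGreatest hne
      have hτ0' : η τ = 0 := hτ0
      refine ⟨τ, hτ, by rw [hτ0']; nlinarith [sq_nonneg (η 0)],
        fun s hs => lt_of_not_ge fun h0 => ?_⟩
      obtain ⟨r, hr, hr0⟩ := hzero s ⟨hτ.1.trans hs.1.le, hs.2.le⟩ h0
      have := hmax ⟨⟨hτ.1.trans (hs.1.le.trans hr.1), hr.2⟩, hr0⟩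
      linarith [hs.1, hr.1]
  have hanti : AntitoneOn (fun s => η s ^ 2 / 2 - H (ξ s)) (Icc τ t) := by
    have hsub : Icc τ t ⊆ Icc 0 t := Icc_subset_Icc_left hτ.1
    have hd : ∀ s ∈ Icc 0 t, HasDerivWithinAt (fun s => η s ^ 2 / 2 - H (ξ s))
        (η s * (a s - g (ξ s))) (Icc 0 t) s := fun s hs => by
      have h1 := ((hη s hs).pow 2).div_const 2
      have h2 := (hH (ξ s)).comp_hasDerivWithinAt s (hξ s hs)
      refine (h1.sub h2).congr_deriv ?_
      push_cast
      ring
    refine antitoneOn_of_hasDerivWithinAt_nonpos (convex_Icc τ t)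
      (fun s hs => ((hd s (hsub hs)).continuousWithinAt).mono hsub)
      (fun s hs => (hd s (hsub (interior_subset hs))).mono (interior_subset.trans hsub))
      fun s hs => ?_
    rw [interior_Icc] at hs
    have h1 := le_of_abs_le (ha s (hsub (Ioo_subset_Icc_self hs)))
    nlinarith [hτp s hs]
  have h1 := hanti ⟨le_rfl, hτ.2⟩ ⟨hτ.2, le_rfl⟩ hτ.2
  have h2 := abs_le.1 (hK (ξ t))
  have h3 := abs_le.1 (hK (ξ τ))
  simp only at h1
  linarith [h2.1, h2.2, h3.1, h3.2]

theorem sq_velocity_le {t K : ℝ} {ξ η a g H : ℝ → ℝ} (ht : 0 ≤ t)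
    (hξ : ∀ s ∈ Icc 0 t, HasDerivWithinAt ξ (η s) (Icc 0 t) s)
    (hη : ∀ s ∈ Icc 0 t, HasDerivWithinAt η (a s) (Icc 0 t) s)
    (ha : ∀ s ∈ Icc 0 t, |a s| ≤ g (ξ s)) (hH : ∀ x, HasDerivAt H (g x) x)
    (hK : ∀ x, |H x| ≤ K) : η t ^ 2 ≤ η 0 ^ 2 + 4 * K := by
  rcases lt_trichotomy (η t) 0 with h | h | h
  · have := sq_velocity_le_of_pos (ξ := fun s => -ξ s) (η := fun s => -η s) (a := fun s => -a s)
      (g := fun x => g (-x)) (H := fun x => -H (-x)) (K := K) ht (fun s hs => (hξ s hs).neg)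
      (fun s hs => (hη s hs).neg) (fun s hs => by simpa using ha s hs)
      (fun x => (((hH (-x)).comp x (hasDerivAt_neg x)).neg).congr_deriv (by ring))
      (fun x => by simpa using hK (-x)) (by simpa using h)
    simpa using this
  · have := (abs_nonneg _).trans (hK 0)
    rw [h]
    nlinarith [sq_nonneg (η 0)]
  · exact sq_velocity_le_of_pos ht hξ hη ha hH hK h

/-- A force that is bounded by `M / k ^ 2` and by `M / x ^ 2` is dominated by the derivative
`2 M / (x ^ 2 + k ^ 2)` of an arctangent, whose total variation is `2 π M / k`. -/
theorem sq_velocity_le_of_inverse_square {t M k : ℝ} {ξ η a : ℝ → ℝ} (ht : 0 ≤ t) (hM : 0 < M)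
    (hk : 0 < k)
    (hξ : ∀ s ∈ Icc 0 t, HasDerivWithinAt ξ (η s) (Icc 0 t) s)
    (hη : ∀ s ∈ Icc 0 t, HasDerivWithinAt η (a s) (Icc 0 t) s)
    (ha : ∀ s ∈ Icc 0 t, |a s| * ξ s ^ 2 ≤ M) (hc : ∀ s ∈ Icc 0 t, |a s| * k ^ 2 ≤ M) :
    η t ^ 2 ≤ η 0 ^ 2 + 4 * (Real.pi * M / k) := by
  refine sq_velocity_le (g := fun x => 2 * M / (x ^ 2 + k ^ 2))
    (H := fun x => 2 * M / k * Real.arctan (x / k)) ht hξ hη (fun s hs => ?_) (fun x => ?_)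
    fun x => ?_
  · rw [le_div_iff₀ (by positivity)]
    linarith [ha s hs, hc s hs]
  · have h := ((Real.hasDerivAt_arctan (x / k)).comp x ((hasDerivAt_id x).div_const k)).const_mul
      (2 * M / k)
    refine h.congr_deriv ?_
    have : 0 < x ^ 2 + k ^ 2 := by positivity
    have : 0 < 1 + (x / k) ^ 2 := by positivity
    field_simp
    ring
  · have h : |Real.arctan (x / k)| ≤ Real.pi / 2 :=
      abs_le.2 ⟨(Real.neg_pi_div_two_lt_arctan _).le, (Real.arctan_lt_pi_div_two _).le⟩
    rw [abs_mul, abs_of_pos (by positivity : 0 < 2 * M / k)]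
    calc 2 * M / k * |Real.arctan (x / k)| ≤ 2 * M / k * (Real.pi / 2) := by gcongr
      _ = _ := by ring

section

variable {f₀ : Phase → ℝ} {q L : ℝ} {F : ℝ → Space → Space}

theorem HasFlow.sq_norm_forward_snd_le (H : HasFlow .nonrelativistic q L F) {M k : ℝ}
    (hM : 0 < M) (hk : 0 < k) (hFM : ∀ s ∈ Icc 0 q, ∀ x, ‖F s x‖ ≤ M / ‖x‖ ^ 2)
    (hFk : ∀ s ∈ Icc 0 q, ∀ x, ‖F s x‖ ≤ M / k ^ 2) {t : ℝ} (ht : t ∈ Icc 0 q) (z : Phase) :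
    ‖(forward .nonrelativistic q F t z).2‖ ^ 2 ≤ ‖z.2‖ ^ 2 + 12 * (Real.pi * M / k) := by
  have h0 := (HasFlow.zero_mem ht).2
  have hsub : Icc 0 t ⊆ Icc 0 q := Icc_subset_Icc_right ht.2
  have key : ∀ i : Fin 3, ‖(forward .nonrelativistic q F t z).2 i‖ ^ 2 ≤
      ‖z.2 i‖ ^ 2 + 4 * (Real.pi * M / k) := by
    intro i
    let p : Space →L[ℝ] ℝ := EuclideanSpace.proj i
    have h := sq_velocity_le_of_inverse_square (t := t) ht.1 hM hk
      (ξ := fun s => (forward .nonrelativistic q F s z).1 i)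
      (η := fun s => (forward .nonrelativistic q F s z).2 i)
      (a := fun s => (-F s (forward .nonrelativistic q F s z).1) i)
      (fun s hs => p.hasFDerivAt.comp_hasDerivWithinAt s
        ((H.hasDerivWithinAt_forward_fst z (hsub hs)).mono hsub))
      (fun s hs => p.hasFDerivAt.comp_hasDerivWithinAt s
        ((H.hasDerivWithinAt_forward_snd z (hsub hs)).mono hsub)) ?_ ?_
    · simpa [H.forward_zero h0] using h
    · intro s hs
      set x := (forward .nonrelativistic q F s z).1
      have h1 := hFM s (hsub hs) x
      have h2 : |(-F s x) i| ≤ ‖F s x‖ := by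
        simpa using PiLp.norm_apply_le (-F s x) i
      have h3 : x i ^ 2 ≤ ‖x‖ ^ 2 := by
        rw [← sq_abs]
        exact pow_le_pow_left₀ (abs_nonneg _) (PiLp.norm_apply_le x i) 2
      rcases eq_or_ne x 0 with hx | hx
      · simp [hx, hM.le]
      · rw [le_div_iff₀ (by positivity)] at h1
        exact (mul_le_mul h2 h3 (sq_nonneg _) (norm_nonneg _)).trans h1
    · intro s hs
      have h1 := hFk s (hsub hs) (forward .nonrelativistic q F s z).1
      rw [le_div_iff₀ (by positivity)] at h1
      refine (mul_le_mul_of_nonneg_right ?_ (sq_nonneg k)).trans h1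
      simpa using PiLp.norm_apply_le (-F s (forward .nonrelativistic q F s z).1) i
  rw [EuclideanSpace.norm_sq_eq, EuclideanSpace.norm_sq_eq, Fin.sum_univ_three,
    Fin.sum_univ_three]
  linarith [key 0, key 1, key 2]

/-- Velocities of spherically symmetric non-relativistic solutions are bounded independently of the
time interval. The field is at most `M / |x| ^ 2`, and at most of order `P ^ 2` when velocities are
bounded by `P`, which gives `P ^ 2 ≤ a + b P` for the smallest such bound. -/
theorem exists_velocity_bound_nonrelativistic (hf : IsState f₀) : ∃ P₁, ∀ (q : ℝ)
    (F : ℝ → Space → Space) (L : ℝ), HasFlow .nonrelativistic q L F →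
      (∀ s ∈ Icc 0 q, ∀ x, F s x = radialField (cloud .nonrelativistic q F f₀ s) x) →
      ∀ t ∈ Icc 0 q, ∀ z, f₀ z ≠ 0 → ‖(forward .nonrelativistic q F t z).2‖ ≤ P₁ := by
  obtain ⟨C, hC0, hC⟩ := hf.exists_bound
  obtain ⟨P₀, hP₀, hP₀'⟩ := hf.exists_velocityLe
  have hfin := hf.isFiniteMeasure
  have hu := unitBallVolume_pos
  -- the summand `1` covers the case of zero mass
  set M := (massMeasure f₀).real univ + 1 with hMdef
  have hM : 0 < M := by positivity
  set K := M + unitBallVolume * C * unitBallVolume with hK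
  have hK0 : 0 < K := by positivity
  set κ := Real.sqrt (M / K) with hκ
  have hκ0 : 0 < κ := Real.sqrt_pos.2 (by positivity)
  have hκ2 : κ ^ 2 = M / K := Real.sq_sqrt (by positivity)
  set A := 12 * (Real.pi * M / κ) with hA
  refine ⟨P₀ ^ 2 + 1 + A, fun q F L H hF t ht z hz => ?_⟩
  -- the smallest bound for the velocities that is at least `1`
  set S : Set ℝ := insert 1 {p | ∃ s ∈ Icc 0 q, ∃ z, f₀ z ≠ 0 ∧
    p = ‖(forward .nonrelativistic q F s z).2‖} with hS
  have hSb : BddAbove S := by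
    obtain ⟨P, -, hP⟩ := H.exists_velocity_bound hf
    refine BddAbove.insert 1 ⟨P, ?_⟩
    rintro _ ⟨s, hs, z, hz, rfl⟩
    exact hP s hs z hz
  set P := sSup S with hPdef
  have hP1 : 1 ≤ P := le_csSup hSb (mem_insert _ _)
  have hPpos : 0 < P := by linarith
  have hPle : ∀ s ∈ Icc 0 q, ∀ z, f₀ z ≠ 0 → ‖(forward .nonrelativistic q F s z).2‖ ≤ P :=
    fun s hs z hz => le_csSup hSb (mem_insert_of_mem _ ⟨s, hs, z, hz, rfl⟩)
  have hA0 : 0 ≤ A := by have := Real.pi_pos; positivity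
  have hstep : ∀ s ∈ Icc 0 q, ∀ z, f₀ z ≠ 0 →
      ‖(forward .nonrelativistic q F s z).2‖ ^ 2 ≤ P₀ ^ 2 + A * P := by
    intro s hs z hz
    -- for this `k`, `M / k ^ 2 = K P ^ 2`, which bounds the field when `R = 1 / P` is chosen below
    have h := H.sq_norm_forward_snd_le (M := M) (k := κ / P) hM (by positivity) ?_ ?_ hs z
    · have h1 : ‖z.2‖ ^ 2 ≤ P₀ ^ 2 := pow_le_pow_left₀ (norm_nonneg _) (hP₀' z hz) 2
      have h2 : 12 * (Real.pi * M / (κ / P)) = A * P := by rw [hA]; field_simp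
      linarith
    · intro s hs x
      have hcf : IsFiniteMeasure (cloud .nonrelativistic q F f₀ s) := by
        unfold cloud; infer_instance
      rw [hF s hs]
      refine (norm_radialField_le_div x).trans ?_
      rw [cloud, map_measureReal_apply (H.measurable_forward_fst hs) MeasurableSet.univ,
        preimage_univ]
      gcongr
      linarith
    · intro s hs x
      rw [hF s hs]
      refine (H.norm_radialField_cloud_le hf hC0 hC hs (hPle s hs) (R := 1 / P)
        (by positivity) x).trans ?_
      have e : M / (κ / P) ^ 2 = K * P ^ 2 := by
        rw [div_pow, hκ2]; field_simp
      have e' : unitBallVolume * densityBound C P * (1 / P) =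
          unitBallVolume * C * unitBallVolume * P ^ 2 := by
        rw [densityBound_eq C hPpos.le]; field_simp
      have e'' : (massMeasure f₀).real univ / (1 / P) ^ 2 = (massMeasure f₀).real univ * P ^ 2 := by
        field_simp
      rw [e, e', e'', hK, hMdef]
      nlinarith [sq_nonneg P]
  have hPsq : P ^ 2 ≤ P₀ ^ 2 + 1 + A * P := by
    have h1 : P ≤ Real.sqrt (P₀ ^ 2 + 1 + A * P) := by
      refine csSup_le ⟨1, mem_insert _ _⟩ ?_
      rintro _ (rfl | ⟨s, hs, z, hz, rfl⟩)
      · exact Real.one_le_sqrt.2 (by nlinarith [sq_nonneg P₀, mul_nonneg hA0 hPpos.le])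
      · exact Real.le_sqrt_of_sq_le (by linarith [hstep s hs z hz])
    calc P ^ 2 ≤ Real.sqrt (P₀ ^ 2 + 1 + A * P) ^ 2 := by gcongr
      _ = _ := Real.sq_sqrt (by positivity)
  have h1 : P * P ≤ (P₀ ^ 2 + 1 + A) * P := by nlinarith [sq_nonneg P₀]
  exact (hPle t ht z hz).trans (le_of_mul_le_mul_right h1 hPpos)

/-- Non-relativistic solutions are global. -/
theorem lifespan_nonrelativistic (hf : IsState f₀) (hs : SphericallySymmetric f₀) :
    lifespan .nonrelativistic f₀ = ⊤ := by
  obtain ⟨T₀, g₀, h₀⟩ := exists_isSymmetricSolution .nonrelativistic hf hs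
  have h := isSymmetricSolution_maximalSolution hf h₀
  obtain ⟨P₁, hP₁⟩ := exists_velocity_bound_nonrelativistic hf
  refine lifespan_eq_top hf hs fun T hT => ⟨P₁, fun q hq0 hqT => ?_⟩
  have hq : (q : EReal) < lifespan .nonrelativistic f₀ := by rw [hT]; exact_mod_cast hqT
  obtain ⟨L, H⟩ := h.exists_hasFlow hq0 hq
  exact hP₁ q _ L H fun s hs x => h.field_eq hf hq0 hq hs x

end

/-! ### Conservation of the Casimir functionals -/

theorem HasFlow.casimir_comp_backward {m : Model} {T L : ℝ} {F : ℝ → Space → Space}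
    (H : HasFlow m T L F) {t : ℝ} (ht : t ∈ Icc 0 T) (Φ : ℝ → ℝ) (f₀ : Phase → ℝ) :
    casimir Φ (fun z => f₀ (backward m T F t z)) = casimir Φ f₀ :=
  (H.measurePreserving_backward ht).integral_comp
    (H.homeomorph ht).symm.measurableEmbedding fun z => Φ (f₀ z)

/-! ### The softened kernel -/

/-- The softened distance `√(ε² + |y|²)`. -/
def softNorm (ε : ℝ) (y : Space) : ℝ := Real.sqrt (ε ^ 2 + ‖y‖ ^ 2)

/-- The softened kernel `y / (ε² + |y|²) ^ (3 / 2)`. -/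
def softKernel (ε : ℝ) (y : Space) : Space := (softNorm ε y ^ 3)⁻¹ • y

theorem continuous_softNorm (ε : ℝ) : Continuous (softNorm ε) := by unfold softNorm; fun_prop

theorem sq_softNorm (ε : ℝ) (y : Space) : softNorm ε y ^ 2 = ε ^ 2 + ‖y‖ ^ 2 :=
  Real.sq_sqrt (by positivity)

theorem norm_le_softNorm (ε : ℝ) (y : Space) : ‖y‖ ≤ softNorm ε y :=
  Real.le_sqrt_of_sq_le (by linarith [sq_nonneg ε])

theorem le_softNorm (ε : ℝ) (y : Space) : ε ≤ softNorm ε y :=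
  Real.le_sqrt_of_sq_le (by linarith [sq_nonneg ‖y‖])

theorem softNorm_neg (ε : ℝ) (y : Space) : softNorm ε (-y) = softNorm ε y := by simp [softNorm]

theorem softKernel_neg (ε : ℝ) (y : Space) : softKernel ε (-y) = -softKernel ε y := by
  simp [softKernel, softNorm_neg]

section

variable {ε : ℝ}

theorem softNorm_pos (hε : 0 < ε) (y : Space) : 0 < softNorm ε y :=
  hε.trans_le (le_softNorm ε y)

theorem continuous_softKernel (hε : 0 < ε) : Continuous (softKernel ε) :=
  (((continuous_softNorm ε).pow 3).inv₀ fun y => (pow_pos (softNorm_pos hε y) 3).ne').smul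
    continuous_id

theorem norm_softKernel_le (hε : 0 < ε) (y : Space) : ‖softKernel ε y‖ ≤ (ε ^ 2)⁻¹ := by
  have h := softNorm_pos hε y
  rw [softKernel, norm_smul, norm_inv, norm_pow, Real.norm_of_nonneg h.le,
    inv_mul_le_iff₀ (by positivity)]
  have h1 : ε ^ 2 ≤ softNorm ε y ^ 2 := pow_le_pow_left₀ hε.le (le_softNorm ε y) 2
  rw [← div_eq_mul_inv, le_div_iff₀ (by positivity)]
  calc ‖y‖ * ε ^ 2 ≤ softNorm ε y * softNorm ε y ^ 2 :=
        mul_le_mul (norm_le_softNorm ε y) h1 (by positivity) h.le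
    _ = _ := by ring

theorem inv_softNorm_le (hε : 0 < ε) (y : Space) : (softNorm ε y)⁻¹ ≤ ε⁻¹ :=
  inv_anti₀ hε (le_softNorm ε y)

/-- The softened kernel is minus the gradient of the softened potential. -/
theorem hasDerivWithinAt_inv_softNorm (hε : 0 < ε) {y : ℝ → Space} {y' : Space} {S : Set ℝ}
    {s : ℝ} (hy : HasDerivWithinAt y y' S s) :
    HasDerivWithinAt (fun s => (softNorm ε (y s))⁻¹) (-inner ℝ (softKernel ε (y s)) y') S s := by
  have hpos := softNorm_pos hε (y s)
  have h0 : ε ^ 2 + ‖y s‖ ^ 2 ≠ 0 := by positivity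
  have h1 := ((hy.norm_sq.const_add (ε ^ 2)).sqrt h0).inv hpos.ne'
  refine h1.congr_deriv ?_
  change -(2 * inner ℝ (y s) y' / (2 * softNorm ε (y s))) / softNorm ε (y s) ^ 2 = _
  rw [softKernel, real_inner_smul_left]
  field_simp

theorem norm_kernel_sub_softKernel_le (hε : 0 < ε) (y : Space) :
    ‖kernel y - softKernel ε y‖ ≤ (‖y‖ ^ 2)⁻¹ ∧
      (1 ≤ ‖y‖ → ‖kernel y - softKernel ε y‖ ≤ 3 * ε ^ 2) := by
  rcases eq_or_ne y 0 with rfl | hy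
  · simp [kernel, softKernel]
  set a := ‖y‖ with ha
  set r := softNorm ε y with hr
  have ha0 : 0 < a := norm_pos_iff.2 hy
  have har : a ≤ r := norm_le_softNorm ε y
  have hr0 : 0 < r := ha0.trans_le har
  have hr2 : r ^ 2 = ε ^ 2 + a ^ 2 := sq_softNorm ε y
  have h3 : a ^ 3 ≤ r ^ 3 := pow_le_pow_left₀ ha0.le har 3
  have e : ‖kernel y - softKernel ε y‖ = (r ^ 3 - a ^ 3) / (a ^ 2 * r ^ 3) := by
    rw [kernel, softKernel, ← sub_smul, norm_smul, ← ha, ← hr, Real.norm_of_nonneg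
      (sub_nonneg.2 (inv_anti₀ (by positivity) h3))]
    field_simp
  rw [e]
  refine ⟨?_, fun h1 => ?_⟩
  · rw [div_le_iff₀ (by positivity)]
    have : (a ^ 2)⁻¹ * (a ^ 2 * r ^ 3) = r ^ 3 := by field_simp
    rw [this]
    linarith [pow_pos ha0 3]
  · rw [div_le_iff₀ (by positivity)]
    have h4 : r - a ≤ ε ^ 2 := by nlinarith
    have h5 : r ^ 3 - a ^ 3 ≤ (r - a) * (3 * r ^ 2) := by
      have : r ^ 3 - a ^ 3 = (r - a) * (r ^ 2 + r * a + a ^ 2) := by ring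
      rw [this]
      refine mul_le_mul_of_nonneg_left ?_ (by linarith)
      nlinarith
    have h6 : r ^ 2 ≤ a ^ 2 * r ^ 3 := by
      have : 1 ≤ a ^ 2 * r := by nlinarith
      nlinarith [pow_pos hr0 2]
    calc r ^ 3 - a ^ 3 ≤ ε ^ 2 * (3 * r ^ 2) := h5.trans (by gcongr)
      _ ≤ ε ^ 2 * (3 * (a ^ 2 * r ^ 3)) := by gcongr
      _ = _ := by ring

end

theorem tendsto_softNorm (y : Space) :
    Filter.Tendsto (fun ε => softNorm ε y) (𝓝[>] 0) (𝓝 ‖y‖) := by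
  have h : Continuous fun ε => softNorm ε y := by unfold softNorm; fun_prop
  have h1 := (h.tendsto 0).mono_left (nhdsWithin_le_nhds (s := Ioi 0))
  have h2 : softNorm 0 y = ‖y‖ := by
    rw [softNorm, zero_pow two_ne_zero, zero_add, Real.sqrt_sq (norm_nonneg y)]
  rwa [h2] at h1

theorem tendsto_norm_kernel_sub_softKernel (y : Space) :
    Filter.Tendsto (fun ε => ‖kernel y - softKernel ε y‖) (𝓝[>] 0) (𝓝 0) := by
  rcases eq_or_ne y 0 with rfl | hy
  · simp [kernel, softKernel]
  have h : Filter.Tendsto (fun ε => softKernel ε y) (𝓝[>] 0) (𝓝 (kernel y)) :=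
    (((tendsto_softNorm y).pow 3).inv₀ (pow_ne_zero 3 (norm_ne_zero_iff.2 hy))).smul_const y
  have h1 := (tendsto_const_nhds (x := kernel y)).sub h
  rw [sub_self] at h1
  simpa using h1.norm

theorem measurable_softKernel (ε : ℝ) : Measurable (softKernel ε) := by
  have := (continuous_softNorm ε).measurable
  unfold softKernel
  fun_prop

theorem measurable_norm_kernel_sub_softKernel (ε : ℝ) :
    Measurable fun y => ‖kernel y - softKernel ε y‖ :=
  (measurable_kernel.sub (measurable_softKernel ε)).norm

theorem integrableOn_norm_kernel_sub_softKernel {ε : ℝ} (hε : 0 < ε) :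
    IntegrableOn (fun y => ‖kernel y - softKernel ε y‖) (Metric.ball 0 1) :=
  (integrableOn_inv_norm_sq 1).mono' (measurable_norm_kernel_sub_softKernel ε).aestronglyMeasurable
    (Filter.Eventually.of_forall fun y => by
      rw [norm_norm]; exact (norm_kernel_sub_softKernel_le hε y).1)

theorem tendsto_integral_norm_kernel_sub_softKernel :
    Filter.Tendsto (fun ε => ∫ y in Metric.ball (0 : Space) 1, ‖kernel y - softKernel ε y‖)
      (𝓝[>] 0) (𝓝 0) := by
  have h := tendsto_integral_filter_of_dominated_convergence
    (μ := volume.restrict (Metric.ball (0 : Space) 1)) (l := 𝓝[>] (0 : ℝ))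
    (F := fun ε y => ‖kernel y - softKernel ε y‖) (f := fun _ => (0 : ℝ))
    (fun y => (‖y‖ ^ 2)⁻¹)
    (Filter.Eventually.of_forall fun ε =>
      (measurable_norm_kernel_sub_softKernel ε).aestronglyMeasurable) ?_
    (integrableOn_inv_norm_sq 1)
    (Filter.Eventually.of_forall fun y => tendsto_norm_kernel_sub_softKernel y)
  · simpa using h
  · filter_upwards [self_mem_nhdsWithin] with ε hε
    refine Filter.Eventually.of_forall fun y => ?_
    rw [norm_norm]
    exact (norm_kernel_sub_softKernel_le hε y).1

/-! ### Integrals over pairs of particles -/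

section

variable {μ : Measure Space} {D c : ℝ} {φ : Space → ℝ}

theorem DensityLe.integral_prod_comp_sub_le (h : DensityLe μ D) (hm : Measurable φ)
    (h0 : ∀ y, 0 ≤ φ y) (hφ : IntegrableOn φ (Metric.ball 0 1)) (hc : ∀ y, 1 ≤ ‖y‖ → φ y ≤ c) :
    Integrable (fun p : Space × Space => φ (p.1 - p.2)) (μ.prod μ) ∧
      ∫ p : Space × Space, φ (p.1 - p.2) ∂μ.prod μ ≤
        (D * (∫ y in Metric.ball 0 1, φ y) + c * μ.real univ) * μ.real univ := by
  have := h.finite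
  set A := D * (∫ y in Metric.ball 0 1, φ y) + c * μ.real univ
  have hA := fun x => h.integral_comp_sub_le hm h0 hφ hc x
  have hm2 : AEStronglyMeasurable (fun p : Space × Space => φ (p.1 - p.2)) (μ.prod μ) :=
    (hm.comp (by fun_prop)).aestronglyMeasurable
  have hmi : AEStronglyMeasurable (fun x => ∫ y, φ (x - y) ∂μ) μ := hm2.integral_prod_right'
  have hint : Integrable (fun x => ∫ y, φ (x - y) ∂μ) μ := by
    refine (integrable_const A).mono' hmi (Filter.Eventually.of_forall fun x => ?_)
    rw [Real.norm_of_nonneg (integral_nonneg fun _ => h0 _)]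
    exact (hA x).2
  have hprod : Integrable (fun p : Space × Space => φ (p.1 - p.2)) (μ.prod μ) := by
    rw [integrable_prod_iff hm2]
    refine ⟨Filter.Eventually.of_forall fun x => (hA x).1, hint.congr ?_⟩
    exact Filter.Eventually.of_forall fun x => by simp [abs_of_nonneg (h0 _)]
  refine ⟨hprod, ?_⟩
  rw [integral_prod _ hprod]
  calc ∫ x, ∫ y, φ (x - y) ∂μ ∂μ ≤ ∫ _, A ∂μ :=
        integral_mono hint (integrable_const A) fun x => (hA x).2
    _ = A * μ.real univ := by simp [mul_comm]

theorem DensityLe.ae_prod_ne (h : DensityLe μ D) :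
    ∀ᵐ p : Space × Space ∂μ.prod μ, p.1 - p.2 ≠ 0 := by
  have := h.finite
  have hd : MeasurableSet {p : Space × Space | p.1 - p.2 = 0} :=
    (measurable_fst.sub measurable_snd) (measurableSet_singleton 0)
  rw [ae_iff]
  simp only [ne_eq, not_not]
  rw [Measure.measure_prod_null hd]
  refine Filter.Eventually.of_forall fun x => ?_
  have e : Prod.mk x ⁻¹' {p : Space × Space | p.1 - p.2 = 0} = {x} := by
    ext y; simp [sub_eq_zero, eq_comm]
  change μ (Prod.mk x ⁻¹' {p : Space × Space | p.1 - p.2 = 0}) = 0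
  rw [e]
  exact le_antisymm ((h.le {x}).trans_eq (by simp)) bot_le

/-- The softened potential energy converges to the potential energy. -/
theorem DensityLe.tendsto_integral_inv_softNorm (h : DensityLe μ D) :
    Filter.Tendsto (fun ε => ∫ p : Space × Space, (softNorm ε (p.1 - p.2))⁻¹ ∂μ.prod μ)
      (𝓝[>] 0) (𝓝 (∫ p : Space × Space, ‖p.1 - p.2‖⁻¹ ∂μ.prod μ)) := by
  have := h.finite
  have hint := (h.integral_prod_comp_sub_le (φ := fun y => (‖y‖ ^ 2)⁻¹) (c := 1) (by fun_prop)
    (fun _ => by positivity) (integrableOn_inv_norm_sq 1)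
    (fun _ hy => inv_le_one_of_one_le₀ (one_le_pow₀ hy))).1
  refine tendsto_integral_filter_of_dominated_convergence
    (fun p => 1 + (‖p.1 - p.2‖ ^ 2)⁻¹) (Filter.Eventually.of_forall fun ε => ?_) ?_
    ((integrable_const 1).add hint) ?_
  · have := (continuous_softNorm ε).measurable
    exact Measurable.aestronglyMeasurable (by fun_prop)
  · filter_upwards [self_mem_nhdsWithin] with ε hε
    filter_upwards [h.ae_prod_ne] with p hp
    have h1 : 0 < ‖p.1 - p.2‖ := norm_pos_iff.2 hp
    have h2 : (softNorm ε (p.1 - p.2))⁻¹ ≤ ‖p.1 - p.2‖⁻¹ :=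
      inv_anti₀ h1 (norm_le_softNorm ε _)
    rw [Real.norm_of_nonneg (inv_nonneg.2 (softNorm_pos hε _).le), ← inv_pow]
    nlinarith [sq_nonneg (‖p.1 - p.2‖⁻¹ - 1), inv_pos.2 h1]
  · filter_upwards [h.ae_prod_ne] with p hp
    exact (tendsto_softNorm _).inv₀ (norm_ne_zero_iff.2 hp)

end

/-! ### Energy in Lagrangian coordinates -/

theorem continuous_particleEnergy (m : Model) : Continuous m.particleEnergy := by
  cases m <;> (unfold Model.particleEnergy; fun_prop)

theorem abs_particleEnergy_le (m : Model) (v : Space) : |m.particleEnergy v| ≤ 1 + ‖v‖ ^ 2 := by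
  have h := sq_nonneg ‖v‖
  cases m with
  | nonrelativistic =>
    rw [Model.particleEnergy, abs_of_nonneg (by positivity)]
    linarith
  | relativistic =>
    rw [Model.particleEnergy, abs_of_nonneg (by positivity), Real.sqrt_le_left (by positivity)]
    nlinarith

/-- The velocity is the gradient of the particle energy. -/
theorem hasDerivWithinAt_particleEnergy (m : Model) {V : ℝ → Space} {V' : Space} {S : Set ℝ}
    {s : ℝ} (hV : HasDerivWithinAt V V' S s) :
    HasDerivWithinAt (fun s => m.particleEnergy (V s)) (inner ℝ (m.velocity (V s)) V') S s := by
  cases m with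
  | nonrelativistic =>
    refine (hV.norm_sq.div_const 2).congr_deriv ?_
    rw [Model.velocity]
    ring
  | relativistic =>
    have h0 : 1 + ‖V s‖ ^ 2 ≠ 0 := by positivity
    refine ((hV.norm_sq.const_add 1).sqrt h0).congr_deriv ?_
    have h1 : 0 < Real.sqrt (1 + ‖V s‖ ^ 2) := by positivity
    rw [Model.velocity, real_inner_smul_left]
    field_simp

theorem IsState.kineticEnergy_eq {g : Phase → ℝ} (hg : IsState g) (m : Model) :
    kineticEnergy m g = ∫ z, m.particleEnergy z.2 ∂massMeasure g := by
  rw [hg.integral_massMeasure, kineticEnergy]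
  simp_rw [smul_eq_mul, mul_comm]

theorem IsState.potentialEnergy_eq {g : Phase → ℝ} (hg : IsState g) :
    potentialEnergy g = -(1 / 2) *
      ∫ p : Phase × Phase, ‖p.1.1 - p.2.1‖⁻¹ ∂(massMeasure g).prod (massMeasure g) := by
  have hm := hg.measurable.ennreal_ofReal
  have hm2 : Measurable fun p : Phase × Phase =>
      ENNReal.ofReal (g p.1) * ENNReal.ofReal (g p.2) :=
    (hm.comp measurable_fst).mul (hm.comp measurable_snd)
  rw [potentialEnergy, massMeasure, prod_withDensity hm hm,
    integral_withDensity_eq_integral_toReal_smul hm2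
      (Filter.Eventually.of_forall fun p => ENNReal.mul_lt_top ENNReal.ofReal_lt_top
        ENNReal.ofReal_lt_top), ← Measure.volume_eq_prod]
  congr 1
  refine integral_congr_ae (Filter.Eventually.of_forall fun p => ?_)
  simp only [ENNReal.toReal_mul, ENNReal.toReal_ofReal (hg.nonneg _), smul_eq_mul, div_eq_mul_inv]

section

variable {m : Model} {q L : ℝ} {F : ℝ → Space → Space} {f₀ : Phase → ℝ}

theorem HasFlow.kineticEnergy_comp_backward (H : HasFlow m q L F) (hf : IsState f₀) {s : ℝ}
    (hs : s ∈ Icc 0 q) : kineticEnergy m (fun z => f₀ (backward m q F s z)) =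
      ∫ z, m.particleEnergy (forward m q F s z).2 ∂massMeasure f₀ := by
  rw [(H.isState_comp_backward hf hs).kineticEnergy_eq, H.massMeasure_comp_backward hf hs,
    integral_map (H.continuous_forward hs).measurable.aemeasurable]
  exact ((continuous_particleEnergy m).comp continuous_snd).measurable.aestronglyMeasurable

theorem HasFlow.prod_cloud (H : HasFlow m q L F) (hf : IsState f₀) {s : ℝ} (hs : s ∈ Icc 0 q) :
    (cloud m q F f₀ s).prod (cloud m q F f₀ s) =
      ((massMeasure f₀).prod (massMeasure f₀)).map
        (Prod.map (fun z => (forward m q F s z).1) fun z => (forward m q F s z).1) := by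
  have := hf.isFiniteMeasure
  exact Measure.map_prod_map _ _ (H.measurable_forward_fst hs) (H.measurable_forward_fst hs)

theorem HasFlow.potentialEnergy_comp_backward (H : HasFlow m q L F) (hf : IsState f₀) {s : ℝ}
    (hs : s ∈ Icc 0 q) : potentialEnergy (fun z => f₀ (backward m q F s z)) =
      -(1 / 2) * ∫ p : Space × Space, ‖p.1 - p.2‖⁻¹
        ∂(cloud m q F f₀ s).prod (cloud m q F f₀ s) := by
  have := hf.isFiniteMeasure
  have := (H.isState_comp_backward hf hs).isFiniteMeasure
  rw [(H.isState_comp_backward hf hs).potentialEnergy_eq, H.cloud_eq hf hs,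
    Measure.map_prod_map _ _ measurable_fst measurable_fst, integral_map (by fun_prop)]
  · rfl
  · exact Measurable.aestronglyMeasurable (by fun_prop)

theorem HasFlow.integral_prod_cloud (H : HasFlow m q L F) (hf : IsState f₀) {s : ℝ}
    (hs : s ∈ Icc 0 q) {φ : Space → ℝ} (hφ : Measurable φ) :
    ∫ p : Space × Space, φ (p.1 - p.2) ∂(cloud m q F f₀ s).prod (cloud m q F f₀ s) =
      ∫ p : Phase × Phase, φ ((forward m q F s p.1).1 - (forward m q F s p.2).1)
        ∂(massMeasure f₀).prod (massMeasure f₀) := by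
  have h := H.measurable_forward_fst hs
  rw [H.prod_cloud hf hs, integral_map (h.prodMap h).aemeasurable
    (Measurable.aestronglyMeasurable (by fun_prop))]
  rfl

theorem HasFlow.integrable_prod_cloud (H : HasFlow m q L F) (hf : IsState f₀) {s : ℝ}
    (hs : s ∈ Icc 0 q) {φ : Space → ℝ}
    (hφ : Integrable (fun p : Space × Space => φ (p.1 - p.2))
      ((cloud m q F f₀ s).prod (cloud m q F f₀ s))) :
    Integrable (fun p : Phase × Phase => φ ((forward m q F s p.1).1 - (forward m q F s p.2).1))
        ((massMeasure f₀).prod (massMeasure f₀)) := by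
  have h := H.measurable_forward_fst hs
  rw [H.prod_cloud hf hs] at hφ
  exact hφ.comp_aemeasurable (h.prodMap h).aemeasurable

end

/-! ### Conservation of energy -/

/-- Differentiation of an average of uniformly Lipschitz functions of time. -/
theorem hasDerivAt_integral_of_bound {α : Type*} [MeasurableSpace α] {ν : Measure α}
    [IsFiniteMeasure ν] {φ φ' : ℝ → α → ℝ} {q A A' : ℝ}
    (hm : ∀ s ∈ Icc 0 q, AEStronglyMeasurable (φ s) ν)
    (hm' : ∀ s ∈ Icc 0 q, AEStronglyMeasurable (φ' s) ν)
    (hb : ∀ᵐ a ∂ν, ∀ s ∈ Icc 0 q, ‖φ s a‖ ≤ A)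
    (hb' : ∀ᵐ a ∂ν, ∀ s ∈ Icc 0 q, ‖φ' s a‖ ≤ A')
    (hd : ∀ a, ∀ s ∈ Icc 0 q, HasDerivWithinAt (fun s => φ s a) (φ' s a) (Icc 0 q) s) :
    ContinuousOn (fun s => ∫ a, φ s a ∂ν) (Icc 0 q) ∧
      ∀ s ∈ Ioo 0 q, HasDerivAt (fun s => ∫ a, φ s a ∂ν) (∫ a, φ' s a ∂ν) s := by
  constructor
  · refine continuousOn_of_dominated (bound := fun _ => A) hm (fun s hs => ?_)
      (integrable_const A)
      (Filter.Eventually.of_forall fun a s hs => (hd a s hs).continuousWithinAt)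
    filter_upwards [hb] with a ha using ha s hs
  · intro s hs
    have hnhds : Ioo 0 q ∈ 𝓝 s := isOpen_Ioo.mem_nhds hs
    refine (hasDerivAt_integral_of_dominated_loc_of_deriv_le (bound := fun _ => A') (s := Ioo 0 q)
      hnhds (Filter.mem_of_superset hnhds fun u hu => hm u (Ioo_subset_Icc_self hu))
      ((integrable_const A).mono' (hm s (Ioo_subset_Icc_self hs)) ?_)
      (hm' s (Ioo_subset_Icc_self hs)) ?_ (integrable_const A') ?_).2
    · filter_upwards [hb] with a ha using ha s (Ioo_subset_Icc_self hs)
    · filter_upwards [hb'] with a ha u hu using ha u (Ioo_subset_Icc_self hu)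
    · exact Filter.Eventually.of_forall fun a u hu =>
        (hd a u (Ioo_subset_Icc_self hu)).hasDerivAt (Icc_mem_nhds hu.1 hu.2)

section

variable {m : Model} {q L : ℝ} {F : ℝ → Space → Space} {f₀ : Phase → ℝ}

/-- The energy of the particles with the potential of a softened kernel. -/
def softEnergy (m : Model) (q : ℝ) (F : ℝ → Space → Space) (f₀ : Phase → ℝ) (ε s : ℝ) : ℝ :=
  (∫ z, m.particleEnergy (forward m q F s z).2 ∂massMeasure f₀) - 1 / 2 *
    ∫ p : Phase × Phase, (softNorm ε ((forward m q F s p.1).1 - (forward m q F s p.2).1))⁻¹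
      ∂(massMeasure f₀).prod (massMeasure f₀)

/-- The rate of change of the softened energy is the power of the difference between the field and
the softened field. Symmetry under the exchange of two particles removes the factor `1 / 2`. -/
theorem HasFlow.abs_softEnergy_deriv_le (H : HasFlow m q L F) (hf : IsState f₀)
    (hF : ∀ s ∈ Icc 0 q, ∀ x, F s x =
      ∫ z, kernel (x - (forward m q F s z).1) ∂massMeasure f₀)
    {P : ℝ} (hP : ∀ s ∈ Icc 0 q, ∀ z, f₀ z ≠ 0 → ‖(forward m q F s z).2‖ ≤ P) {ε : ℝ}
    (hε : 0 < ε) {s : ℝ} (hs : s ∈ Icc 0 q) {D : ℝ} (hD : DensityLe (cloud m q F f₀ s) D) :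
    |(∫ z, inner ℝ (m.velocity (forward m q F s z).2)
        (-F s (forward m q F s z).1) ∂massMeasure f₀) - 1 / 2 *
      ∫ p : Phase × Phase, -inner ℝ
        (softKernel ε ((forward m q F s p.1).1 - (forward m q F s p.2).1))
        (m.velocity (forward m q F s p.1).2 - m.velocity (forward m q F s p.2).2)
        ∂(massMeasure f₀).prod (massMeasure f₀)| ≤
      P * ∫ p : Phase × Phase,
        ‖kernel ((forward m q F s p.1).1 - (forward m q F s p.2).1) -
          softKernel ε ((forward m q F s p.1).1 - (forward m q F s p.2).1)‖
        ∂(massMeasure f₀).prod (massMeasure f₀) := by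
  have := hf.isFiniteMeasure
  set ν := massMeasure f₀ with hν
  set X : Phase → Space := fun z => (forward m q F s z).1 with hX
  set W : Phase → Space := fun z => m.velocity (forward m q F s z).2 with hW
  have hXm : Measurable X := H.measurable_forward_fst hs
  have hWm : Measurable W :=
    ((continuous_velocity m).comp (H.continuous_forward hs).snd).measurable
  have hWP : ∀ᵐ z ∂ν, ‖W z‖ ≤ P := hf.ae_massMeasure fun z hz =>
    (norm_velocity_le m _).trans (hP s hs z hz)
  have hWP1 : ∀ᵐ p ∂ν.prod ν, ‖W p.1‖ ≤ P := Measure.quasiMeasurePreserving_fst.ae hWP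
  have hWP2 : ∀ᵐ p ∂ν.prod ν, ‖W p.2‖ ≤ P := Measure.quasiMeasurePreserving_snd.ae hWP
  have hKm := measurable_softKernel ε
  have hkm := measurable_kernel
  have hKi : ∀ Y : Phase × Phase → Space, Measurable Y → (∀ᵐ p ∂ν.prod ν, ‖Y p‖ ≤ P) →
      Integrable (fun p : Phase × Phase => inner ℝ (softKernel ε (X p.1 - X p.2)) (Y p))
        (ν.prod ν) := by
    intro Y hY hYP
    refine (integrable_const ((ε ^ 2)⁻¹ * P)).mono'
      (Measurable.aestronglyMeasurable (by fun_prop)) ?_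
    filter_upwards [hYP] with p hp
    exact (norm_inner_le_norm _ _).trans
      (mul_le_mul (norm_softKernel_le hε _) hp (norm_nonneg _) (by positivity))
  have hK1 := hKi (fun p => W p.1) (by fun_prop) hWP1
  have hK2 := hKi (fun p => W p.2) (by fun_prop) hWP2
  have hk1 : Integrable (fun p : Phase × Phase => inner ℝ (W p.1) (kernel (X p.1 - X p.2)))
      (ν.prod ν) := by
    have h1 := H.integrable_prod_cloud hf hs (φ := fun y => (‖y‖ ^ 2)⁻¹)
      (hD.integral_prod_comp_sub_le (φ := fun y => (‖y‖ ^ 2)⁻¹) (c := 1) (by fun_prop)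
        (fun _ => by positivity) (integrableOn_inv_norm_sq 1)
        (fun _ hy => inv_le_one_of_one_le₀ (one_le_pow₀ hy))).1
    refine (h1.const_mul P).mono' (Measurable.aestronglyMeasurable (by fun_prop)) ?_
    filter_upwards [hWP1] with p hp
    refine (norm_inner_le_norm _ _).trans ?_
    rw [norm_kernel]
    exact mul_le_mul_of_nonneg_right hp (by positivity)
  have e1 : ∫ z, inner ℝ (W z) (-F s (X z)) ∂ν =
      -∫ p : Phase × Phase, inner ℝ (W p.1) (kernel (X p.1 - X p.2)) ∂ν.prod ν := by
    rw [integral_prod _ hk1, ← integral_neg]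
    refine integral_congr_ae (Filter.Eventually.of_forall fun z => ?_)
    have hi : Integrable (fun z' => kernel (X z - X z')) ν :=
      (hD.integrable_kernel (X z)).comp_measurable hXm
    simp only
    rw [inner_neg_right, hF s hs, ← integral_inner hi]
  have e2 : ∫ p : Phase × Phase, inner ℝ (softKernel ε (X p.1 - X p.2)) (W p.2) ∂ν.prod ν =
      -∫ p : Phase × Phase, inner ℝ (softKernel ε (X p.1 - X p.2)) (W p.1) ∂ν.prod ν := by
    rw [← integral_prod_swap, ← integral_neg]
    refine integral_congr_ae (Filter.Eventually.of_forall fun p => ?_)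
    simp only [Prod.fst_swap, Prod.snd_swap]
    rw [← neg_sub, softKernel_neg, inner_neg_left]
  have e3 : ∫ p : Phase × Phase, -inner ℝ (softKernel ε (X p.1 - X p.2)) (W p.1 - W p.2)
      ∂ν.prod ν =
      -(2 * ∫ p : Phase × Phase, inner ℝ (softKernel ε (X p.1 - X p.2)) (W p.1) ∂ν.prod ν) := by
    rw [integral_neg]
    simp_rw [inner_sub_right]
    rw [integral_sub hK1 hK2, e2]
    ring
  have e4 : (∫ z, inner ℝ (W z) (-F s (X z)) ∂ν) - 1 / 2 *
      ∫ p : Phase × Phase, -inner ℝ (softKernel ε (X p.1 - X p.2)) (W p.1 - W p.2) ∂ν.prod ν =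
      ∫ p : Phase × Phase, -inner ℝ (W p.1)
        (kernel (X p.1 - X p.2) - softKernel ε (X p.1 - X p.2)) ∂ν.prod ν := by
    have hK1' : Integrable (fun p : Phase × Phase =>
        inner ℝ (W p.1) (softKernel ε (X p.1 - X p.2))) (ν.prod ν) := by
      simpa only [real_inner_comm] using hK1
    rw [e1, e3, integral_neg]
    simp_rw [inner_sub_right]
    rw [integral_sub hk1 hK1']
    simp_rw [real_inner_comm (W _) (softKernel ε _)]
    ring
  change |(∫ z, inner ℝ (W z) (-F s (X z)) ∂ν) - 1 / 2 * ∫ p : Phase × Phase,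
    -inner ℝ (softKernel ε (X p.1 - X p.2)) (W p.1 - W p.2) ∂ν.prod ν| ≤ _
  rw [e4, ← Real.norm_eq_abs, ← integral_const_mul]
  refine norm_integral_le_of_norm_le (Integrable.const_mul ?_ P) ?_
  · exact H.integrable_prod_cloud hf hs (φ := fun y => ‖kernel y - softKernel ε y‖)
      (hD.integral_prod_comp_sub_le (measurable_norm_kernel_sub_softKernel ε)
        (fun _ => norm_nonneg _) (integrableOn_norm_kernel_sub_softKernel hε)
        fun y hy => (norm_kernel_sub_softKernel_le hε y).2 hy).1
  · filter_upwards [hWP1] with p hp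
    rw [norm_neg]
    exact (norm_inner_le_norm _ _).trans (mul_le_mul_of_nonneg_right hp (norm_nonneg _))

end

section

variable {m : Model} {q L : ℝ} {F : ℝ → Space → Space} {f₀ : Phase → ℝ}

theorem HasFlow.abs_softEnergy_sub_le (H : HasFlow m q L F) (hf : IsState f₀)
    (hF : ∀ s ∈ Icc 0 q, ∀ x, F s x =
      ∫ z, kernel (x - (forward m q F s z).1) ∂massMeasure f₀)
    {B : ℝ} (hB : ∀ s ∈ Icc 0 q, ∀ x, ‖F s x‖ ≤ B) {P : ℝ} (hP0 : 0 ≤ P)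
    (hP : ∀ s ∈ Icc 0 q, ∀ z, f₀ z ≠ 0 → ‖(forward m q F s z).2‖ ≤ P) {D : ℝ}
    (hD : ∀ s ∈ Icc 0 q, DensityLe (cloud m q F f₀ s) D) {ε : ℝ} (hε : 0 < ε) {t : ℝ}
    (ht0 : 0 < t) (ht : t ≤ q) :
    |softEnergy m q F f₀ ε t - softEnergy m q F f₀ ε 0| ≤
      P * ((D * (∫ y in Metric.ball 0 1, ‖kernel y - softKernel ε y‖) +
        3 * ε ^ 2 * (massMeasure f₀).real univ) * (massMeasure f₀).real univ) * t := by
  have := hf.isFiniteMeasure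
  set ν := massMeasure f₀ with hν
  have hX : ∀ s ∈ Icc 0 q, Continuous fun z => (forward m q F s z).1 := fun s hs =>
    (H.continuous_forward hs).fst
  have hV : ∀ s ∈ Icc 0 q, Continuous fun z => (forward m q F s z).2 := fun s hs =>
    (H.continuous_forward hs).snd
  have hW : ∀ s ∈ Icc 0 q, Continuous fun z => m.velocity (forward m q F s z).2 := fun s hs =>
    (continuous_velocity m).comp (hV s hs)
  have hae : ∀ᵐ z ∂ν, ∀ s ∈ Icc 0 q, ‖(forward m q F s z).2‖ ≤ P :=
    hf.ae_massMeasure fun z hz s hs => hP s hs z hz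
  obtain ⟨hkc, hkd⟩ := hasDerivAt_integral_of_bound (ν := ν) (q := q)
    (φ := fun s z => m.particleEnergy (forward m q F s z).2)
    (φ' := fun s z => inner ℝ (m.velocity (forward m q F s z).2) (-F s (forward m q F s z).1))
    (A := 1 + P ^ 2) (A' := P * B)
    (fun s hs => ((continuous_particleEnergy m).comp (hV s hs)).aestronglyMeasurable)
    (fun s hs => ((hW s hs).inner
      ((H.toIsForce.continuous hs).comp (hX s hs)).neg).aestronglyMeasurable)
    (by
      filter_upwards [hae] with z hz s hs
      refine (abs_particleEnergy_le m _).trans ?_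
      have := pow_le_pow_left₀ (norm_nonneg _) (hz s hs) 2
      linarith)
    (by
      filter_upwards [hae] with z hz s hs
      refine (norm_inner_le_norm _ _).trans ?_
      rw [norm_neg]
      exact mul_le_mul ((norm_velocity_le m _).trans (hz s hs)) (hB s hs _) (norm_nonneg _) hP0)
    (fun z s hs => hasDerivWithinAt_particleEnergy m (H.hasDerivWithinAt_forward_snd z hs))
  obtain ⟨hpc, hpd⟩ := hasDerivAt_integral_of_bound (ν := ν.prod ν) (q := q)
    (φ := fun s p => (softNorm ε ((forward m q F s p.1).1 - (forward m q F s p.2).1))⁻¹)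
    (φ' := fun s p => -inner ℝ
        (softKernel ε ((forward m q F s p.1).1 - (forward m q F s p.2).1))
        (m.velocity (forward m q F s p.1).2 - m.velocity (forward m q F s p.2).2))
    (A := ε⁻¹) (A' := (ε ^ 2)⁻¹ * (P + P))
    (fun s hs => Continuous.aestronglyMeasurable (((continuous_softNorm ε).comp
      (((hX s hs).comp continuous_fst).sub ((hX s hs).comp continuous_snd))).inv₀
        fun _ => (softNorm_pos hε _).ne'))
    (fun s hs => Continuous.aestronglyMeasurable ((((continuous_softKernel hε).comp
      (((hX s hs).comp continuous_fst).sub ((hX s hs).comp continuous_snd))).inner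
        (((hW s hs).comp continuous_fst).sub ((hW s hs).comp continuous_snd))).neg))
    (Filter.Eventually.of_forall fun p s hs => by
      rw [Real.norm_of_nonneg (inv_nonneg.2 (softNorm_pos hε _).le)]
      exact inv_softNorm_le hε _)
    (by
      filter_upwards [Measure.quasiMeasurePreserving_fst.ae hae,
        Measure.quasiMeasurePreserving_snd.ae hae] with p h1 h2 s hs
      rw [norm_neg]
      refine (norm_inner_le_norm _ _).trans (mul_le_mul (norm_softKernel_le hε _)
        ((norm_sub_le _ _).trans (add_le_add ?_ ?_)) (norm_nonneg _) (by positivity))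
      · exact (norm_velocity_le m _).trans (h1 s hs)
      · exact (norm_velocity_le m _).trans (h2 s hs))
    (fun p s hs => hasDerivWithinAt_inv_softNorm hε
      ((H.hasDerivWithinAt_forward_fst p.1 hs).sub (H.hasDerivWithinAt_forward_fst p.2 hs)))
  have hsub : Icc 0 t ⊆ Icc 0 q := Icc_subset_Icc_right ht
  obtain ⟨s, hs, hslope⟩ := exists_hasDerivAt_eq_slope (softEnergy m q F f₀ ε) _ ht0
    ((hkc.sub (hpc.const_mul (1 / 2))).mono hsub)
    (fun s hs => (hkd s ⟨hs.1, hs.2.trans_le ht⟩).sub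
      ((hpd s ⟨hs.1, hs.2.trans_le ht⟩).const_mul (1 / 2)))
  have hs' : s ∈ Icc 0 q := hsub (Ioo_subset_Icc_self hs)
  have hb := H.abs_softEnergy_deriv_le hf hF hP hε hs' (hD s hs')
  rw [hslope, sub_zero, abs_div, abs_of_pos ht0, div_le_iff₀ ht0] at hb
  refine hb.trans ?_
  have h1 := ((hD s hs').integral_prod_comp_sub_le (measurable_norm_kernel_sub_softKernel ε)
    (fun _ => norm_nonneg _) (integrableOn_norm_kernel_sub_softKernel hε)
    fun y hy => (norm_kernel_sub_softKernel_le hε y).2 hy).2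
  rw [H.integral_prod_cloud hf hs' (measurable_norm_kernel_sub_softKernel ε)] at h1
  have h2 : (cloud m q F f₀ s).real univ = ν.real univ := by
    rw [cloud, map_measureReal_apply (H.measurable_forward_fst hs') MeasurableSet.univ,
      preimage_univ]
  rw [h2] at h1
  gcongr

theorem HasFlow.tendsto_softEnergy (H : HasFlow m q L F) (hf : IsState f₀) {D s : ℝ}
    (hs : s ∈ Icc 0 q) (hD : DensityLe (cloud m q F f₀ s) D) :
    Filter.Tendsto (fun ε => softEnergy m q F f₀ ε s) (𝓝[>] 0)
      (𝓝 (kineticEnergy m (fun z => f₀ (backward m q F s z)) +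
        potentialEnergy fun z => f₀ (backward m q F s z))) := by
  rw [H.kineticEnergy_comp_backward hf hs, H.potentialEnergy_comp_backward hf hs]
  have h := (hD.tendsto_integral_inv_softNorm.const_mul (-(1 / 2))).const_add
    (∫ z, m.particleEnergy (forward m q F s z).2 ∂massMeasure f₀)
  refine h.congr fun ε => ?_
  rw [H.integral_prod_cloud hf hs (φ := fun y => (softNorm ε y)⁻¹)
    (continuous_softNorm ε).measurable.inv, softEnergy]
  ring

/-- Conservation of energy. The singular potential is softened first; the softened energy is
differentiable, and its derivative tends to zero as the softening is removed. -/
theorem HasFlow.energy_comp_backward (H : HasFlow m q L F) (hf : IsState f₀)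
    (hF : ∀ s ∈ Icc 0 q, ∀ x, F s x =
      ∫ z, kernel (x - (forward m q F s z).1) ∂massMeasure f₀)
    {B : ℝ} (hB : ∀ s ∈ Icc 0 q, ∀ x, ‖F s x‖ ≤ B) {t : ℝ} (ht : t ∈ Icc 0 q) :
    kineticEnergy m (fun z => f₀ (backward m q F t z)) +
        potentialEnergy (fun z => f₀ (backward m q F t z)) =
      kineticEnergy m f₀ + potentialEnergy f₀ := by
  have h0 := HasFlow.zero_mem ht
  have e0 : (fun z => f₀ (backward m q F 0 z)) = f₀ := by
    ext z; rw [H.backward_zero h0.2]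
  rcases ht.1.eq_or_lt with rfl | ht0
  · rw [e0]
  obtain ⟨C, hC0, hC⟩ := hf.exists_bound
  obtain ⟨P, hP0, hP⟩ := H.exists_velocity_bound hf
  have hD := fun s hs => H.densityLe_cloud hf hC0 hC hs (hP s hs)
  have h1 := H.tendsto_softEnergy hf ht (hD t ht)
  have h2 := H.tendsto_softEnergy hf h0 (hD 0 h0)
  rw [e0] at h2
  have h3 := (h1.sub h2).abs
  have h4 : Filter.Tendsto (fun ε : ℝ => P * ((densityBound C P *
      (∫ y in Metric.ball (0 : Space) 1, ‖kernel y - softKernel ε y‖) +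
        3 * ε ^ 2 * (massMeasure f₀).real univ) * (massMeasure f₀).real univ) * t)
      (𝓝[>] 0) (𝓝 0) := by
    have h5 : Filter.Tendsto (fun ε : ℝ => 3 * ε ^ 2 * (massMeasure f₀).real univ)
        (𝓝[>] 0) (𝓝 0) := by
      have : Continuous fun ε : ℝ => 3 * ε ^ 2 * (massMeasure f₀).real univ := by fun_prop
      simpa using (this.tendsto 0).mono_left (nhdsWithin_le_nhds (s := Ioi 0))
    simpa using ((((tendsto_integral_norm_kernel_sub_softKernel.const_mul
      (densityBound C P)).add h5).mul_const ((massMeasure f₀).real univ)).const_mul P).mul_const t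
  have h6 := le_of_tendsto_of_tendsto h3 h4 (by
    filter_upwards [self_mem_nhdsWithin] with ε hε
    exact H.abs_softEnergy_sub_le hf hF hB hP0.le hP hD hε ht0 ht.2)
  exact sub_eq_zero.1 (abs_nonpos_iff.1 h6)

end

section

variable {m : Model} {f₀ : Phase → ℝ} {T : EReal} {f : ℝ → Phase → ℝ}

theorem IsSymmetricSolution.energy_eq (h : IsSymmetricSolution m f₀ T f) (hf : IsState f₀)
    {t : ℝ} (ht : t ∈ timeInterval T) :
    kineticEnergy m (f t) + potentialEnergy (f t) =
      kineticEnergy m f₀ + potentialEnergy f₀ := by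
  obtain ⟨q, hq0, htq, hqT⟩ := exists_real_btwn ht
  obtain ⟨L, H⟩ := h.exists_hasFlow hq0 hqT
  obtain ⟨B, hB⟩ := h.exists_field_bound hf hq0 hqT
  have ht' : t ∈ Icc 0 q := ⟨ht.1, htq.le⟩
  rw [funext (h.eq_transport hq0 hqT ht')]
  refine H.energy_comp_backward hf (fun s hs x => ?_) hB ht'
  rw [(h.isState hf (Icc_subset_timeInterval hqT hs)).field_eq_integral_kernel,
    funext (h.eq_transport hq0 hqT hs), H.massMeasure_comp_backward hf hs,
    integral_map (H.continuous_forward hs).measurable.aemeasurable]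
  exact (measurable_kernel.comp (by fun_prop)).aestronglyMeasurable

theorem IsSymmetricSolution.casimir_eq (h : IsSymmetricSolution m f₀ T f) (Φ : ℝ → ℝ)
    {t : ℝ} (ht : t ∈ timeInterval T) : casimir Φ (f t) = casimir Φ f₀ := by
  obtain ⟨q, hq0, htq, hqT⟩ := exists_real_btwn ht
  obtain ⟨L, H⟩ := h.exists_hasFlow hq0 hqT
  have ht' : t ∈ Icc 0 q := ⟨ht.1, htq.le⟩
  rw [funext (h.eq_transport hq0 hqT ht'), H.casimir_comp_backward ht']

end

end VlasovPoisson

end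

theorem theorem2p1 (m : VlasovPoisson.Model) (f₀ : VlasovPoisson.Phase → ℝ)
    (hf₀ : VlasovPoisson.IsState f₀) (hsymm : VlasovPoisson.SphericallySymmetric f₀) :
    ∃ (T : EReal) (f : ℝ → VlasovPoisson.Phase → ℝ),
      -- `f` is a spherically symmetric strong Lagrangian solution on `[0, T[`
      VlasovPoisson.IsSymmetricSolution m f₀ T f ∧
      -- each `f(t)` is a state, so it is non-negative and its energies are defined
      (∀ t ∈ VlasovPoisson.timeInterval T, VlasovPoisson.IsState (f t)) ∧
      -- uniqueness of solutions, and maximality of `T`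
      (∀ (T' : EReal) (g : ℝ → VlasovPoisson.Phase → ℝ),
        VlasovPoisson.IsSymmetricSolution m f₀ T' g →
          T' ≤ T ∧ ∀ t ∈ VlasovPoisson.timeInterval T', g t = f t) ∧
      -- the maximal solution is global in the non-relativistic case
      (m = VlasovPoisson.Model.nonrelativistic → T = ⊤) ∧
      -- the continuation criterion in the relativistic case
      (m = VlasovPoisson.Model.relativistic →
        BddAbove {p : ℝ | ∃ t ∈ VlasovPoisson.timeInterval T,
          ∃ z ∈ tsupport (f t), p = ‖z.2‖} → T = ⊤) ∧
      -- conservation of energy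
      (∀ t ∈ VlasovPoisson.timeInterval T,
        VlasovPoisson.kineticEnergy m (f t) + VlasovPoisson.potentialEnergy (f t) =
          VlasovPoisson.kineticEnergy m f₀ + VlasovPoisson.potentialEnergy f₀) ∧
      -- conservation of all Casimir functionals
      (∀ Φ : ℝ → ℝ, Continuous Φ → Φ 0 = 0 → ∀ t ∈ VlasovPoisson.timeInterval T,
        VlasovPoisson.casimir Φ (f t) = VlasovPoisson.casimir Φ f₀) := by
  obtain ⟨T₀, g₀, h₀⟩ := VlasovPoisson.exists_isSymmetricSolution m hf₀ hsymm
  have h := VlasovPoisson.isSymmetricSolution_maximalSolution hf₀ h₀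
  refine ⟨_, _, h, fun t ht => h.isState hf₀ ht, fun T' g hg => ⟨hg.le_lifespan, fun t ht =>
      (VlasovPoisson.maximalSolution_eq hf₀ hg ht).symm⟩, ?_,
    fun _ hb => VlasovPoisson.lifespan_eq_top_of_bddAbove hf₀ hsymm hb,
    fun t ht => h.energy_eq hf₀ ht, fun Φ _ _ t ht => h.casimir_eq Φ ht⟩
  rintro rfl
  exact VlasovPoisson.lifespan_nonrelativistic hf₀ hsymm
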